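/- Notation. Let $(z;q)_\infty=\prod_{j\ge 0}(1-zq^j)$ for $|q|<1$. For $\operatorname{Re}\beta>0$, $y\mapsto\log(e^{-y};e^{-\beta})_\infty$ denotes the branch of the logarithm that is analytic for $y\notin 2\pi\mathrm i\mathbb Z+\beta\mathbb R_{\le 0}$ and equals $\sum_{k\ge 0}\log(1-e^{-y-\beta k})$ (principal logarithms) for $\operatorname{Re}y>0$. $B_k$ are the Bernoulli numbers ($B_1=-\frac12$), $B_n(x)=\sum_{k=0}^n\binom nk B_kx^{n-k}$ the Bernoulli polynomials, $\zeta$ the Riemann zeta function, $\gamma$ Euler's constant, and $\operatorname{Li}_s(z)=\sum_{m\ge 1}z^m/m^s$ the polylogarithm, which for integers $s\le 0$ is the rational function $(z\,\frac{d}{dz})^{-s}\frac z{1-z}$. The powers of $\beta$ and $\log\beta$ have their principal values. Let $c\ge 0$ be real, fix $\theta=\arg\beta\in(-\pi/2,\pi/2)$, and let $x\in\mathbb C$. If $c=0$, assume that $x\notin 2\pi\mathrm i\mathbb Z+e^{\mathrm i\theta}\mathbb R_{\le 0}$. If $c>0$, assume that $x\notin e^{\mathrm i(1-c)\theta}\mathbb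 R_{\le 0}$. Then, as $\beta\to 0$ with $\arg\beta=\theta$, the function $F(\beta)=\log(e^{-x\beta^c};e^{-\beta})_\infty$ has the following asymptotic expansions. (i) If $c=0$, for every $N\ge 0$, $$F(\beta)=\sum_{k=0}^{N}\frac{(-1)^{k-1}B_k\operatorname{Li}_{2-k}(e^{-x})}{k!}\,\beta^{k-1}+\mathcal O(|\beta|^{N}),$$ where $\operatorname{Li}_1(e^{-x})$ and $\operatorname{Li}_2(e^{-x})$ are the branches that are analytic for $x\notin 2\pi\mathrm i\mathbb Z+e^{\mathrm i\theta}\mathbb R_{\le 0}$ and given by $\sum_{m\ge1}e^{-mx}/m^s$ for $\operatorname{Re}x>0$. (ii) If $0<c<1$, for all $M,P\ge 0$, $$\begin{aligned}F(\beta)={}&-\frac{\pi^2}{6}\beta^{-1}+x(1-\log x-c\log\beta)\beta^{c-1}+\frac c2\log\beta+\frac12\log x-\sum_{k=1}^{M}\frac{B_{2k}}{2k(2k-1)x^{2k-1}}\,\beta^{(1-c)(2k-1)}\\&-\sum_{n=1}^{P}\sum_{k=0}^{n+1}\frac{B_kB_nx^{n+1-k}}{k!\,n\,(n+1-k)!}\,\beta^{(1-c)(k-1)+cn}+\mathcal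 O\bigl(|\beta|^{\min((1-c)(2M+1),\,c(P+2)-1)}\bigr).\end{aligned}$$ (iii) If $c=1$, for every $N\ge 0$, $$F(\beta)=-\frac{\pi^2}{6}\beta^{-1}+\Bigl(\frac12-x\Bigr)\log\beta-\log\Gamma(x)+\frac12\log(2\pi)-\sum_{n=1}^{N}\frac{B_nB_{n+1}(x)}{n(n+1)!}\,\beta^n+\mathcal O(|\beta|^{N+1}),$$ where $\log\Gamma$ is the branch that is real-valued for $x>0$ and analytic for $x\notin\mathbb R_{\le 0}$. (iv) If $c>1$, for all $K\ge 1$ and $P\ge 0$, $$\begin{aligned}F(\beta)={}&-\frac{\pi^2}{6}\beta^{-1}+\Bigl(c-\frac12\Bigr)\log\beta+\log x+\frac12\log(2\pi)+x(\gamma-\log\beta)\beta^{c-1}-\sum_{k=2}^{K}\frac{\zeta(k)(-x)^k}{k}\,\beta^{(c-1)k}\\&-\sum_{n=1}^{P}\sum_{k=0}^{n+1}\frac{B_kB_nx^{n+1-k}}{k!\,n\,(n+1-k)!}\,\beta^{k-1+c(n+1-k)}+\mathcal O\bigl(|\beta|^{\min((c-1)(K+1),\,P+1)}\bigr).\end{aligned}$$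 In (ii) and (iv), $\log x$ is the branch that is analytic for $x\notin e^{\mathrm i(1-c)\theta}\mathbb R_{\le 0}$ and normalized by $\log x=\log|x|+\mathrm i(1-c)\theta$ for $x\in e^{\mathrm i(1-c)\theta}\mathbb R_{>0}$; if $|(1-c)\theta|<\pi$ (in particular in (ii)), this is the branch that is real-valued for $x>0$. The implied constants depend only on $\theta,c,x$ and the truncation orders. -/

import Mathlib

open Filter Topology Asymptotics

/-- The complement of the cuts `2πi ℤ + u ℝ_{≤ 0}`. -/
def slitDomain (u : ℂ) : Set ℂ :=
  {y | ∀ (n : ℤ) (t : ℝ), 0 ≤ t → y ≠ 2 * Real.pi * Complex.I * n - t * u}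

/-- `Li_{-n}(z) = (z d/dz)^n (z / (1 - z))`, a rational function with its only pole at `z = 1`. -/
noncomputable def polylogNonpos (n : ℕ) : ℂ → ℂ :=
  (fun (g : ℂ → ℂ) (z : ℂ) => z * deriv g z)^[n] (fun z => z / (1 - z))

/-- The integral of `f` along the ray from `x` to infinity in the direction `u`. -/
noncomputable def rayIntegral (u : ℂ) (f : ℂ → ℂ) (x : ℂ) : ℂ :=
  u * ∫ t in Set.Ioi (0 : ℝ), f (x + t * u)

/-- `Li_s(e^{-x})` for an integer `s`. For `s ≤ 0` it is the rational function of `e^{-x}` above.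
For `s ≥ 1` it is the branch that is analytic outside the cuts `2πi ℤ + u ℝ_{≤ 0}` and equal to
`∑_{m ≥ 1} e^{-mx} / m^s` for `Re x > 0`, obtained by integrating
`d/dx Li_s(e^{-x}) = - Li_{s-1}(e^{-x})` along rays that do not meet the cuts;
see `hasSum_polylogExp` and `differentiableOn_polylogExp`. -/
noncomputable def polylogExp (u : ℂ) (s : ℤ) : ℂ → ℂ :=
  (rayIntegral u)^[s.toNat] (fun w => polylogNonpos (-s).toNat (Complex.exp (-w)))

theorem mem_slitDomain_iff {u y : ℂ} :
    y ∈ slitDomain u ↔ ∀ t : ℝ, 0 ≤ t → Complex.exp (y + t * u) ≠ 1 := by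
  constructor
  · intro h t ht he
    obtain ⟨n, hn⟩ := Complex.exp_eq_one_iff.1 he
    exact h n t ht (by linear_combination hn)
  · intro h n t ht he
    exact h t ht (Complex.exp_eq_one_iff.2 ⟨n, by rw [he]; ring⟩)

theorem slitDomain_of_re_pos {u y : ℂ} (hu : 0 < u.re) (hy : 0 < y.re) : y ∈ slitDomain u := by
  rw [mem_slitDomain_iff]
  intro t ht he
  have h1 : ‖Complex.exp (y + t * u)‖ = 1 := by rw [he]; simp
  rw [Complex.norm_exp, Real.exp_eq_one_iff] at h1
  simp at h1
  nlinarith [mul_nonneg ht hu.le]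

theorem slitDomain_add {u y : ℂ} (hy : y ∈ slitDomain u) {t : ℝ} (ht : 0 ≤ t) :
    y + t * u ∈ slitDomain u := by
  rw [mem_slitDomain_iff] at *
  intro s hs
  have := hy (t + s) (by positivity)
  rwa [show y + t * u + s * u = y + ((t + s : ℝ) : ℂ) * u by push_cast; ring]

theorem isOpen_slitDomain {u : ℂ} (hu : 0 < u.re) : IsOpen (slitDomain u) := by
  rw [isOpen_iff_mem_nhds]
  intro y hy
  rw [mem_slitDomain_iff] at hy
  set T : ℝ := (‖y‖ + 2) / u.re with hT
  have hopen : IsOpen {p : ℂ × ℝ | Complex.exp (p.1 + p.2 * u) ≠ 1} :=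
    isOpen_ne_fun (by fun_prop) (by fun_prop)
  have hsub : ({y} : Set ℂ) ×ˢ Set.Icc (0 : ℝ) T ⊆
      {p : ℂ × ℝ | Complex.exp (p.1 + p.2 * u) ≠ 1} := by
    rintro ⟨a, t⟩ ⟨ha, ht⟩
    simp only [Set.mem_singleton_iff] at ha
    subst ha
    exact hy t ht.1
  obtain ⟨v, w, hv, -, hyv, hw, hvw⟩ :=
    generalized_tube_lemma isCompact_singleton isCompact_Icc hopen hsub
  filter_upwards [hv.mem_nhds (hyv rfl), Metric.ball_mem_nhds y one_pos] with z hz hz'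
  rw [mem_slitDomain_iff]
  intro t ht
  by_cases htT : t ≤ T
  · exact hvw (Set.mk_mem_prod hz (hw ⟨ht, htT⟩))
  · intro he
    have h1 : ‖Complex.exp (z + t * u)‖ = 1 := by rw [he]; simp
    rw [Complex.norm_exp, Real.exp_eq_one_iff] at h1
    simp at h1
    have h2 : ‖y‖ + 2 < t * u.re := by
      rw [not_le, hT, div_lt_iff₀ hu] at htT; exact htT
    have h3 : |z.re - y.re| < 1 := by
      have := Complex.abs_re_le_norm (z - y)
      rw [Metric.mem_ball, dist_eq_norm] at hz'
      simp at this
      linarith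
    have h4 := Complex.abs_re_le_norm y
    have := abs_lt.1 h3
    have := abs_le.1 h4
    linarith

theorem rayBound {u : ℂ} (hu : 0 < u.re) {f : ℂ → ℂ} (hf : ContinuousOn f (slitDomain u))
    {C : ℝ} (hC : ∀ w : ℂ, 1 ≤ w.re → ‖f w‖ ≤ C * Real.exp (-w.re))
    {K : Set ℂ} (hK : IsCompact K) (hKs : K ⊆ slitDomain u) :
    ∃ M : ℝ, 0 ≤ M ∧ ∀ y ∈ K, ∀ t : ℝ, 0 ≤ t → ‖f (y + t * u)‖ ≤ M * Real.exp (-(t * u.re)) := by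
  obtain ⟨R, hR⟩ := hK.isBounded.exists_norm_le
  set T : ℝ := (R + 1) / u.re with hT
  have hcont : ContinuousOn (fun p : ℂ × ℝ => f (p.1 + p.2 * u)) (K ×ˢ Set.Icc 0 T) := by
    refine hf.comp (by fun_prop) ?_
    rintro ⟨a, t⟩ ⟨ha, ht⟩
    exact slitDomain_add (hKs ha) ht.1
  obtain ⟨M, hM⟩ := (hK.prod isCompact_Icc).exists_bound_of_continuousOn hcont
  refine ⟨max (|M| * Real.exp (T * u.re)) (|C| * Real.exp R), by positivity, ?_⟩
  intro y hy t ht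
  have hRe := abs_le.1 ((Complex.abs_re_le_norm y).trans (hR y hy))
  by_cases htT : t ≤ T
  · calc ‖f (y + t * u)‖ ≤ M := hM (y, t) ⟨hy, ht, htT⟩
      _ ≤ |M| := le_abs_self M
      _ = |M| * 1 := by ring
      _ ≤ |M| * Real.exp (T * u.re + -(t * u.re)) := by
          gcongr
          rw [Real.one_le_exp_iff]
          nlinarith
      _ = |M| * Real.exp (T * u.re) * Real.exp (-(t * u.re)) := by rw [Real.exp_add]; ring
      _ ≤ _ := by gcongr; exact le_max_left _ _
  · have h2 : R + 1 < t * u.re := by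
      rw [not_le, hT, div_lt_iff₀ hu] at htT; exact htT
    have h3 : (y + t * u).re = y.re + t * u.re := by simp
    calc ‖f (y + t * u)‖ ≤ C * Real.exp (-(y + t * u).re) := hC _ (by rw [h3]; linarith)
      _ ≤ |C| * Real.exp (R + -(t * u.re)) := by
          gcongr
          · exact le_abs_self C
          · rw [h3]; linarith
      _ = |C| * Real.exp R * Real.exp (-(t * u.re)) := by rw [Real.exp_add]; ring
      _ ≤ _ := by gcongr; exact le_max_right _ _

theorem rayIntegral_good {u : ℂ} (hu : 0 < u.re) {f : ℂ → ℂ}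
    (hf : DifferentiableOn ℂ f (slitDomain u))
    (hC : ∃ C : ℝ, ∀ w : ℂ, 1 ≤ w.re → ‖f w‖ ≤ C * Real.exp (-w.re)) :
    DifferentiableOn ℂ (rayIntegral u f) (slitDomain u) ∧
      ∃ C : ℝ, ∀ w : ℂ, 1 ≤ w.re → ‖rayIntegral u f w‖ ≤ C * Real.exp (-w.re) := by
  obtain ⟨C, hC⟩ := hC
  have hint : MeasureTheory.IntegrableOn (fun t : ℝ => Real.exp (-(t * u.re))) (Set.Ioi 0) := by
    have := exp_neg_integrableOn_Ioi 0 hu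
    refine this.congr_fun (fun t _ => ?_) measurableSet_Ioi
    simp [mul_comm]
  have hmeas : ∀ g : ℂ → ℂ, ContinuousOn g (slitDomain u) → ∀ x ∈ slitDomain u,
      MeasureTheory.AEStronglyMeasurable (fun t : ℝ => g (x + t * u))
        (MeasureTheory.volume.restrict (Set.Ioi 0)) := by
    intro g hg x hx
    refine ContinuousOn.aestronglyMeasurable ?_ measurableSet_Ioi
    refine hg.comp (by fun_prop) ?_
    intro t ht
    exact slitDomain_add hx (le_of_lt ht)
  refine ⟨?_, ?_⟩
  · intro x hx
    refine DifferentiableAt.differentiableWithinAt ?_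
    obtain ⟨ε, hε, hball⟩ := Metric.isOpen_iff.1 (isOpen_slitDomain hu) x hx
    have hcb : Metric.closedBall x (ε / 2) ⊆ slitDomain u :=
      (Metric.closedBall_subset_ball (by linarith)).trans hball
    obtain ⟨M, hM0, hM⟩ := rayBound hu hf.continuousOn hC (isCompact_closedBall x (ε / 2)) hcb
    refine DifferentiableAt.const_mul ?_ _
    have hs : Metric.ball x (ε / 4) ∈ 𝓝 x := Metric.ball_mem_nhds x (by linarith)
    have hfd : DifferentiableOn ℂ (deriv f) (slitDomain u) := hf.deriv (isOpen_slitDomain hu)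
    refine (hasDerivAt_integral_of_dominated_loc_of_deriv_le
      (F' := fun y t => deriv f (y + t * u))
      (bound := fun t => M / (ε / 4) * Real.exp (-(t * u.re))) hs ?_ ?_ ?_ ?_ ?_ ?_).2.differentiableAt
    · filter_upwards [(isOpen_slitDomain hu).mem_nhds hx] with y hy
      exact hmeas f hf.continuousOn y hy
    · refine MeasureTheory.Integrable.mono' (hint.const_mul M) (hmeas f hf.continuousOn x hx) ?_
      filter_upwards [MeasureTheory.ae_restrict_mem measurableSet_Ioi] with t ht
      exact hM x (Metric.mem_closedBall_self (by linarith)) t (le_of_lt ht)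
    · exact hmeas _ hfd.continuousOn x hx
    · filter_upwards [MeasureTheory.ae_restrict_mem measurableSet_Ioi] with t ht y hy
      have hsub : ∀ z ∈ Metric.closedBall (y + t * u) (ε / 4),
          z - t * u ∈ Metric.closedBall x (ε / 2) := by
        intro z hz
        rw [Metric.mem_closedBall, dist_eq_norm] at *
        rw [Metric.mem_ball, dist_eq_norm] at hy
        calc ‖z - t * u - x‖ = ‖(z - (y + t * u)) + (y - x)‖ := by congr 1; ring
          _ ≤ ‖z - (y + t * u)‖ + ‖y - x‖ := norm_add_le _ _
          _ ≤ _ := by linarith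
      have hin : Metric.closedBall (y + t * u) (ε / 4) ⊆ slitDomain u := by
        intro z hz
        have := slitDomain_add (hcb (hsub z hz)) (le_of_lt ht)
        simpa using this
      have := Complex.norm_deriv_le_of_forall_mem_sphere_norm_le (f := f) (c := y + t * u)
        (R := ε / 4) (C := M * Real.exp (-(t * u.re))) (by linarith)
        (DifferentiableOn.diffContOnCl (hf.mono (by
          rw [closure_ball _ (by linarith : ε / 4 ≠ 0)]
          exact hin))) (by
          intro z hz
          have := hM _ (hsub z (Metric.sphere_subset_closedBall hz)) t (le_of_lt ht)
          simpa using this)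
      calc _ ≤ _ := this
        _ = _ := by ring
    · exact hint.const_mul _
    · filter_upwards [MeasureTheory.ae_restrict_mem measurableSet_Ioi] with t ht y hy
      have hy' : y ∈ slitDomain u := hcb (Metric.ball_subset_closedBall
        (Metric.ball_subset_ball (by linarith) hy))
      have h1 := (hf.differentiableAt ((isOpen_slitDomain hu).mem_nhds
        (slitDomain_add hy' (le_of_lt ht)))).hasDerivAt
      exact h1.comp_add_const y (t * u)
  · refine ⟨‖u‖ * (C * ∫ t in Set.Ioi (0 : ℝ), Real.exp (-(t * u.re))), fun w hw => ?_⟩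
    rw [rayIntegral, norm_mul, mul_assoc]
    gcongr
    calc ‖∫ t in Set.Ioi (0 : ℝ), f (w + t * u)‖
        ≤ ∫ t in Set.Ioi (0 : ℝ), C * Real.exp (-w.re) * Real.exp (-(t * u.re)) := by
          refine MeasureTheory.norm_integral_le_of_norm_le (hint.const_mul _) ?_
          filter_upwards [MeasureTheory.ae_restrict_mem measurableSet_Ioi] with t ht
          have h3 : (w + t * u).re = w.re + t * u.re := by simp
          have h4 : 0 ≤ t * u.re := mul_nonneg (le_of_lt ht) hu.le
          refine (hC _ (by rw [h3]; linarith)).trans (le_of_eq ?_)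
          rw [h3, neg_add, Real.exp_add]; ring
      _ = _ := by rw [MeasureTheory.integral_const_mul]; ring

theorem differentiableOn_polylogNonpos (n : ℕ) :
    DifferentiableOn ℂ (polylogNonpos n) {z | z ≠ 1} := by
  have hopen : IsOpen {z : ℂ | z ≠ 1} := isOpen_ne
  induction n with
  | zero =>
    intro z hz
    refine DifferentiableAt.differentiableWithinAt ?_
    refine DifferentiableAt.div (by fun_prop) (by fun_prop) ?_
    exact sub_ne_zero.2 (Ne.symm hz)
  | succ n ih =>
    have : polylogNonpos (n + 1) = fun z => z * deriv (polylogNonpos n) z := by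
      unfold polylogNonpos
      rw [Function.iterate_succ_apply']
    rw [this]
    exact differentiableOn_id.mul (ih.deriv hopen)

theorem exp_neg_ne_one {u y : ℂ} (hy : y ∈ slitDomain u) : Complex.exp (-y) ≠ 1 := by
  intro h
  rw [mem_slitDomain_iff] at hy
  apply hy 0 le_rfl
  rw [Complex.exp_neg, inv_eq_one] at h
  simpa using h

theorem polylogExp_good {u : ℂ} (hu : 0 < u.re) (s : ℕ) :
    DifferentiableOn ℂ (polylogExp u s) (slitDomain u) ∧
      ∃ C : ℝ, ∀ w : ℂ, 1 ≤ w.re → ‖polylogExp u s w‖ ≤ C * Real.exp (-w.re) := by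
  induction s with
  | zero =>
    have h0 : polylogExp u ((0 : ℕ) : ℤ) = fun w => polylogNonpos 0 (Complex.exp (-w)) := by
      simp [polylogExp]
    rw [h0]
    refine ⟨?_, 2, ?_⟩
    · exact (differentiableOn_polylogNonpos 0).comp (by fun_prop) (fun y hy => exp_neg_ne_one hy)
    · intro w hw
      simp only [polylogNonpos, Function.iterate_zero, id]
      rw [norm_div, Complex.norm_exp, Complex.neg_re]
      have h1 : Real.exp (-w.re) ≤ 1 / 2 := by
        have : (2 : ℝ) ≤ Real.exp w.re := by linarith [Real.add_one_le_exp w.re]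
        rw [Real.exp_neg, ← one_div]
        exact one_div_le_one_div_of_le (by norm_num) this
      have h2 : 1 / 2 ≤ ‖1 - Complex.exp (-w)‖ := by
        have := norm_sub_norm_le (1 : ℂ) (Complex.exp (-w))
        rw [Complex.norm_exp, Complex.neg_re, norm_one] at this
        linarith
      rw [div_le_iff₀ (by linarith)]
      nlinarith [Real.exp_pos (-w.re)]
  | succ n ih =>
    have : polylogExp u ((n + 1 : ℕ) : ℤ) = rayIntegral u (polylogExp u (n : ℤ)) := by
      unfold polylogExp
      have e1 : (-((n + 1 : ℕ) : ℤ)).toNat = 0 := by omega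
      have e2 : (-(n : ℤ)).toNat = 0 := by omega
      rw [e1, e2, Int.toNat_natCast, Int.toNat_natCast, Function.iterate_succ_apply']
    rw [this]
    exact rayIntegral_good hu ih.1 ih.2

theorem differentiableOn_polylogExp {u : ℂ} (hu : 0 < u.re) (s : ℤ) :
    DifferentiableOn ℂ (polylogExp u s) (slitDomain u) := by
  rcases le_total 0 s with hs | hs
  · lift s to ℕ using hs
    exact (polylogExp_good hu s).1
  · have : polylogExp u s = fun w => polylogNonpos (-s).toNat (Complex.exp (-w)) := by
      unfold polylogExp
      rw [Int.toNat_of_nonpos hs]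
      rfl
    rw [this]
    exact (differentiableOn_polylogNonpos _).comp (by fun_prop) (fun y hy => exp_neg_ne_one hy)

theorem hasSum_polylogNonpos (n : ℕ) {z : ℂ} (hz : ‖z‖ < 1) :
    HasSum (fun m : ℕ => ((m : ℂ) + 1) ^ n * z ^ (m + 1)) (polylogNonpos n z) := by
  induction n generalizing z with
  | zero =>
    have := (hasSum_geometric_of_norm_lt_one hz).mul_left z
    simp only [polylogNonpos, Function.iterate_zero, id, pow_zero, one_mul]
    rw [div_eq_mul_inv]
    exact this.congr_fun (fun m => by ring)
  | succ n ih =>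
    have e : polylogNonpos (n + 1) = fun z => z * deriv (polylogNonpos n) z := by
      unfold polylogNonpos
      rw [Function.iterate_succ_apply']
    rw [e]
    obtain ⟨r, hzr, hr1⟩ := exists_between hz
    have hr0 : 0 ≤ r := (norm_nonneg z).trans hzr.le
    have hsum : Summable (fun m : ℕ => ((m : ℝ) + 1) ^ n * r ^ (m + 1)) := by
      have := summable_pow_mul_geometric_of_norm_lt_one (R := ℝ) n
        (r := r) (by rwa [Real.norm_of_nonneg hr0])
      have := (summable_nat_add_iff 1).2 this
      simpa using this
    have hz' : z ∈ Metric.ball (0 : ℂ) r := by simpa using hzr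
    have hd := Complex.hasSum_deriv_of_summable_norm (U := Metric.ball (0 : ℂ) r)
      (F := fun (m : ℕ) (w : ℂ) => ((m : ℂ) + 1) ^ n * w ^ (m + 1)) hsum
      (fun m => by fun_prop) Metric.isOpen_ball (by
        intro m w hw
        have hw' : ‖w‖ ≤ r := by simpa using (Metric.mem_ball.1 hw).le
        rw [norm_mul, norm_pow, norm_pow]
        have : ‖(m : ℂ) + 1‖ = (m : ℝ) + 1 := by
          rw [← Nat.cast_succ, Complex.norm_natCast]; simp
        rw [this]
        gcongr) hz'
    have heq : (fun w : ℂ => ∑' m : ℕ, ((m : ℂ) + 1) ^ n * w ^ (m + 1)) =ᶠ[𝓝 z]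
        polylogNonpos n := by
      filter_upwards [Metric.isOpen_ball.mem_nhds hz'] with w hw
      have hw' : ‖w‖ < 1 := by
        have : ‖w‖ < r := by simpa using hw
        linarith
      exact (ih hw').tsum_eq
    rw [heq.deriv_eq] at hd
    have := hd.mul_left z
    refine this.congr_fun (fun m => ?_)
    rw [deriv_const_mul _ (by fun_prop)]
    simp
    ring

theorem hasSum_polylogExp {u : ℂ} (hu : 0 < u.re) (s : ℤ) {x : ℂ} (hx : 0 < x.re) :
    HasSum (fun m : ℕ => Complex.exp (-((m : ℂ) + 1) * x) / ((m : ℂ) + 1) ^ s)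
      (polylogExp u s x) := by
  have hexp : ∀ (y : ℂ) (m : ℕ),
      Complex.exp (-((m : ℂ) + 1) * y) = Complex.exp (-y) ^ (m + 1) := by
    intro y m
    rw [← Complex.exp_nat_mul]; congr 1; push_cast; ring
  have base : ∀ (k : ℕ) (y : ℂ), 0 < y.re →
      HasSum (fun m : ℕ => Complex.exp (-((m : ℂ) + 1) * y) / ((m : ℂ) + 1) ^ (-(k : ℤ)))
        (polylogNonpos k (Complex.exp (-y))) := by
    intro k y hy
    have h1 : ‖Complex.exp (-y)‖ < 1 := by
      rw [Complex.norm_exp, Real.exp_lt_one_iff]; simpa using hy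
    refine (hasSum_polylogNonpos k h1).congr_fun (fun m => ?_)
    rw [hexp, zpow_neg, zpow_natCast, div_inv_eq_mul, mul_comm]
  rcases le_total s 0 with hs | hs
  · have e : polylogExp u s = fun w => polylogNonpos (-s).toNat (Complex.exp (-w)) := by
      unfold polylogExp
      rw [Int.toNat_of_nonpos hs]
      rfl
    rw [e]
    have := base (-s).toNat x hx
    rwa [Int.toNat_of_nonneg (by omega), neg_neg] at this
  · lift s to ℕ using hs
    induction s generalizing x with
    | zero =>
      have := base 0 x hx
      simpa [polylogExp] using this
    | succ n ih =>
      have e : polylogExp u ((n + 1 : ℕ) : ℤ) = rayIntegral u (polylogExp u (n : ℤ)) := by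
        unfold polylogExp
        have e1 : (-((n + 1 : ℕ) : ℤ)).toNat = 0 := by omega
        have e2 : (-(n : ℤ)).toNat = 0 := by omega
        rw [e1, e2, Int.toNat_natCast, Int.toNat_natCast, Function.iterate_succ_apply']
      have hu0 : u ≠ 0 := by rintro rfl; simp at hu
      have hm0 : ∀ m : ℕ, ((m : ℂ) + 1) ≠ 0 := fun m => Nat.cast_add_one_ne_zero m
      have hre : ∀ m : ℕ, (-((m : ℂ) + 1) * u).re < 0 := by
        intro m
        have : (-((m : ℂ) + 1) * u).re = -(((m : ℝ) + 1) * u.re) := by simp; ring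
        rw [this, neg_lt_zero]
        positivity
      set F : ℕ → ℝ → ℂ := fun m t =>
        Complex.exp (-((m : ℂ) + 1) * (x + t * u)) / ((m : ℂ) + 1) ^ (n : ℤ) with hF
      have hFeq : ∀ m t, F m t = Complex.exp (-((m : ℂ) + 1) * x) / ((m : ℂ) + 1) ^ (n : ℤ) *
          Complex.exp (-((m : ℂ) + 1) * u * t) := by
        intro m t
        simp only [hF]
        rw [show -((m : ℂ) + 1) * (x + t * u) = -((m : ℂ) + 1) * x + -((m : ℂ) + 1) * u * t by ring,
          Complex.exp_add]
        ring
      have hFint : ∀ m, MeasureTheory.Integrable (F m)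
          (MeasureTheory.volume.restrict (Set.Ioi 0)) := by
        intro m
        have h := (integrableOn_exp_mul_complex_Ioi (hre m) 0).const_mul
          (Complex.exp (-((m : ℂ) + 1) * x) / ((m : ℂ) + 1) ^ (n : ℤ))
        refine h.congr (Filter.Eventually.of_forall fun t => (hFeq m t).symm)
      have hint : MeasureTheory.IntegrableOn (fun t : ℝ => Real.exp (-(t * u.re)))
          (Set.Ioi 0) := by
        have := exp_neg_integrableOn_Ioi 0 hu
        refine this.congr_fun (fun t _ => ?_) measurableSet_Ioi
        simp [mul_comm]
      have hFsum : Summable fun m => ∫ t in Set.Ioi (0 : ℝ), ‖F m t‖ := by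
        have hg : Summable (fun m : ℕ => Real.exp (-x.re) ^ (m + 1) *
            ∫ t in Set.Ioi (0 : ℝ), Real.exp (-(t * u.re))) := by
          refine Summable.mul_right _ ?_
          refine (summable_nat_add_iff 1).2 (summable_geometric_of_lt_one (Real.exp_pos _).le ?_)
          rw [Real.exp_lt_one_iff]; linarith
        refine hg.of_nonneg_of_le
          (fun m => MeasureTheory.integral_nonneg fun t => norm_nonneg _) (fun m => ?_)
        rw [← MeasureTheory.integral_const_mul]
        refine MeasureTheory.integral_mono_ae (hFint m).norm (hint.const_mul _) ?_
        filter_upwards [MeasureTheory.ae_restrict_mem measurableSet_Ioi] with t ht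
        have ht0 : (0 : ℝ) < t := ht
        have h1 : 1 ≤ ‖((m : ℂ) + 1) ^ (n : ℤ)‖ := by
          rw [zpow_natCast, norm_pow]
          have : ‖(m : ℂ) + 1‖ = (m : ℝ) + 1 := by
            rw [← Nat.cast_succ, Complex.norm_natCast]; simp
          rw [this]
          exact one_le_pow₀ (by linarith [Nat.cast_nonneg (α := ℝ) m])
        simp only [hF]
        rw [norm_div, Complex.norm_exp]
        refine (div_le_self (Real.exp_pos _).le h1).trans ?_
        rw [← Real.exp_nat_mul, ← Real.exp_add]
        apply Real.exp_le_exp.2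
        have : (-((m : ℂ) + 1) * (x + t * u)).re = -(((m : ℝ) + 1) * (x.re + t * u.re)) := by
          simp; ring
        rw [this]
        push_cast
        have h2 : 0 ≤ (m : ℝ) * (t * u.re) := by positivity
        nlinarith
      have key := MeasureTheory.hasSum_integral_of_summable_integral_norm hFint hFsum
      have hval : ∫ t in Set.Ioi (0 : ℝ), ∑' m, F m t =
          ∫ t in Set.Ioi (0 : ℝ), polylogExp u (n : ℤ) (x + t * u) := by
        refine MeasureTheory.setIntegral_congr_fun measurableSet_Ioi (fun t ht => ?_)
        have ht0 : (0 : ℝ) < t := ht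
        refine (ih (x := x + t * u) ?_).tsum_eq
        have : (x + t * u).re = x.re + t * u.re := by simp
        rw [this]; positivity
      rw [hval] at key
      rw [e]
      refine (key.mul_left u).congr_fun (fun m => ?_)
      have h3 : ∫ t in Set.Ioi (0 : ℝ), F m t =
          Complex.exp (-((m : ℂ) + 1) * x) / ((m : ℂ) + 1) ^ (n : ℤ) *
            (-Complex.exp (-((m : ℂ) + 1) * u * (0 : ℝ)) / (-((m : ℂ) + 1) * u)) := by
        rw [← integral_exp_mul_complex_Ioi (hre m) 0, ← MeasureTheory.integral_const_mul]
        exact MeasureTheory.integral_congr_ae (Filter.Eventually.of_forall fun t => hFeq m t)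
      rw [h3]
      have := hm0 m
      simp only [zpow_natCast, Complex.ofReal_zero, mul_zero, Complex.exp_zero]
      field_simp
      ring

/-- The `q`-Pochhammer symbol `(z; q)_∞`. -/
noncomputable def qPochhammer (z q : ℂ) : ℂ := ∏' j : ℕ, (1 - z * q ^ j)

/-- `log (e^{-y}; e^{-β})_∞` for `Re β > 0`: the branch that is analytic outside the cuts
`2πi ℤ + β ℝ_{≤ 0}` and vanishes as `Re y → ∞`, written as
`∑_{k ≥ 0} log (1 - e^{-y-βk}) = - ∑_{k ≥ 0} Li_1(e^{-y-βk})`, with the branch of `Li_1(e^{-w})` that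
is analytic outside these cuts. -/
noncomputable def logQPochhammer (β y : ℂ) : ℂ := -∑' k : ℕ, polylogExp β 1 (y + k * β)

theorem polylogExp_one_of_re_pos {u : ℂ} (hu : 0 < u.re) {x : ℂ} (hx : 0 < x.re) :
    polylogExp u 1 x = -Complex.log (1 - Complex.exp (-x)) := by
  have h1 : ‖Complex.exp (-x)‖ < 1 := by
    rw [Complex.norm_exp, Real.exp_lt_one_iff]; simpa using hx
  have h2 := (hasSum_nat_add_iff' 1).2 (Complex.hasSum_taylorSeries_neg_log h1)
  simp only [Finset.range_one, Finset.sum_singleton, pow_zero, Nat.cast_zero, div_zero,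
    sub_zero] at h2
  refine (hasSum_polylogExp hu 1 hx).unique (h2.congr_fun fun m => ?_)
  rw [← Complex.exp_nat_mul, zpow_one]
  push_cast
  congr 2
  ring

theorem isPreconnected_slitDomain {u : ℂ} (hu : 0 < u.re) : IsPreconnected (slitDomain u) := by
  set H : Set ℂ := {z | 0 < z.re} with hH
  have hHc : IsPreconnected H := (convex_halfSpace_re_gt 0).isPreconnected
  have hHs : H ⊆ slitDomain u := fun z hz => slitDomain_of_re_pos hu hz
  refine isPreconnected_of_forall (1 : ℂ) (fun y hy => ?_)
  refine ⟨H ∪ (fun t : ℝ => y + t * u) '' Set.Ici 0, ?_, ?_, ?_, ?_⟩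
  · refine Set.union_subset hHs ?_
    rintro _ ⟨t, ht, rfl⟩
    exact slitDomain_add hy ht
  · left; simp [hH]
  · right; exact ⟨0, by simp, by simp⟩
  · have hT : 0 ≤ (‖y‖ + 1) / u.re := by positivity
    refine IsPreconnected.union (y + ((‖y‖ + 1) / u.re : ℝ) * u) ?_ ⟨_, hT, rfl⟩ hHc ?_
    · have h1 : (y + ((‖y‖ + 1) / u.re : ℝ) * u).re = y.re + (‖y‖ + 1) := by
        rw [Complex.add_re, Complex.re_ofReal_mul]
        field_simp
      have h2 := (abs_le.1 (Complex.abs_re_le_norm y)).1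
      simp only [hH, Set.mem_ofPred_eq, h1]
      linarith
    · exact isPreconnected_Ici.image _ (by fun_prop)

theorem exp_neg_polylogExp_one {u : ℂ} (hu : 0 < u.re) {x : ℂ} (hx : x ∈ slitDomain u) :
    Complex.exp (-polylogExp u 1 x) = 1 - Complex.exp (-x) := by
  have hA : AnalyticOnNhd ℂ (fun x => Complex.exp (-polylogExp u 1 x)) (slitDomain u) :=
    DifferentiableOn.analyticOnNhd (differentiableOn_polylogExp hu 1).neg.cexp
      (isOpen_slitDomain hu)
  have hB : AnalyticOnNhd ℂ (fun x => 1 - Complex.exp (-x)) (slitDomain u) :=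
    DifferentiableOn.analyticOnNhd (by fun_prop) (isOpen_slitDomain hu)
  refine hA.eqOn_of_preconnected_of_eventuallyEq hB (isPreconnected_slitDomain hu)
    (z₀ := 1) (slitDomain_of_re_pos hu (by simp)) ?_ hx
  have hopen : IsOpen {z : ℂ | 0 < z.re} := isOpen_lt continuous_const Complex.continuous_re
  filter_upwards [hopen.mem_nhds (show (1 : ℂ) ∈ {z : ℂ | 0 < z.re} by simp)] with z hz
  rw [polylogExp_one_of_re_pos hu hz, neg_neg, Complex.exp_log]
  rw [sub_ne_zero]
  exact (exp_neg_ne_one (slitDomain_of_re_pos hu hz)).symm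

theorem summable_polylogExp_one {β y : ℂ} (hβ : 0 < β.re) (hy : y ∈ slitDomain β) :
    Summable fun k : ℕ => polylogExp β 1 (y + k * β) := by
  obtain ⟨hd, C, hC⟩ := polylogExp_good hβ 1
  obtain ⟨M, -, hM⟩ := rayBound hβ hd.continuousOn hC (K := {y}) isCompact_singleton (by simpa)
  have hg : Summable (fun k : ℕ => M * Real.exp (-β.re) ^ k) :=
    (summable_geometric_of_lt_one (Real.exp_pos _).le
      (by rw [Real.exp_lt_one_iff]; linarith)).mul_left _
  refine Summable.of_norm_bounded hg (fun k => ?_)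
  have := hM y rfl k (by positivity)
  rw [← Real.exp_nat_mul]
  simpa using this

theorem logQPochhammer_of_re_pos {β y : ℂ} (hβ : 0 < β.re) (hy : 0 < y.re) :
    HasSum (fun k : ℕ => Complex.log (1 - Complex.exp (-y - β * k))) (logQPochhammer β y) := by
  have h := (summable_polylogExp_one hβ (slitDomain_of_re_pos hβ hy)).hasSum.neg
  refine h.congr_fun ?_
  intro k
  have h1 : 0 < (y + k * β).re := by
    have : (y + k * β).re = y.re + k * β.re := by simp
    rw [this]; positivity
  rw [polylogExp_one_of_re_pos hβ h1, neg_neg]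
  congr 3
  ring

theorem differentiableOn_logQPochhammer {β : ℂ} (hβ : 0 < β.re) :
    DifferentiableOn ℂ (logQPochhammer β) (slitDomain β) := by
  intro y hy
  refine DifferentiableAt.differentiableWithinAt ?_
  obtain ⟨ε, hε, hball⟩ := Metric.isOpen_iff.1 (isOpen_slitDomain hβ) y hy
  have hcb : Metric.closedBall y (ε / 2) ⊆ slitDomain β :=
    (Metric.closedBall_subset_ball (by linarith)).trans hball
  obtain ⟨hd, C, hC⟩ := polylogExp_good hβ 1
  obtain ⟨M, -, hM⟩ := rayBound hβ hd.continuousOn hC (isCompact_closedBall y (ε / 2)) hcb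
  have hg : Summable (fun k : ℕ => M * Real.exp (-β.re) ^ k) :=
    (summable_geometric_of_lt_one (Real.exp_pos _).le
      (by rw [Real.exp_lt_one_iff]; linarith)).mul_left _
  have hsub : Metric.ball y (ε / 2) ⊆ slitDomain β := Metric.ball_subset_closedBall.trans hcb
  have := Complex.differentiableOn_tsum_of_summable_norm (U := Metric.ball y (ε / 2))
    (F := fun (k : ℕ) (w : ℂ) => polylogExp β 1 (w + k * β)) hg (by
      intro k
      refine hd.comp (by fun_prop) (fun w hw => ?_)
      exact_mod_cast slitDomain_add (hsub hw) (Nat.cast_nonneg k)) Metric.isOpen_ball (by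
      intro k w hw
      have := hM w (Metric.ball_subset_closedBall hw) k (by positivity)
      rw [← Real.exp_nat_mul]
      simpa using this)
  exact (this.differentiableAt (Metric.isOpen_ball.mem_nhds
    (Metric.mem_ball_self (by linarith)))).neg

theorem exp_logQPochhammer {β y : ℂ} (hβ : 0 < β.re) (hy : y ∈ slitDomain β) :
    Complex.exp (logQPochhammer β y) = qPochhammer (Complex.exp (-y)) (Complex.exp (-β)) := by
  have h := (summable_polylogExp_one hβ hy).hasSum.neg.cexp
  refine h.tprod_eq.symm.trans (tprod_congr fun k => ?_)
  have h1 : y + k * β ∈ slitDomain β := by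
    exact_mod_cast slitDomain_add hy (Nat.cast_nonneg k)
  simp only [Function.comp_apply]
  rw [exp_neg_polylogExp_one hβ h1, ← Complex.exp_nat_mul, ← Complex.exp_add]
  congr 2
  ring

/-- The branch of `log x` that is analytic outside the cut `e^{iφ} ℝ_{≤ 0}`, normalized by
`logCut φ x = log |x| + iφ` for `x` on the opposite ray `e^{iφ} ℝ_{> 0}`. It is real-valued for
`x > 0` whenever `|φ| < π`. -/
noncomputable def logCut (φ : ℝ) (x : ℂ) : ℂ :=
  Complex.log (x * Complex.exp (-(φ * Complex.I))) + φ * Complex.I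

theorem exp_logCut (φ : ℝ) {x : ℂ} (hx : x ≠ 0) : Complex.exp (logCut φ x) = x := by
  rw [logCut, Complex.exp_add, Complex.exp_log (by simp [hx]), mul_assoc, ← Complex.exp_add]
  simp

theorem logCut_ofReal {φ : ℝ} (hφ : |φ| < Real.pi) {x : ℝ} (hx : 0 < x) :
    logCut φ x = Real.log x := by
  have h := abs_lt.1 hφ
  rw [logCut, Complex.log_ofReal_mul hx (Complex.exp_ne_zero _), Complex.log_exp]
  · ring
  · simp; linarith
  · simp; linarith

theorem mem_slitPlane_of_avoid {φ : ℝ} {x : ℂ}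
    (hx : ∀ t : ℝ, 0 ≤ t → x ≠ -(t * Complex.exp (φ * Complex.I))) :
    x * Complex.exp (-(φ * Complex.I)) ∈ Complex.slitPlane := by
  by_contra h
  rw [Complex.mem_slitPlane_iff_not_le_zero, not_not] at h
  obtain ⟨h1, h2⟩ := Complex.le_def.1 h
  set z := x * Complex.exp (-(φ * Complex.I)) with hz
  have hzr : z = ((z.re : ℝ) : ℂ) := Complex.ext (by simp) (by simpa using h2)
  apply hx (-z.re) (by simpa using h1)
  have : x = z * Complex.exp (φ * Complex.I) := by
    rw [hz, mul_assoc, ← Complex.exp_add]; simp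
  rw [this]
  conv_lhs => rw [hzr]
  push_cast
  ring

theorem differentiableAt_logCut {φ : ℝ} {x : ℂ}
    (hx : ∀ t : ℝ, 0 ≤ t → x ≠ -(t * Complex.exp (φ * Complex.I))) :
    DifferentiableAt ℂ (logCut φ) x := by
  unfold logCut
  have h : DifferentiableAt ℂ (fun z : ℂ => z * Complex.exp (-(φ * Complex.I))) x := by fun_prop
  exact (h.clog (mem_slitPlane_of_avoid hx)).add_const _

/-- `log Γ(x)`, the branch that is real-valued for `x > 0` and analytic outside `ℝ_{≤ 0}`. -/
noncomputable def logGamma (x : ℂ) : ℂ :=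
  -Real.eulerMascheroniConstant * x - Complex.log x +
    ∑' n : ℕ, (x / (n + 1) - Complex.log (1 + x / (n + 1)))

theorem norm_logGamma_term {K : Set ℂ} (hK : IsCompact K) :
    ∃ C : ℝ, ∃ N : ℕ, ∀ n : ℕ, N ≤ n → ∀ x ∈ K,
      ‖x / ((n : ℂ) + 1) - Complex.log (1 + x / ((n : ℂ) + 1))‖ ≤ C / ((n : ℝ) + 1) ^ 2 := by
  obtain ⟨R, hR⟩ := hK.isBounded.exists_norm_le
  obtain ⟨N, hN⟩ := exists_nat_ge (2 * |R|)
  refine ⟨R ^ 2, N, fun n hn x hx => ?_⟩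
  have hn' : (N : ℝ) ≤ n := by exact_mod_cast hn
  have hnn : ‖(n : ℂ) + 1‖ = (n : ℝ) + 1 := by
    rw [← Nat.cast_succ, Complex.norm_natCast]; simp
  have hxR : ‖x‖ ≤ |R| := (hR x hx).trans (le_abs_self R)
  have hpos : (0 : ℝ) < n + 1 := by positivity
  have h1 : ‖x / ((n : ℂ) + 1)‖ ≤ |R| / ((n : ℝ) + 1) := by
    rw [norm_div, hnn]; gcongr
  have h2 : |R| / ((n : ℝ) + 1) ≤ 1 / 2 := by
    rw [div_le_iff₀ hpos]; linarith
  have h3 := Complex.norm_log_one_add_sub_self_le (z := x / ((n : ℂ) + 1)) (by linarith)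
  rw [norm_sub_rev]
  have h4 : (1 - ‖x / ((n : ℂ) + 1)‖)⁻¹ ≤ 2 := by
    rw [inv_le_comm₀ (by linarith) (by norm_num)]; linarith
  calc _ ≤ _ := h3
    _ ≤ (|R| / ((n : ℝ) + 1)) ^ 2 * 2 / 2 := by
        have h5 : 0 ≤ (1 - ‖x / ((n : ℂ) + 1)‖)⁻¹ := inv_nonneg.2 (by linarith)
        gcongr
    _ = _ := by rw [div_pow, sq_abs]; ring

theorem summable_logGamma_bound (C : ℝ) : Summable fun n : ℕ => C / ((n : ℝ) + 1) ^ 2 := by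
  have h := (summable_nat_add_iff 1).2 (Real.summable_one_div_nat_pow.2 one_lt_two)
  refine (h.mul_left C).congr (fun n => ?_)
  push_cast
  ring

theorem slitPlane_logGamma {x : ℂ} (hx : x ∈ Complex.slitPlane) (n : ℕ) :
    1 + x / ((n : ℂ) + 1) ∈ Complex.slitPlane := by
  have e : x / ((n : ℂ) + 1) = ((1 / ((n : ℝ) + 1) : ℝ) : ℂ) * x := by push_cast; ring
  have hp : (0 : ℝ) < 1 / ((n : ℝ) + 1) := by positivity
  rw [Complex.mem_slitPlane_iff] at *
  rw [e]
  rcases hx with h | h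
  · left; simp only [Complex.add_re, Complex.one_re, Complex.re_ofReal_mul]; positivity
  · right; simp only [Complex.add_im, Complex.one_im, Complex.im_ofReal_mul, zero_add]
    exact mul_ne_zero hp.ne' h

theorem summable_logGamma (x : ℂ) :
    Summable fun n : ℕ => x / ((n : ℂ) + 1) - Complex.log (1 + x / ((n : ℂ) + 1)) := by
  obtain ⟨C, N, h⟩ := norm_logGamma_term (isCompact_singleton (x := x))
  refine Summable.of_norm_bounded_eventually_nat (summable_logGamma_bound C) ?_
  filter_upwards [eventually_ge_atTop N] with n hn
  exact h n hn x rfl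

theorem differentiableOn_logGamma : DifferentiableOn ℂ logGamma Complex.slitPlane := by
  intro x hx
  refine DifferentiableAt.differentiableWithinAt ?_
  obtain ⟨ε, hε, hball⟩ := Metric.isOpen_iff.1 Complex.isOpen_slitPlane x hx
  obtain ⟨C, N, h⟩ := norm_logGamma_term (isCompact_closedBall x ε)
  have hterm : ∀ n : ℕ, DifferentiableOn ℂ
      (fun x : ℂ => x / ((n : ℂ) + 1) - Complex.log (1 + x / ((n : ℂ) + 1)))
      Complex.slitPlane := by
    intro n y hy
    have h1 : DifferentiableAt ℂ (fun x : ℂ => 1 + x / ((n : ℂ) + 1)) y := by fun_prop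
    have h2 : DifferentiableAt ℂ (fun x : ℂ => x / ((n : ℂ) + 1)) y := by fun_prop
    exact (h2.sub (h1.clog (slitPlane_logGamma hy n))).differentiableWithinAt
  have hsplit : logGamma = fun x : ℂ => -Real.eulerMascheroniConstant * x - Complex.log x +
      (∑ n ∈ Finset.range N, (x / ((n : ℂ) + 1) - Complex.log (1 + x / ((n : ℂ) + 1))) +
        ∑' n : ℕ, (x / (((n + N : ℕ) : ℂ) + 1) -
          Complex.log (1 + x / (((n + N : ℕ) : ℂ) + 1)))) := by
    funext y
    rw [logGamma, ← (summable_logGamma y).sum_add_tsum_nat_add N]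
  have htail := Complex.differentiableOn_tsum_of_summable_norm (U := Metric.ball x ε)
    (F := fun (n : ℕ) (x : ℂ) => x / (((n + N : ℕ) : ℂ) + 1) -
          Complex.log (1 + x / (((n + N : ℕ) : ℂ) + 1)))
    ((summable_nat_add_iff N).2 (summable_logGamma_bound C))
    (fun n => (hterm (n + N)).mono hball) Metric.isOpen_ball
    (fun n w hw => h (n + N) (by omega) w (Metric.ball_subset_closedBall hw))
  rw [hsplit]
  have h1 : DifferentiableAt ℂ
      (fun x : ℂ => -(Real.eulerMascheroniConstant : ℂ) * x - Complex.log x) x := by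
    have : DifferentiableAt ℂ Complex.log x := Complex.differentiableAt_log hx
    fun_prop
  refine h1.add (DifferentiableAt.add ?_ ?_)
  · refine DifferentiableAt.fun_sum (fun n _ => ?_)
    exact (hterm n).differentiableAt (Complex.isOpen_slitPlane.mem_nhds hx)
  · exact htail.differentiableAt (Metric.isOpen_ball.mem_nhds (Metric.mem_ball_self hε))

theorem exp_logGamma {x : ℂ} (hx : x ∈ Complex.slitPlane) :
    Complex.exp (logGamma x) = Complex.Gamma x := by
  have hx0 : x ≠ 0 := Complex.slitPlane_ne_zero hx
  have hγ : Tendsto (fun n : ℕ => (((harmonic n : ℝ) - Real.log n : ℝ) : ℂ)) atTop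
      (𝓝 Real.eulerMascheroniConstant) :=
    (Complex.continuous_ofReal.tendsto _).comp Real.tendsto_harmonic_sub_log
  have hlim : Tendsto (fun n : ℕ => -(((harmonic n : ℝ) - Real.log n : ℝ) : ℂ) * x - Complex.log x +
      ∑ k ∈ Finset.range n, (x / ((k : ℂ) + 1) - Complex.log (1 + x / ((k : ℂ) + 1)))) atTop
      (𝓝 (logGamma x)) :=
    ((hγ.neg.mul_const x).sub_const _).add (summable_logGamma x).hasSum.tendsto_sum_nat
  refine tendsto_nhds_unique hlim.cexp ?_
  refine (Complex.GammaSeq_tendsto_Gamma x).congr' ?_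
  filter_upwards [eventually_ne_atTop 0] with n hn
  have hn0 : (n : ℂ) ≠ 0 := by exact_mod_cast hn
  have hlog : ((Real.log n : ℝ) : ℂ) = Complex.log n := by
    rw [Complex.ofReal_log (by positivity)]; simp
  have hharm : ((harmonic n : ℝ) : ℂ) = ∑ k ∈ Finset.range n, 1 / ((k : ℂ) + 1) := by
    simp [harmonic]
  have hsum : ∑ k ∈ Finset.range n, (x / ((k : ℂ) + 1) - Complex.log (1 + x / ((k : ℂ) + 1))) =
      ((harmonic n : ℝ) : ℂ) * x - ∑ k ∈ Finset.range n, Complex.log (1 + x / ((k : ℂ) + 1)) := by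
    rw [Finset.sum_sub_distrib, hharm, Finset.sum_mul]
    congr 1
    refine Finset.sum_congr rfl fun k _ => ?_
    ring
  rw [hsum]
  rw [show -(((harmonic n : ℝ) - Real.log n : ℝ) : ℂ) * x - Complex.log x +
      (((harmonic n : ℝ) : ℂ) * x - ∑ k ∈ Finset.range n, Complex.log (1 + x / ((k : ℂ) + 1))) =
      Complex.log n * x - Complex.log x -
        ∑ k ∈ Finset.range n, Complex.log (1 + x / ((k : ℂ) + 1)) by
    rw [← hlog]; push_cast; ring]
  rw [Complex.exp_sub, Complex.exp_sub, Complex.exp_log hx0, Complex.exp_sum,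
    Complex.GammaSeq, Complex.cpow_def_of_ne_zero hn0, Finset.prod_range_succ']
  have hprod : ∏ k ∈ Finset.range n, Complex.exp (Complex.log (1 + x / ((k : ℂ) + 1))) =
      (∏ k ∈ Finset.range n, (x + ((k + 1 : ℕ) : ℂ))) / (n.factorial : ℂ) := by
    rw [← Finset.prod_range_add_one_eq_factorial, Nat.cast_prod, ← Finset.prod_div_distrib]
    refine Finset.prod_congr rfl fun k _ => ?_
    rw [Complex.exp_log (Complex.slitPlane_ne_zero (slitPlane_logGamma hx k))]
    have : (k : ℂ) + 1 ≠ 0 := Nat.cast_add_one_ne_zero k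
    push_cast
    field_simp
    ring
  rw [hprod]
  have hf : (n.factorial : ℂ) ≠ 0 := by exact_mod_cast n.factorial_ne_zero
  have hp : (∏ k ∈ Finset.range n, (x + ((k + 1 : ℕ) : ℂ))) ≠ 0 := by
    refine Finset.prod_ne_zero_iff.2 fun k _ h => ?_
    have : x = ((-((k + 1 : ℕ) : ℝ) : ℝ) : ℂ) := by
      push_cast at h ⊢; linear_combination h
    rw [this, Complex.ofReal_mem_slitPlane] at hx
    have : (0 : ℝ) ≤ ((k + 1 : ℕ) : ℝ) := by positivity
    linarith
  simp only [Nat.cast_zero, add_zero]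
  field_simp

theorem logGamma_ofReal {x : ℝ} (hx : 0 < x) : logGamma x = Real.log (Real.Gamma x) := by
  have him : (logGamma x).im = 0 := by
    have e : logGamma x = ((-Real.eulerMascheroniConstant * x - Real.log x +
        ∑' n : ℕ, (x / (n + 1) - Real.log (1 + x / (n + 1))) : ℝ) : ℂ) := by
      rw [logGamma]
      push_cast
      rw [Complex.ofReal_log hx.le]
      congr 2
      funext n
      rw [Complex.ofReal_log (by positivity)]
      push_cast
      rfl
    rw [e, Complex.ofReal_im]
  have h := exp_logGamma (x := x) (Complex.ofReal_mem_slitPlane.2 hx)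
  rw [Complex.Gamma_ofReal] at h
  have e2 : logGamma x = ((logGamma x).re : ℂ) := Complex.ext (by simp) (by simpa using him)
  rw [e2, ← Complex.ofReal_exp, Complex.ofReal_inj] at h
  rw [e2, ← h, Real.log_exp]

/-- The filter "`β → 0` with fixed argument `θ`". -/
noncomputable def argRay (θ : ℝ) : Filter ℂ := 𝓝[{β : ℂ | β ≠ 0 ∧ β.arg = θ}] 0

/-! Put f(w) = Li_2(e^{-w}). Since log(e^{-y};e^{-β})_∞ - log(e^{-y-β};e^{-β})_∞ = log(1 - e^{-y}) =
f'(y), Euler–Maclaurin summation along y, y+β, y+2β, … gives log(e^{-y};e^{-β})_∞ ≈ -∑ B_k/k!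
β^{k-1} f^{(k)}(y). Nothing comes from infinity, because f and its derivatives decay exponentially
there. For fixed y this is the case c = 0 (`logQPochhammer_expansion_of_fixed`).

For c > 0 write y = Xβ with X = xβ^{c-1}, so that y tends to the singularity of f at 0. There β^{-1}
f(βX) equals X log X - X, plus π²/(6β) + X log β, plus a regular part whose Taylor coefficients are
Bernoulli numbers (`dilogDeriv_expansion`, `zpow_mul_dilogDeriv`). The Euler–Maclaurin sum of X log
X - X is Stirling's series for log Γ(X), since log Γ(X+1) - log Γ(X) = log X; that of the regular
part is ∑ B_n B_{n+1}(X) β^n / (n (n+1)!). This yields the formula of the case c = 1 for variable X,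
with error O(|β|^{N+1} (1+|X|)^{N+2}), uniformly for X in a sector and β, βX small
(`exists_norm_qPochhammerRemainder_le`).

Uniformity is the main point. The Euler–Maclaurin remainders are O(|X|^{-j}) with j free, which
suffices when |β||X|² ≥ 1. For smaller X, the step X → X+1 changes the error only by a Taylor
remainder of the regular part, so X can be moved outward by about |β|^{-1/2} unit steps into the
first regime.

Finally c = 1 is X = x; for 0 < c < 1, X tends to infinity and Stirling's series is inserted; for c
> 1, X tends to 0 and the expansion of log Γ at 0 is inserted, with zeta values coming from its
Weierstrass series. -/

/-! ### Euler–Maclaurin summation. -/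

/-- The functional `∑_{k ≤ m} B_k / k! · h_k` of the Euler–Maclaurin formula. -/
noncomputable def eulerMaclaurinSum (m : ℕ) (h : ℕ → ℂ) : ℂ :=
  ∑ k ∈ Finset.range (m + 1), (bernoulli k : ℂ) / (k.factorial : ℂ) * h k

/-- Repeated integration by parts of B_k(t)/k! against h_{k+1}. With h_1(0) subtracted, the terms k
= 0, 1 form ∫ h_1 minus the trapezoidal average of h_1, because B_1 = -1/2. -/
theorem eulerMaclaurin_unit {h : ℕ → ℝ → ℂ}
    (hd : ∀ k, ∀ t ∈ Set.Icc (0 : ℝ) 1, HasDerivAt (h k) (h (k + 1) t) t) {m : ℕ} (hm : 1 ≤ m) :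
    eulerMaclaurinSum m (fun k => h k 1) - eulerMaclaurinSum m (fun k => h k 0) - h 1 0 =
      (-1) ^ m * ∫ t in (0 : ℝ)..1, (bernoulliFun m t : ℂ) / (m.factorial : ℂ) * h (m + 1) t := by
  have hu : Set.uIcc (0 : ℝ) 1 = Set.Icc 0 1 := Set.uIcc_of_le zero_le_one
  have hint : ∀ k, IntervalIntegrable (h k) MeasureTheory.volume 0 1 := fun k =>
    ContinuousOn.intervalIntegrable fun t ht =>
      (hd k t (hu ▸ ht)).continuousAt.continuousWithinAt
  have hB : ∀ k : ℕ, Continuous fun t : ℝ => (bernoulliFun k t : ℂ) / (k.factorial : ℂ) := by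
    intro k
    have : Continuous (bernoulliFun k) := continuous_bernoulliFun _
    fun_prop
  have hBd : ∀ (k : ℕ) (t : ℝ), HasDerivAt
      (fun t : ℝ => (bernoulliFun (k + 1) t : ℂ) / ((k + 1).factorial : ℂ))
      ((bernoulliFun k t : ℂ) / (k.factorial : ℂ)) t := by
    intro k t
    have h1 := ((hasDerivAt_bernoulliFun (k + 1) t).ofReal_comp).div_const
      ((k + 1).factorial : ℂ)
    refine h1.congr_deriv ?_
    rw [Nat.factorial_succ, Nat.add_sub_cancel]
    have h2 : (k.factorial : ℂ) ≠ 0 := by exact_mod_cast k.factorial_ne_zero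
    have h3 : (k : ℂ) + 1 ≠ 0 := Nat.cast_add_one_ne_zero k
    push_cast
    field_simp
  have hparts : ∀ k : ℕ, ∫ t in (0 : ℝ)..1, (bernoulliFun k t : ℂ) / (k.factorial : ℂ) * h (k + 1) t
      = (bernoulliFun (k + 1) 1 : ℂ) / ((k + 1).factorial : ℂ) * h (k + 1) 1
        - (bernoulliFun (k + 1) 0 : ℂ) / ((k + 1).factorial : ℂ) * h (k + 1) 0
        - ∫ t in (0 : ℝ)..1,
            (bernoulliFun (k + 1) t : ℂ) / ((k + 1).factorial : ℂ) * h (k + 1 + 1) t := by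
    intro k
    rw [intervalIntegral.integral_mul_deriv_eq_deriv_mul (fun t _ => hBd k t)
      (fun t ht => hd (k + 1) t (hu ▸ ht)) ((hB k).intervalIntegrable _ _) (hint _)]
    ring
  induction m, hm using Nat.le_induction with
  | base =>
    have h0 : ∫ t in (0 : ℝ)..1, h 1 t = h 0 1 - h 0 0 :=
      intervalIntegral.integral_eq_sub_of_hasDerivAt (fun t ht => hd 0 t (hu ▸ ht)) (hint 1)
    have h1 := hparts 0
    simp only [bernoulliFun_zero, Nat.factorial_zero, Complex.ofReal_one, Nat.cast_one, div_one,
      one_mul, zero_add, h0] at h1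
    rw [eulerMaclaurinSum, eulerMaclaurinSum]
    simp only [Finset.sum_range_succ, Finset.sum_range_zero]
    simp [bernoulliFun_one] at h1 ⊢
    linear_combination h1
  | succ m hm ih =>
    rw [hparts, bernoulliFun_endpoints_eq_of_ne_one (by omega), bernoulliFun_eval_zero] at ih
    have e : ∀ g : ℕ → ℂ, eulerMaclaurinSum (m + 1) g = eulerMaclaurinSum m g +
        (bernoulli (m + 1) : ℂ) / ((m + 1).factorial : ℂ) * g (m + 1) := fun g => by
      rw [eulerMaclaurinSum, Finset.sum_range_succ, eulerMaclaurinSum]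
    rw [e, e, pow_succ]
    -- Integration by parts brings the boundary term with the sign (-1)^m, and the new summand must
    -- cancel it. For odd m it does; for even m both vanish, as B_{m+1} = 0.
    rcases Nat.even_or_odd m with hev | hodd
    · have hz : bernoulli (m + 1) = 0 :=
        bernoulli_eq_zero_of_odd hev.add_one (by omega)
      rw [hz] at ih ⊢
      simp at ih ⊢
      linear_combination ih
    · rw [hodd.neg_one_pow] at ih ⊢
      push_cast at ih ⊢
      linear_combination ih

/-- The constant is a bound for B_m on [0, 1], hence independent of h. This uniformity is needed
later, when h depends on β and X. -/
theorem exists_eulerMaclaurin_unit_bound (m : ℕ) (hm : 1 ≤ m) : ∃ C : ℝ, 0 ≤ C ∧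
    ∀ (h : ℕ → ℝ → ℂ) (b : ℝ),
      (∀ k, ∀ t ∈ Set.Icc (0 : ℝ) 1, HasDerivAt (h k) (h (k + 1) t) t) →
      (∀ t ∈ Set.Icc (0 : ℝ) 1, ‖h (m + 1) t‖ ≤ b) →
      ‖eulerMaclaurinSum m (fun k => h k 1) - eulerMaclaurinSum m (fun k => h k 0) - h 1 0‖
        ≤ C * b := by
  have hcont : Continuous (bernoulliFun m) := continuous_bernoulliFun _
  obtain ⟨C, hC⟩ := (isCompact_Icc (a := (0 : ℝ)) (b := 1)).exists_bound_of_continuousOn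
    hcont.continuousOn
  have hC0 : 0 ≤ C := (norm_nonneg _).trans (hC 0 (by simp))
  refine ⟨C, hC0, fun h b hd hb => ?_⟩
  rw [eulerMaclaurin_unit hd hm, norm_mul, norm_pow, norm_neg, norm_one, one_pow, one_mul]
  have := intervalIntegral.norm_integral_le_of_norm_le_const (a := (0 : ℝ)) (b := 1) (C := C * b)
    (f := fun t => (bernoulliFun m t : ℂ) / (m.factorial : ℂ) * h (m + 1) t) ?_
  · simpa using this
  · intro t ht
    rw [Set.uIoc_of_le zero_le_one] at ht
    have ht' : t ∈ Set.Icc (0 : ℝ) 1 := ⟨ht.1.le, ht.2⟩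
    rw [norm_mul, norm_div, Complex.norm_real, Complex.norm_natCast]
    have h1 : (1 : ℝ) ≤ m.factorial := by exact_mod_cast m.factorial_pos
    exact mul_le_mul ((div_le_self (norm_nonneg _) h1).trans (hC t ht')) (hb t ht')
      (norm_nonneg _) hC0

/-- The Euler–Maclaurin formula for a function `S` with `S n - S (n + 1) = h_1 n`. -/
theorem exists_eulerMaclaurin_bound (m : ℕ) (hm : 1 ≤ m) : ∃ C : ℝ, 0 ≤ C ∧
    ∀ (h : ℕ → ℝ → ℂ) (S : ℕ → ℂ) (b : ℕ → ℝ),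
      (∀ k t, 0 ≤ t → HasDerivAt (h k) (h (k + 1) t) t) →
      (∀ n, S n - S (n + 1) = h 1 n) →
      Tendsto (fun n : ℕ => S n + eulerMaclaurinSum m (fun k => h k n)) atTop (𝓝 0) →
      (∀ n : ℕ, ∀ t ∈ Set.Icc (0 : ℝ) 1, ‖h (m + 1) (n + t)‖ ≤ b n) → Summable b →
      ‖S 0 + eulerMaclaurinSum m (fun k => h k 0)‖ ≤ C * ∑' n, b n := by
  obtain ⟨C, hC0, hC⟩ := exists_eulerMaclaurin_unit_bound m hm
  refine ⟨C, hC0, fun h S b hd hS hlim hb hsum => ?_⟩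
  -- The sequence S n + ∑ B_k/k! h_k(n) tends to 0 and its n-th increment is at most C b_n, so its
  -- initial term is at most the sum of all increments.
  have := dist_le_tsum_of_dist_le_of_tendsto₀ (fun n => C * b n) (fun n => ?_)
    (hsum.mul_left C) hlim
  · rw [tsum_mul_left, dist_zero_right] at this
    simpa using this
  · have h1 := hC (fun k t => h k (n + t)) (b n) (fun k t ht => ?_) (hb n)
    · simp only [add_zero] at h1
      rw [dist_comm, dist_eq_norm]
      refine le_trans (le_of_eq ?_) h1
      congr 1
      have := hS n
      push_cast
      linear_combination -this
    · exact (hd k (n + t) (add_nonneg (Nat.cast_nonneg n) ht.1)).comp_const_add (n : ℝ) t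

/-! ### Polylogarithms: scaling, decay and derivatives. -/

/-- The substitution t → rt in the ray integral shows that only the direction matters; hence β may
be replaced by e^{iθ} and the functions do not move as β → 0. -/
theorem polylogExp_real_mul {r : ℝ} (hr : 0 < r) (u : ℂ) (s : ℤ) :
    polylogExp (r * u) s = polylogExp u s := by
  have h : rayIntegral (r * u) = rayIntegral u := by
    funext f x
    have h1 := MeasureTheory.integral_comp_mul_left_Ioi (fun t : ℝ => f (x + t * u)) 0 hr
    rw [mul_zero] at h1
    have h2 : ∫ t in Set.Ioi (0 : ℝ), f (x + t * (r * u)) =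
        ∫ t in Set.Ioi (0 : ℝ), f (x + ((r * t : ℝ) : ℂ) * u) := by
      congr 1; funext t; congr 1; push_cast; ring
    rw [rayIntegral, rayIntegral, h2, h1, Complex.real_smul]
    have : (r : ℂ) ≠ 0 := by exact_mod_cast hr.ne'
    push_cast
    field_simp
  rw [polylogExp, polylogExp, h]

/-- Taken from the series ∑ e^{-mw}/m^s, which treats all integers s at once: Re w ≥ 1 allows e^{-Re
w} to be extracted while a convergent series in e^{-m} remains. -/
theorem exists_norm_polylogExp_le {u : ℂ} (hu : 0 < u.re) (s : ℤ) :
    ∃ C : ℝ, ∀ w : ℂ, 1 ≤ w.re → ‖polylogExp u s w‖ ≤ C * Real.exp (-w.re) := by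
  have hs : Summable fun m : ℕ => ((m : ℝ) + 1) ^ s.natAbs * Real.exp (-1) ^ m := by
    have h1 := summable_pow_mul_geometric_of_norm_lt_one (R := ℝ) s.natAbs
      (r := Real.exp (-1)) (by rw [Real.norm_of_nonneg (Real.exp_pos _).le]; simp)
    have h2 := ((summable_nat_add_iff 1).2 h1).mul_left (Real.exp 1)
    refine h2.congr fun m => ?_
    have : Real.exp 1 * Real.exp (-1) = 1 := by rw [← Real.exp_add]; simp
    push_cast
    rw [pow_succ]
    linear_combination ((m : ℝ) + 1) ^ s.natAbs * Real.exp (-1) ^ m * this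
  refine ⟨∑' m : ℕ, ((m : ℝ) + 1) ^ s.natAbs * Real.exp (-1) ^ m, fun w hw => ?_⟩
  rw [← (hasSum_polylogExp hu s (by linarith : 0 < w.re)).tsum_eq, ← tsum_mul_right]
  refine tsum_of_norm_bounded (hs.mul_right _).hasSum fun m => ?_
  have hn : ‖(m : ℂ) + 1‖ = (m : ℝ) + 1 := by
    rw [← Nat.cast_succ, Complex.norm_natCast]; simp
  have h1 : (1 : ℝ) ≤ (m : ℝ) + 1 := by linarith [Nat.cast_nonneg (α := ℝ) m]
  rw [norm_div, norm_zpow, hn, Complex.norm_exp, div_eq_mul_inv, ← zpow_neg]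
  have h2 : ((m : ℝ) + 1) ^ (-s) ≤ ((m : ℝ) + 1) ^ s.natAbs := by
    rw [← zpow_natCast]
    exact zpow_le_zpow_right₀ h1 (by omega)
  have h3 : Real.exp ((-((m : ℂ) + 1) * w).re) ≤ Real.exp (-1) ^ m * Real.exp (-w.re) := by
    rw [← Real.exp_nat_mul, ← Real.exp_add]
    apply Real.exp_le_exp.2
    have : (-((m : ℂ) + 1) * w).re = -(((m : ℝ) + 1) * w.re) := by simp; ring
    rw [this]
    nlinarith [Nat.cast_nonneg (α := ℝ) m]
  calc _ ≤ (Real.exp (-1) ^ m * Real.exp (-w.re)) * ((m : ℝ) + 1) ^ s.natAbs := by gcongr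
    _ = _ := by ring

/-- Complex differentiability is known from `rayIntegral_good`, so the value of the derivative can
be read off in one direction. Along the ray itself the integral only loses an initial segment, and
the fundamental theorem of calculus applies. -/
theorem hasDerivAt_rayIntegral {u : ℂ} (hu : 0 < u.re) {f : ℂ → ℂ}
    (hf : DifferentiableOn ℂ f (slitDomain u))
    (hC : ∃ C : ℝ, ∀ w : ℂ, 1 ≤ w.re → ‖f w‖ ≤ C * Real.exp (-w.re)) {x : ℂ}
    (hx : x ∈ slitDomain u) : HasDerivAt (rayIntegral u f) (-f x) x := by
  have hu0 : u ≠ 0 := by rintro rfl; simp at hu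
  have hnhds := (isOpen_slitDomain hu).mem_nhds hx
  have hd := ((rayIntegral_good hu hf hC).1.differentiableAt hnhds).hasDerivAt
  obtain ⟨C, hC⟩ := hC
  obtain ⟨M, -, hM⟩ := rayBound hu hf.continuousOn hC (K := {x}) isCompact_singleton (by simpa)
  have hcont : ContinuousOn (fun t : ℝ => f (x + t * u)) (Set.Ici 0) :=
    hf.continuousOn.comp (by fun_prop) fun t ht => slitDomain_add hx ht
  have hint : MeasureTheory.IntegrableOn (fun t : ℝ => f (x + t * u)) (Set.Ioi 0) := by
    have h1 : MeasureTheory.IntegrableOn (fun t : ℝ => Real.exp (-(t * u.re))) (Set.Ioi 0) := by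
      refine (exp_neg_integrableOn_Ioi 0 hu).congr_fun (fun t _ => ?_) measurableSet_Ioi
      simp [mul_comm]
    refine MeasureTheory.Integrable.mono' (h1.const_mul M)
      ((hcont.mono Set.Ioi_subset_Ici_self).aestronglyMeasurable measurableSet_Ioi) ?_
    filter_upwards [MeasureTheory.ae_restrict_mem measurableSet_Ioi] with t ht
    exact hM x rfl t (le_of_lt ht)
  have hray : ∀ s : ℝ, 0 ≤ s → rayIntegral u f (x + s * u) =
      rayIntegral u f x - u * ∫ t in (0 : ℝ)..s, f (x + t * u) := by
    intro s hs
    have h1 : ∫ t in Set.Ioi (0 : ℝ), f (x + s * u + t * u) =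
        ∫ t in Set.Ioi s, f (x + t * u) := by
      have := (MeasureTheory.measurePreserving_add_right MeasureTheory.volume s
        ).setIntegral_preimage_emb (measurableEmbedding_addRight s)
        (fun t : ℝ => f (x + t * u)) (Set.Ioi s)
      rw [Set.preimage_add_const_Ioi, sub_self] at this
      rw [← this]
      congr 1; funext t; congr 1; push_cast; ring
    rw [rayIntegral, rayIntegral, h1, ← intervalIntegral.integral_Ioi_sub_Ioi hint hs]
    ring
  -- Only a one-sided derivative at s = 0 is taken: for negative s the point x + su may lie on a
  -- cut.
  have hg : HasDerivWithinAt (fun s : ℝ => rayIntegral u f (x + s * u))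
      (deriv (rayIntegral u f) x * u) (Set.Ici 0) 0 := by
    have h1 : HasDerivAt (fun s : ℂ => rayIntegral u f (x + s * u))
        (deriv (rayIntegral u f) x * u) ((0 : ℝ) : ℂ) := by
      refine HasDerivAt.comp (𝕜 := ℂ) _ (h₂ := rayIntegral u f) ?_ ?_
      · simpa using hd
      · simpa using ((hasDerivAt_id ((0 : ℝ) : ℂ)).mul_const u).const_add x
    exact h1.comp_ofReal.hasDerivWithinAt
  have hg2 : HasDerivWithinAt (fun s : ℝ => rayIntegral u f (x + s * u))
      (-(u * f x)) (Set.Ici 0) 0 := by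
    have h1 : HasDerivWithinAt (fun s : ℝ => ∫ t in (0 : ℝ)..s, f (x + t * u))
        (f (x + (0 : ℝ) * u)) (Set.Ici 0) 0 := by
      refine intervalIntegral.integral_hasDerivWithinAt_right (by simp) (t := Set.Ioi 0) ?_
        ((hcont 0 (by simp)).mono Set.Ioi_subset_Ici_self)
      exact ⟨Set.Ioi 0, self_mem_nhdsWithin,
        (hcont.mono Set.Ioi_subset_Ici_self).aestronglyMeasurable measurableSet_Ioi⟩
    have h2 := (h1.const_mul u).const_sub (rayIntegral u f x)
    simp only [Complex.ofReal_zero, zero_mul, add_zero] at h2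
    refine h2.congr (fun s hs => hray s hs) ?_
    exact hray 0 le_rfl
  have := (uniqueDiffWithinAt_Ici (0 : ℝ)).eq_deriv _ hg hg2
  have h3 : deriv (rayIntegral u f) x = -f x := by
    apply mul_right_cancel₀ hu0
    linear_combination this
  rwa [h3] at hd

theorem polylogExp_natCast_add_one (u : ℂ) (n : ℕ) :
    polylogExp u ((n : ℤ) + 1) = rayIntegral u (polylogExp u n) := by
  unfold polylogExp
  rw [show (-((n : ℤ) + 1)).toNat = 0 by omega, show (-(n : ℤ)).toNat = 0 by omega,
    show ((n : ℤ) + 1).toNat = n + 1 by omega, Int.toNat_natCast, Function.iterate_succ_apply']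

theorem polylogExp_neg_natCast (u : ℂ) (n : ℕ) :
    polylogExp u (-(n : ℤ)) = fun w => polylogNonpos n (Complex.exp (-w)) := by
  unfold polylogExp
  rw [show (-(n : ℤ)).toNat = 0 by omega, show (-(-(n : ℤ))).toNat = n by omega]
  rfl

theorem hasDerivAt_polylogExp {u : ℂ} (hu : 0 < u.re) (s : ℤ) {x : ℂ} (hx : x ∈ slitDomain u) :
    HasDerivAt (polylogExp u s) (-polylogExp u (s - 1) x) x := by
  rcases le_or_gt s 0 with hs | hs
  · obtain ⟨n, rfl⟩ : ∃ n : ℕ, s = -(n : ℤ) := ⟨s.natAbs, by omega⟩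
    rw [show -(n : ℤ) - 1 = -((n + 1 : ℕ) : ℤ) by push_cast; ring, polylogExp_neg_natCast,
      polylogExp_neg_natCast]
    have h1 : HasDerivAt (polylogNonpos n) (deriv (polylogNonpos n) (Complex.exp (-x)))
        (Complex.exp (-x)) :=
      ((differentiableOn_polylogNonpos n).differentiableAt
        (isOpen_ne.mem_nhds (exp_neg_ne_one hx))).hasDerivAt
    have h2 := h1.comp x ((hasDerivAt_neg x).cexp)
    refine h2.congr_deriv ?_
    have : polylogNonpos (n + 1) = fun z => z * deriv (polylogNonpos n) z := by
      unfold polylogNonpos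
      rw [Function.iterate_succ_apply']
    rw [this]
    ring
  · obtain ⟨n, rfl⟩ : ∃ n : ℕ, s = (n : ℤ) + 1 := ⟨(s - 1).toNat, by omega⟩
    rw [polylogExp_natCast_add_one, show (n : ℤ) + 1 - 1 = n by ring]
    obtain ⟨h1, h2⟩ := polylogExp_good hu n
    exact hasDerivAt_rayIntegral hu h1 h2 hx

/-- The `k`-th derivative of `w ↦ Li_2(e^{-w})`. -/
noncomputable def dilogDeriv (u : ℂ) (k : ℕ) (w : ℂ) : ℂ :=
  (-1) ^ k * polylogExp u (2 - (k : ℤ)) w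

theorem hasDerivAt_dilogDeriv {u : ℂ} (hu : 0 < u.re) (k : ℕ) {x : ℂ} (hx : x ∈ slitDomain u) :
    HasDerivAt (dilogDeriv u k) (dilogDeriv u (k + 1) x) x := by
  refine ((hasDerivAt_polylogExp hu (2 - (k : ℤ)) hx).const_mul ((-1) ^ k)).congr_deriv ?_
  rw [dilogDeriv, show (2 : ℤ) - ((k + 1 : ℕ) : ℤ) = 2 - (k : ℤ) - 1 by push_cast; ring]
  ring

theorem continuousOn_dilogDeriv {u : ℂ} (hu : 0 < u.re) (k : ℕ) :
    ContinuousOn (dilogDeriv u k) (slitDomain u) := fun _ hx =>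
  (hasDerivAt_dilogDeriv hu k hx).continuousAt.continuousWithinAt

theorem exists_norm_dilogDeriv_le {u : ℂ} (hu : 0 < u.re) (k : ℕ) :
    ∃ C : ℝ, ∀ w : ℂ, 1 ≤ w.re → ‖dilogDeriv u k w‖ ≤ C * Real.exp (-w.re) := by
  obtain ⟨C, hC⟩ := exists_norm_polylogExp_le hu (2 - (k : ℤ))
  refine ⟨C, fun w hw => ?_⟩
  rw [dilogDeriv, norm_mul, norm_pow, norm_neg, norm_one, one_pow, one_mul]
  exact hC w hw

theorem dilogDeriv_real_mul {r : ℝ} (hr : 0 < r) (u : ℂ) (k : ℕ) :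
    dilogDeriv (r * u) k = dilogDeriv u k := by
  funext w
  rw [dilogDeriv, dilogDeriv, polylogExp_real_mul hr]

/-! ### Euler–Maclaurin for the q-Pochhammer symbol, and the case c = 0. -/

theorem logQPochhammer_sub {β y : ℂ} (hβ : 0 < β.re) (hy : y ∈ slitDomain β) :
    logQPochhammer β y - logQPochhammer β (y + β) = dilogDeriv β 1 y := by
  have h := (summable_polylogExp_one hβ hy).tsum_eq_zero_add
  rw [logQPochhammer, logQPochhammer, h, dilogDeriv]
  have e : ∀ k : ℕ, y + ((k + 1 : ℕ) : ℂ) * β = y + β + k * β := fun k => by push_cast; ring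
  simp only [e]
  norm_num

/-- These are the tails of one series. No condition on β and y is needed, since a series that is not
summable has the value 0 by convention, and so have its tails. -/
theorem tendsto_logQPochhammer_add (β y : ℂ) :
    Tendsto (fun n : ℕ => logQPochhammer β (y + n * β)) atTop (𝓝 0) := by
  have h := (tendsto_sum_nat_add fun k : ℕ => polylogExp β 1 (y + k * β)).neg
  rw [neg_zero] at h
  refine h.congr fun n => ?_
  rw [logQPochhammer]
  congr 2
  funext k
  congr 1
  push_cast
  ring

theorem tendsto_dilogDeriv_add {β y : ℂ} (hβ : 0 < β.re) (hy : y ∈ slitDomain β) (k : ℕ) :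
    Tendsto (fun n : ℕ => dilogDeriv β k (y + n * β)) atTop (𝓝 0) := by
  obtain ⟨C, hC⟩ := exists_norm_dilogDeriv_le hβ k
  obtain ⟨M, -, hM⟩ := rayBound hβ (continuousOn_dilogDeriv hβ k) hC (K := {y})
    isCompact_singleton (by simpa)
  have h1 : Tendsto (fun n : ℕ => M * Real.exp (-(n * β.re))) atTop (𝓝 0) := by
    have h2 : Tendsto (fun n : ℕ => (n : ℝ) * β.re) atTop atTop :=
      tendsto_natCast_atTop_atTop.atTop_mul_const hβ
    simpa using (Real.tendsto_exp_neg_atTop_nhds_zero.comp h2).const_mul M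
  refine squeeze_zero_norm (fun n => ?_) h1
  simpa using hM y rfl n (Nat.cast_nonneg n)

theorem exists_logQPochhammer_eulerMaclaurin (m : ℕ) (hm : 1 ≤ m) : ∃ C : ℝ, 0 ≤ C ∧
    ∀ (β y : ℂ) (b : ℕ → ℝ), 0 < β.re → y ∈ slitDomain β →
      (∀ n : ℕ, ∀ t ∈ Set.Icc (0 : ℝ) 1, ‖β‖ ^ m * ‖dilogDeriv β (m + 1) (y + (n + t) * β)‖ ≤ b n) →
      Summable b →
      ‖logQPochhammer β y +
        eulerMaclaurinSum m (fun k => β ^ ((k : ℤ) - 1) * dilogDeriv β k y)‖ ≤ C * ∑' n, b n := by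
  obtain ⟨C, hC0, hC⟩ := exists_eulerMaclaurin_bound m hm
  refine ⟨C, hC0, fun β y b hβ hy hb hsum => ?_⟩
  have hβ0 : β ≠ 0 := by rintro rfl; simp at hβ
  -- The factor β^{k-1} absorbs the chain rule in t and leaves h_1 without a factor, as the
  -- difference equation for S requires; the term k = 0 carries β^{-1}.
  have := hC (fun k t => β ^ ((k : ℤ) - 1) * dilogDeriv β k (y + t * β))
    (fun n => logQPochhammer β (y + n * β)) b ?_ ?_ ?_ ?_ hsum
  · simpa using this
  · intro k t ht
    have h1 : HasDerivAt (fun s : ℂ => dilogDeriv β k (y + s * β))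
        (dilogDeriv β (k + 1) (y + t * β) * β) (t : ℂ) := by
      refine HasDerivAt.comp (𝕜 := ℂ) _ (h₂ := dilogDeriv β k)
        (hasDerivAt_dilogDeriv hβ k (slitDomain_add hy ht)) ?_
      simpa using ((hasDerivAt_id (t : ℂ)).mul_const β).const_add y
    refine (h1.comp_ofReal.const_mul (β ^ ((k : ℤ) - 1))).congr_deriv ?_
    rw [show ((k + 1 : ℕ) : ℤ) - 1 = ((k : ℤ) - 1) + 1 by push_cast; ring, zpow_add_one₀ hβ0]
    ring
  · intro n
    have h1 : y + n * β ∈ slitDomain β := by exact_mod_cast slitDomain_add hy (Nat.cast_nonneg n)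
    have := logQPochhammer_sub hβ h1
    simp only [Nat.cast_one, sub_self, zpow_zero, one_mul, Complex.ofReal_natCast, ← this]
    congr 2
    push_cast
    ring
  · have h1 : Tendsto (fun n : ℕ => eulerMaclaurinSum m
        (fun k => β ^ ((k : ℤ) - 1) * dilogDeriv β k (y + (n : ℝ) * β))) atTop (𝓝 0) := by
      have h2 : Tendsto (fun n : ℕ => eulerMaclaurinSum m
          (fun k => β ^ ((k : ℤ) - 1) * dilogDeriv β k (y + (n : ℝ) * β))) atTop
          (𝓝 (∑ k ∈ Finset.range (m + 1), (bernoulli k : ℂ) / (k.factorial : ℂ) *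
            (β ^ ((k : ℤ) - 1) * 0))) := by
        unfold eulerMaclaurinSum
        refine tendsto_finsetSum _ fun k _ => ?_
        refine Tendsto.const_mul _ (Tendsto.const_mul _ ?_)
        simpa using tendsto_dilogDeriv_add hβ hy k
      simpa using h2
    simpa using (tendsto_logQPochhammer_add β y).add h1
  · intro n t ht
    rw [norm_mul, show ((m + 1 : ℕ) : ℤ) - 1 = (m : ℤ) by push_cast; ring, zpow_natCast, norm_pow]
    simpa using hb n t ht

theorem slitDomain_real_mul {r : ℝ} (hr : 0 < r) (u : ℂ) : slitDomain (r * u) = slitDomain u := by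
  ext y
  rw [mem_slitDomain_iff, mem_slitDomain_iff]
  constructor
  · intro h t ht
    have h1 := h (t / r) (by positivity)
    have : (r : ℂ) ≠ 0 := by exact_mod_cast hr.ne'
    rwa [show ((t / r : ℝ) : ℂ) * (r * u) = t * u by push_cast; field_simp] at h1
  · intro h t ht
    have h1 := h (t * r) (by positivity)
    rwa [show ((t * r : ℝ) : ℂ) * u = t * (r * u) by push_cast; ring] at h1

theorem re_exp_mul_I_pos {θ : ℝ} (hθ : |θ| < Real.pi / 2) :
    0 < (Complex.exp (θ * Complex.I)).re := by
  rw [Complex.exp_ofReal_mul_I_re]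
  have := abs_lt.1 hθ
  exact Real.cos_pos_of_mem_Ioo ⟨by linarith, by linarith⟩

theorem isBigO_argRay {θ : ℝ} {f : ℂ → ℂ} {g : ℂ → ℝ}
    (h : ∃ C ε : ℝ, 0 < ε ∧ ∀ r : ℝ, 0 < r → r < ε →
      ‖f (r * Complex.exp (θ * Complex.I))‖ ≤ C * |g (r * Complex.exp (θ * Complex.I))|) :
    f =O[argRay θ] g := by
  obtain ⟨C, ε, hε, h⟩ := h
  refine IsBigO.of_bound C ?_
  have h1 : ∀ᶠ β : ℂ in argRay θ, β ∈ Metric.ball (0 : ℂ) ε :=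
    nhdsWithin_le_nhds (Metric.ball_mem_nhds 0 hε)
  have h2 : ∀ᶠ β : ℂ in argRay θ, β ∈ {β : ℂ | β ≠ 0 ∧ β.arg = θ} := self_mem_nhdsWithin
  filter_upwards [h1, h2] with β hβ hβ'
  have h3 := Complex.norm_mul_exp_arg_mul_I β
  rw [hβ'.2] at h3
  have := h ‖β‖ (norm_pos_iff.2 hβ'.1) (by simpa using hβ)
  rw [h3] at this
  simpa using this

/-- Summing e^{-na} costs one factor 1/a; this is the power of r lost in the remainder for fixed x.
-/
theorem tsum_geometric_exp_le {a : ℝ} (ha : 0 < a) (ha1 : a ≤ 1) :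
    ∑' n : ℕ, Real.exp (-a) ^ n ≤ 2 / a := by
  have h1 : Real.exp (-a) < 1 := by rw [Real.exp_lt_one_iff]; linarith
  rw [tsum_geometric_of_lt_one (Real.exp_pos _).le h1, ← one_div]
  have h2 : a / 2 ≤ 1 - Real.exp (-a) := by
    have h3 := Real.add_one_le_exp a
    have h4 : Real.exp (-a) * Real.exp a = 1 := by rw [← Real.exp_add]; simp
    nlinarith [Real.exp_pos (-a)]
  rw [div_le_div_iff₀ (by linarith) ha]
  linarith

/-- The remainder terms are at most r^m M e^{-n r Re u}, by exponential decay along the ray from x.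
Their sum is of order r^m · 1/r. -/
theorem logQPochhammer_expansion_of_fixed {u : ℂ} (hu : 0 < u.re) (hu1 : ‖u‖ = 1) {x : ℂ}
    (hx : x ∈ slitDomain u) (m : ℕ) (hm : 1 ≤ m) :
    ∃ C : ℝ, ∀ r : ℝ, 0 < r → r < 1 →
      ‖logQPochhammer (r * u) x +
        eulerMaclaurinSum m (fun k => (r * u : ℂ) ^ ((k : ℤ) - 1) * dilogDeriv u k x)‖ ≤
        C * r ^ (m - 1) := by
  obtain ⟨C, hC0, hC⟩ := exists_logQPochhammer_eulerMaclaurin m hm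
  obtain ⟨D, hD⟩ := exists_norm_dilogDeriv_le hu (m + 1)
  obtain ⟨M, hM0, hM⟩ := rayBound hu (continuousOn_dilogDeriv hu (m + 1)) hD (K := {x})
    isCompact_singleton (by simpa)
  refine ⟨C * (M * (2 / u.re)), fun r hr hr1 => ?_⟩
  have hre : u.re ≤ 1 := hu1 ▸ Complex.re_le_norm u
  have ha : 0 < r * u.re := by positivity
  have h1 : Real.exp (-(r * u.re)) < 1 := by rw [Real.exp_lt_one_iff]; linarith
  have hnorm : ‖(r * u : ℂ)‖ = r := by
    rw [norm_mul, hu1, mul_one, Complex.norm_real, Real.norm_of_nonneg hr.le]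
  have h := hC (r * u) x (fun n => r ^ m * M * Real.exp (-(r * u.re)) ^ n)
    (by simpa using ha) (by rwa [slitDomain_real_mul hr]) (fun n t ht => ?_)
    ((summable_geometric_of_lt_one (Real.exp_pos _).le h1).mul_left _)
  · simp only [dilogDeriv_real_mul hr] at h
    refine h.trans ?_
    rw [tsum_mul_left]
    have h2 := tsum_geometric_exp_le ha (by nlinarith)
    obtain ⟨j, rfl⟩ : ∃ j, m = j + 1 := ⟨m - 1, by omega⟩
    rw [Nat.add_sub_cancel]
    calc C * (r ^ (j + 1) * M * ∑' n : ℕ, Real.exp (-(r * u.re)) ^ n)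
        ≤ C * (r ^ (j + 1) * M * (2 / (r * u.re))) := by gcongr
      _ = _ := by field_simp; ring
  · rw [hnorm, dilogDeriv_real_mul hr, mul_assoc]
    gcongr
    have h3 : x + (n + t) * (r * u) = x + (((n + t) * r : ℝ) : ℂ) * u := by push_cast; ring
    rw [h3]
    refine (hM x rfl ((n + t) * r) (by have := ht.1; positivity)).trans ?_
    rw [← Real.exp_nat_mul]
    gcongr
    have : 0 ≤ t * (r * u.re) := mul_nonneg ht.1 ha.le
    linarith

theorem logQPochhammer_isBigO_of_fixed {θ : ℝ} (hθ : |θ| < Real.pi / 2) {x : ℂ}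
    (hx : x ∈ slitDomain (Complex.exp (θ * Complex.I))) (N : ℕ) :
    (fun β : ℂ => logQPochhammer β x -
          ∑ k ∈ Finset.range (N + 1),
            (-1 : ℂ) ^ ((k : ℤ) - 1) * (bernoulli k : ℂ) *
              polylogExp (Complex.exp (θ * Complex.I)) (2 - (k : ℤ)) x / (k.factorial : ℂ) *
              β ^ ((k : ℤ) - 1))
        =O[argRay θ] fun β : ℂ => ‖β‖ ^ (N : ℝ) := by
  set u := Complex.exp (θ * Complex.I) with hu
  have hu1 : ‖u‖ = 1 := Complex.norm_exp_ofReal_mul_I θ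
  -- Order N + 1 is used because one power of r is lost; the surplus term k = N + 1 is itself O(r^N)
  -- and joins the error.
  obtain ⟨C, hC⟩ := logQPochhammer_expansion_of_fixed (re_exp_mul_I_pos hθ) hu1 hx (N + 1) (by omega)
  refine isBigO_argRay ⟨C + ‖(bernoulli (N + 1) : ℂ) / ((N + 1).factorial : ℂ) *
    dilogDeriv u (N + 1) x‖, 1, one_pos, fun r hr hr1 => ?_⟩
  rw [← hu]
  have hnorm : ‖(r * u : ℂ)‖ = r := by
    rw [norm_mul, hu1, mul_one, Complex.norm_real, Real.norm_of_nonneg hr.le]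
  have h := hC r hr hr1
  rw [hnorm, Real.rpow_natCast, abs_of_nonneg (by positivity)]
  rw [Nat.add_sub_cancel] at h
  have e : logQPochhammer (r * u) x - ∑ k ∈ Finset.range (N + 1),
      (-1 : ℂ) ^ ((k : ℤ) - 1) * (bernoulli k : ℂ) * polylogExp u (2 - (k : ℤ)) x /
        (k.factorial : ℂ) * (r * u) ^ ((k : ℤ) - 1) =
      (logQPochhammer (r * u) x + eulerMaclaurinSum (N + 1)
        (fun k => (r * u : ℂ) ^ ((k : ℤ) - 1) * dilogDeriv u k x)) -
      (bernoulli (N + 1) : ℂ) / ((N + 1).factorial : ℂ) * dilogDeriv u (N + 1) x * (r * u) ^ N := by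
    rw [eulerMaclaurinSum, Finset.sum_range_succ _ (N + 1),
      show ((N + 1 : ℕ) : ℤ) - 1 = (N : ℤ) by push_cast; ring, zpow_natCast]
    have : ∑ k ∈ Finset.range (N + 1), (-1 : ℂ) ^ ((k : ℤ) - 1) * (bernoulli k : ℂ) *
        polylogExp u (2 - (k : ℤ)) x / (k.factorial : ℂ) * (r * u) ^ ((k : ℤ) - 1) =
        -∑ k ∈ Finset.range (N + 1), (bernoulli k : ℂ) / (k.factorial : ℂ) *
          ((r * u : ℂ) ^ ((k : ℤ) - 1) * dilogDeriv u k x) := by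
      rw [← Finset.sum_neg_distrib]
      refine Finset.sum_congr rfl fun k _ => ?_
      rw [dilogDeriv, zpow_sub_one₀ (by norm_num), zpow_natCast]
      norm_num
      ring
    rw [this]
    ring
  rw [e]
  refine (norm_sub_le _ _).trans ?_
  rw [norm_mul _ ((r * u : ℂ) ^ N), norm_pow, hnorm, add_mul]
  gcongr

/-! ### Stirling's series for log Γ in sectors. -/

/-- `x` lies in a closed sector around the positive real axis, with opening given by `κ`. -/
def InSector (κ : ℝ) (x : ℂ) : Prop := ∀ s : ℝ, 0 ≤ s → κ * (‖x‖ + s) ≤ ‖x + s‖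

theorem InSector.add {κ : ℝ} (hκ : 0 ≤ κ) {x : ℂ} (hx : InSector κ x) {a : ℝ} (ha : 0 ≤ a) :
    InSector κ (x + a) := by
  intro s hs
  have h1 := hx (a + s) (by positivity)
  have h2 : ‖x + a‖ ≤ ‖x‖ + a := by
    refine (norm_add_le _ _).trans ?_
    rw [Complex.norm_real, Real.norm_of_nonneg ha]
  rw [show x + a + s = x + ((a + s : ℝ) : ℂ) by push_cast; ring]
  refine le_trans (mul_le_mul_of_nonneg_left ?_ hκ) h1
  linarith

theorem add_ofReal_mem_slitPlane {x : ℂ} (hx : x ∈ Complex.slitPlane) {a : ℝ} (ha : 0 ≤ a) :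
    x + a ∈ Complex.slitPlane := by
  rw [Complex.mem_slitPlane_iff] at *
  rcases hx with h | h
  · left; simp only [Complex.add_re, Complex.ofReal_re]; positivity
  · right; simpa using h

theorem ofReal_mul_mem_slitPlane {x : ℂ} (hx : x ∈ Complex.slitPlane) {a : ℝ} (ha : 0 < a) :
    (a : ℂ) * x ∈ Complex.slitPlane := by
  rw [Complex.mem_slitPlane_iff] at *
  rw [Complex.re_ofReal_mul, Complex.im_ofReal_mul]
  rcases hx with h | h
  · left; positivity
  · right; exact mul_ne_zero ha.ne' h

/-- The opening depends only on arg x, so one κ serves the whole open ray through x. -/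
theorem exists_inSector {x : ℂ} (hx : x ∈ Complex.slitPlane) :
    ∃ κ : ℝ, 0 < κ ∧ κ ≤ 1 ∧ ∀ a : ℝ, 0 < a → InSector κ (a * x) := by
  have hx0 : 0 < ‖x‖ := norm_pos_iff.2 (Complex.slitPlane_ne_zero hx)
  have hlt : -‖x‖ < x.re := by
    rcases Complex.mem_slitPlane_iff.1 hx with h | h
    · linarith
    · exact (abs_lt.1 (Complex.abs_re_lt_norm.2 h)).1
  have hle : x.re ≤ ‖x‖ := Complex.re_le_norm x
  -- With φ = arg x, q = (1 + cos φ)/2 = cos²(φ/2). The claim follows from |x+s|² = q(|x|+s)² +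
  -- (1-q)(|x|-s)², applied to ax.
  set q : ℝ := (1 + x.re / ‖x‖) / 2 with hq
  have hq0 : 0 < q := by
    have : -1 < x.re / ‖x‖ := by rw [lt_div_iff₀ hx0]; linarith
    rw [hq]; linarith
  have hq1 : q ≤ 1 := by
    have : x.re / ‖x‖ ≤ 1 := by rw [div_le_iff₀ hx0]; linarith
    rw [hq]; linarith
  refine ⟨Real.sqrt q, Real.sqrt_pos.2 hq0, Real.sqrt_le_one.2 hq1, fun a ha s hs => ?_⟩
  have hn : ‖(a : ℂ) * x‖ = a * ‖x‖ := by
    rw [norm_mul, Complex.norm_real, Real.norm_of_nonneg ha.le]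
  have hsq : ‖(a : ℂ) * x + s‖ ^ 2 = (a * ‖x‖) ^ 2 + 2 * s * (a * x.re) + s ^ 2 := by
    have h1 := Complex.sq_norm x
    rw [Complex.normSq_apply] at h1
    rw [Complex.sq_norm, Complex.normSq_apply, mul_pow, h1]
    simp
    ring
  have hre : x.re = (2 * q - 1) * ‖x‖ := by rw [hq]; field_simp; ring
  refine (sq_le_sq₀ (by positivity) (norm_nonneg _)).1 ?_
  rw [hn, mul_pow, Real.sq_sqrt hq0.le, hsq, hre]
  nlinarith [mul_nonneg (sub_nonneg.2 hq1) (sq_nonneg (a * ‖x‖ - s))]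

theorem log_add_natCast_eq {x : ℂ} (hx : x ∈ Complex.slitPlane) {a : ℝ} (ha : 0 < a) :
    Complex.log (x + a) = Real.log a + Complex.log (1 + x / a) := by
  have ha0 : (a : ℂ) ≠ 0 := by exact_mod_cast ha.ne'
  have h : x + a ≠ 0 := Complex.slitPlane_ne_zero (add_ofReal_mem_slitPlane hx ha.le)
  have e : x + a = (a : ℂ) * (1 + x / a) := by field_simp; ring
  rw [e, Complex.log_ofReal_mul ha]
  intro h1
  rw [e, h1, mul_zero] at h
  exact h rfl

/-- The logarithm of Gauss's product, obtained from the Weierstrass series by H_n - log n → γ. All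
logarithms are principal and splitting off the positive factor k+1 causes no jump, so the branch is
preserved. -/
theorem tendsto_logGamma {x : ℂ} (hx : x ∈ Complex.slitPlane) :
    Tendsto (fun n : ℕ => x * Real.log n + Real.log n.factorial -
      ∑ k ∈ Finset.range (n + 1), Complex.log (x + k)) atTop (𝓝 (logGamma x)) := by
  have hγ : Tendsto (fun n : ℕ => (((harmonic n : ℝ) - Real.log n : ℝ) : ℂ)) atTop
      (𝓝 Real.eulerMascheroniConstant) :=
    (Complex.continuous_ofReal.tendsto _).comp Real.tendsto_harmonic_sub_log
  have hlim : Tendsto (fun n : ℕ => -(((harmonic n : ℝ) - Real.log n : ℝ) : ℂ) * x - Complex.log x +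
      ∑ k ∈ Finset.range n, (x / ((k : ℂ) + 1) - Complex.log (1 + x / ((k : ℂ) + 1)))) atTop
      (𝓝 (logGamma x)) :=
    ((hγ.neg.mul_const x).sub_const _).add (summable_logGamma x).hasSum.tendsto_sum_nat
  refine hlim.congr fun n => ?_
  have hharm : ((harmonic n : ℝ) : ℂ) = ∑ k ∈ Finset.range n, 1 / ((k : ℂ) + 1) := by
    simp [harmonic]
  have hfac : (Real.log n.factorial : ℂ) = ∑ k ∈ Finset.range n, (Real.log ((k : ℝ) + 1) : ℂ) := by
    rw [← Finset.prod_range_add_one_eq_factorial, Nat.cast_prod, Real.log_prod]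
    · push_cast; rfl
    · intro k _; positivity
  have hlog : ∀ k : ℕ, Complex.log (1 + x / ((k : ℂ) + 1)) =
      Complex.log (x + (k + 1 : ℕ)) - Real.log ((k : ℝ) + 1) := by
    intro k
    have := log_add_natCast_eq hx (a := (k : ℝ) + 1) (by positivity)
    push_cast at this ⊢
    rw [this]
    ring
  rw [Finset.sum_range_succ', hfac, Finset.sum_sub_distrib]
  simp only [hlog, Finset.sum_sub_distrib]
  have h3 : ∑ k ∈ Finset.range n, x / ((k : ℂ) + 1) = x * ∑ k ∈ Finset.range n, 1 / ((k : ℂ) + 1) := by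
    rw [Finset.mul_sum]
    exact Finset.sum_congr rfl fun k _ => by ring
  rw [h3, ← hharm]
  push_cast
  rw [add_zero]
  ring

theorem tendsto_natCast_mul_log (x : ℂ) :
    Tendsto (fun n : ℕ => (n : ℂ) * Complex.log (1 + x / n)) atTop (𝓝 x) := by
  refine Complex.tendsto_nat_mul_log_one_add_of_tendsto (tendsto_const_nhds.congr' ?_)
  filter_upwards [eventually_ne_atTop 0] with n hn
  have : (n : ℂ) ≠ 0 := by exact_mod_cast hn
  field_simp

theorem tendsto_log_one_add_div (x : ℂ) :
    Tendsto (fun n : ℕ => Complex.log (1 + x / n)) atTop (𝓝 0) := by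
  have h : Tendsto (fun n : ℕ => 1 + x / (n : ℂ)) atTop (𝓝 (1 + 0)) :=
    tendsto_const_nhds.add (tendsto_const_div_atTop_nhds_zero_nat x)
  have := h.clog (by simp)
  simpa using this

/-- In Gauss's limit, replacing x by x+1 removes log x from the sum and appends log(x+n+1), which
differs from log n by o(1). -/
theorem logGamma_add_one {x : ℂ} (hx : x ∈ Complex.slitPlane) :
    logGamma (x + 1) = logGamma x + Complex.log x := by
  have hx1 : x + 1 ∈ Complex.slitPlane := by
    simpa using add_ofReal_mem_slitPlane hx zero_le_one
  have h1 := ((tendsto_logGamma hx).add_const (Complex.log x)).sub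
    (tendsto_log_one_add_div (x + 1))
  rw [sub_zero] at h1
  refine tendsto_nhds_unique (tendsto_logGamma hx1) (h1.congr' ?_)
  filter_upwards [eventually_ge_atTop 1] with n hn
  have hl := log_add_natCast_eq hx1 (a := (n : ℝ)) (by positivity)
  rw [Complex.ofReal_natCast] at hl
  have e : ∀ k : ℕ, x + 1 + k = x + ((k + 1 : ℕ) : ℂ) := fun k => by push_cast; ring
  rw [Finset.sum_range_succ', Finset.sum_range_succ _ n, hl]
  simp only [e]
  push_cast
  rw [add_zero]
  ring

theorem logGamma_add_natCast {x : ℂ} (hx : x ∈ Complex.slitPlane) (n : ℕ) :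
    logGamma (x + n) = logGamma x + ∑ k ∈ Finset.range n, Complex.log (x + k) := by
  induction n with
  | zero => simp
  | succ n ih =>
    have h1 : x + n ∈ Complex.slitPlane := by
      exact_mod_cast add_ofReal_mem_slitPlane hx (Nat.cast_nonneg n)
    rw [Finset.sum_range_succ, ← add_assoc, ← ih, ← logGamma_add_one h1]
    push_cast
    rw [add_assoc]

theorem tendsto_log_factorial :
    Tendsto (fun n : ℕ => Real.log n.factorial - ((n + 1 / 2) * Real.log n - n)) atTop
      (𝓝 (1 / 2 * Real.log (2 * Real.pi))) := by
  have h1 := (Real.continuousAt_log (Real.sqrt_pos.2 Real.pi_pos).ne').tendsto.comp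
    Stirling.tendsto_stirlingSeq_sqrt_pi
  have h2 := h1.add_const (1 / 2 * Real.log 2)
  have e : Real.log (Real.sqrt Real.pi) + 1 / 2 * Real.log 2 = 1 / 2 * Real.log (2 * Real.pi) := by
    rw [Real.log_sqrt Real.pi_pos.le, Real.log_mul two_ne_zero Real.pi_ne_zero]
    ring
  rw [e] at h2
  refine h2.congr' ?_
  filter_upwards [eventually_ge_atTop 1] with n hn
  have hn0 : (n : ℝ) ≠ 0 := by positivity
  rw [Function.comp_apply, Stirling.log_stirlingSeq_formula, Real.log_mul two_ne_zero hn0,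
    Real.log_div hn0 (Real.exp_pos 1).ne', Real.log_exp]
  ring

/-- The `k`-th derivative of `z ↦ z log z - z`. -/
noncomputable def mulLogDeriv : ℕ → ℂ → ℂ
  | 0, z => z * Complex.log z - z
  | 1, z => Complex.log z
  | k + 2, z => (-1) ^ k * (k.factorial : ℂ) / z ^ (k + 1)

theorem hasDerivAt_mulLogDeriv (k : ℕ) {z : ℂ} (hz : z ∈ Complex.slitPlane) :
    HasDerivAt (mulLogDeriv k) (mulLogDeriv (k + 1) z) z := by
  have hz0 := Complex.slitPlane_ne_zero hz
  match k with
  | 0 =>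
    refine (((hasDerivAt_id z).mul (Complex.hasDerivAt_log hz)).sub (hasDerivAt_id z)).congr_deriv ?_
    simp [mulLogDeriv, hz0]
  | 1 =>
    refine (Complex.hasDerivAt_log hz).congr_deriv ?_
    simp [mulLogDeriv]
  | k + 2 =>
    have h1 : HasDerivAt (fun z : ℂ => z ^ (k + 1)) (((k + 1 : ℕ) : ℂ) * z ^ k) z := by
      simpa using hasDerivAt_pow (k + 1) z
    refine ((h1.inv (pow_ne_zero _ hz0)).const_mul ((-1) ^ k * (k.factorial : ℂ))).congr_deriv ?_
    rw [mulLogDeriv, Nat.factorial_succ]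
    push_cast
    field_simp
    ring

theorem norm_mulLogDeriv (k : ℕ) (z : ℂ) :
    ‖mulLogDeriv (k + 2) z‖ = k.factorial / ‖z‖ ^ (k + 1) := by
  rw [mulLogDeriv, norm_div, norm_mul, norm_pow, norm_neg, norm_one, one_pow, one_mul,
    Complex.norm_natCast, norm_pow]

theorem eulerMaclaurinSum_add_two (m : ℕ) (h : ℕ → ℂ) :
    eulerMaclaurinSum (m + 1) h = h 0 - 1 / 2 * h 1 +
      ∑ k ∈ Finset.range m, (bernoulli (k + 2) : ℂ) / ((k + 2).factorial : ℂ) * h (k + 2) := by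
  rw [eulerMaclaurinSum, Finset.sum_range_succ', Finset.sum_range_succ']
  simp [bernoulli_one]
  ring

theorem tendsto_norm_add_natCast (x : ℂ) : Tendsto (fun n : ℕ => ‖x + n‖) atTop atTop := by
  have h : Tendsto (fun n : ℕ => (n : ℝ) - ‖x‖) atTop atTop :=
    tendsto_atTop_add_const_right _ _ tendsto_natCast_atTop_atTop
  refine tendsto_atTop_mono (fun n => ?_) h
  have := norm_sub_norm_le (n : ℂ) (-x)
  rw [norm_neg, Complex.norm_natCast] at this
  rw [add_comm]
  simpa using this

/-- The difference equation determines log Γ only up to a constant; the constant ½ log 2π is fixed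
here, from Gauss's limit and Stirling's formula for n!. -/
theorem tendsto_logGamma_sub_stirling {x : ℂ} (hx : x ∈ Complex.slitPlane) (m : ℕ) :
    Tendsto (fun n : ℕ => -(logGamma (x + n) - 1 / 2 * Real.log (2 * Real.pi)) +
      eulerMaclaurinSum (m + 1) (fun k => mulLogDeriv k (x + n))) atTop (𝓝 0) := by
  have hrest : Tendsto (fun n : ℕ => ∑ k ∈ Finset.range m, (bernoulli (k + 2) : ℂ) /
      ((k + 2).factorial : ℂ) * mulLogDeriv (k + 2) (x + n)) atTop (𝓝 0) := by
    have : Tendsto (fun n : ℕ => ∑ k ∈ Finset.range m, (bernoulli (k + 2) : ℂ) /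
      ((k + 2).factorial : ℂ) * mulLogDeriv (k + 2) (x + n)) atTop
        (𝓝 (∑ k ∈ Finset.range m, (bernoulli (k + 2) : ℂ) / ((k + 2).factorial : ℂ) * 0)) := by
      refine tendsto_finsetSum _ fun k _ => Tendsto.const_mul _ ?_
      rw [tendsto_zero_iff_norm_tendsto_zero]
      simp only [norm_mulLogDeriv]
      exact Tendsto.const_div_atTop ((tendsto_pow_atTop (by omega)).comp
        (tendsto_norm_add_natCast x)) _
    simpa using this
  have h1 := (tendsto_logGamma hx).sub_const (logGamma x)
  rw [sub_self] at h1
  have h2 := (Complex.continuous_ofReal.tendsto _).comp tendsto_log_factorial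
  have h3 := tendsto_natCast_mul_log x
  have h4 := tendsto_log_one_add_div x
  have h5 := (((h1.sub h2).add (h3.add (h4.const_mul (x + 1 / 2)))).sub_const
    (x - 1 / 2 * (Real.log (2 * Real.pi) : ℂ))).add hrest
  have e : (0 : ℂ) - ((1 / 2 * Real.log (2 * Real.pi) : ℝ) : ℂ) + (x + (x + 1 / 2) * 0) -
      (x - 1 / 2 * (Real.log (2 * Real.pi) : ℂ)) + 0 = 0 - 0 := by push_cast; ring
  rw [e, sub_self] at h5
  refine h5.congr' ?_
  filter_upwards [eventually_ge_atTop 1] with n hn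
  have hl := log_add_natCast_eq hx (a := (n : ℝ)) (by positivity)
  rw [Complex.ofReal_natCast] at hl
  rw [eulerMaclaurinSum_add_two, logGamma_add_natCast hx, Finset.sum_range_succ]
  simp only [mulLogDeriv, Function.comp_apply, hl]
  push_cast
  ring

theorem logGamma_stirling {κ : ℝ} (hκ : 0 < κ) (j : ℕ) : ∃ C : ℝ, 0 ≤ C ∧
    ∀ x ∈ Complex.slitPlane, InSector κ x → 1 ≤ ‖x‖ →
      ‖logGamma x - 1 / 2 * Real.log (2 * Real.pi) -
        eulerMaclaurinSum (j + 2) (fun k => mulLogDeriv k x)‖ ≤ C / ‖x‖ ^ j := by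
  obtain ⟨C, hC0, hC⟩ := exists_eulerMaclaurin_bound (j + 2) (by omega)
  refine ⟨C * ((j + 1).factorial / κ ^ (j + 2) * ∑' n : ℕ, 1 / ((n : ℝ) + 1) ^ 2), ?_, ?_⟩
  · have : 0 ≤ ∑' n : ℕ, 1 / ((n : ℝ) + 1) ^ 2 := tsum_nonneg fun n => by positivity
    positivity
  intro x hx hsec hx1
  have hsum : Summable fun n : ℕ => 1 / ((n : ℝ) + 1) ^ 2 := summable_logGamma_bound 1
  -- The remainder involves |x+n+t|^{-(j+2)}, and the sector gives |x+n+t| ≥ κ(|x|+n). Of the j+2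
  -- factors, j provide the decay in |x| and two the convergence of the sum over n; the lost power
  -- is harmless as j is arbitrary.
  have h := hC (fun k t => mulLogDeriv k (x + t))
    (fun n => -(logGamma (x + n) - 1 / 2 * Real.log (2 * Real.pi)))
    (fun n => (j + 1).factorial / κ ^ (j + 2) / ‖x‖ ^ j * (1 / ((n : ℝ) + 1) ^ 2)) ?_ ?_ ?_ ?_
    (hsum.mul_left _)
  · rw [tsum_mul_left] at h
    rw [← norm_neg]
    refine le_trans (le_of_eq ?_) (h.trans (le_of_eq ?_))
    · congr 1
      simp
      ring
    · ring
  · intro k t ht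
    exact ((hasDerivAt_mulLogDeriv k (add_ofReal_mem_slitPlane hx ht)).comp_const_add x
      (t : ℂ)).comp_ofReal
  · intro n
    have h1 : x + n ∈ Complex.slitPlane := by
      exact_mod_cast add_ofReal_mem_slitPlane hx (Nat.cast_nonneg n)
    have h2 := logGamma_add_one h1
    rw [show x + ((n + 1 : ℕ) : ℂ) = x + n + 1 by push_cast; ring, h2]
    simp [mulLogDeriv]
  · simpa using tendsto_logGamma_sub_stirling hx (j + 1)
  · intro n t ht
    have ht0 : 0 ≤ (n : ℝ) + t := add_nonneg (Nat.cast_nonneg n) ht.1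
    have h1 := hsec (n + t) ht0
    rw [norm_mulLogDeriv (j + 1)]
    have h2 : κ * (‖x‖ + n) ≤ ‖x + ((n + t : ℝ) : ℂ)‖ := by
      refine le_trans ?_ h1
      gcongr
      linarith [ht.1]
    have h3 : κ ^ (j + 2) * (‖x‖ ^ j * ((n : ℝ) + 1) ^ 2) ≤ ‖x + ((n + t : ℝ) : ℂ)‖ ^ (j + 2) := by
      calc κ ^ (j + 2) * (‖x‖ ^ j * ((n : ℝ) + 1) ^ 2)
          ≤ κ ^ (j + 2) * ((‖x‖ + n) ^ j * (‖x‖ + n) ^ 2) := by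
            have hn := Nat.cast_nonneg (α := ℝ) n
            have h4 : ‖x‖ ≤ ‖x‖ + n := by linarith
            have h5 : (n : ℝ) + 1 ≤ ‖x‖ + n := by linarith
            gcongr
        _ = (κ * (‖x‖ + n)) ^ (j + 2) := by rw [mul_pow, ← pow_add]
        _ ≤ _ := by gcongr
    calc ((j + 1).factorial : ℝ) / ‖x + ((n + t : ℝ) : ℂ)‖ ^ (j + 2)
        ≤ (j + 1).factorial / (κ ^ (j + 2) * (‖x‖ ^ j * ((n : ℝ) + 1) ^ 2)) := by
          gcongr
      _ = _ := by field_simp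

/-! ### The regular part of 1/(e^w - 1). -/

theorem norm_exp_sub_one_ge {w : ℂ} (hw : ‖w‖ ≤ 1 / 2) : ‖w‖ / 2 ≤ ‖Complex.exp w - 1‖ := by
  have h1 := Complex.norm_exp_sub_one_sub_id_le (x := w) (by linarith)
  have h2 := norm_sub_norm_le w (w - (Complex.exp w - 1))
  rw [sub_sub_cancel, norm_sub_rev w] at h2
  nlinarith [norm_nonneg w]

/-- Euler–Maclaurin on [0, 1] for t ↦ e^{wt}: all its derivatives are proportional, so a factor e^w
- 1 comes out and the formula becomes the Bernoulli expansion of 1/(e^w - 1) with an explicit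
remainder. -/
theorem exists_norm_inv_exp_sub_one_sub_le (N : ℕ) : ∃ C : ℝ, 0 ≤ C ∧ ∀ w : ℂ, w ≠ 0 →
    ‖w‖ ≤ 1 / 2 →
    ‖1 / (Complex.exp w - 1) - 1 / w -
      ∑ n ∈ Finset.Icc 1 N, (bernoulli n : ℂ) / (n.factorial : ℂ) * w ^ (n - 1)‖ ≤ C * ‖w‖ ^ N := by
  obtain ⟨C, hC0, hC⟩ := exists_eulerMaclaurin_unit_bound (N + 1) (by omega)
  -- The factor 2 comes from |e^w - 1| ≥ |w|/2, the factor e from bounding e^{wt}. The last summand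
  -- accounts for the term n = N + 1, present because the order N + 1 is used.
  refine ⟨2 * C * Real.exp 1 + ‖(bernoulli (N + 1) : ℂ) / ((N + 1).factorial : ℂ)‖,
    by positivity, fun w hw hw2 => ?_⟩
  have hw0 : 0 < ‖w‖ := norm_pos_iff.2 hw
  have hge := norm_exp_sub_one_ge hw2
  have hne : Complex.exp w - 1 ≠ 0 := by
    rw [← norm_pos_iff]; linarith
  have h := hC (fun k t => w ^ ((k : ℤ) - 1) * Complex.exp (w * t)) (‖w‖ ^ (N + 1) * Real.exp 1)
    (fun k t _ => ?_) (fun t ht => ?_)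
  · have hS : eulerMaclaurinSum (N + 1) (fun k => w ^ ((k : ℤ) - 1)) = 1 / w +
        ∑ n ∈ Finset.Icc 1 N, (bernoulli n : ℂ) / (n.factorial : ℂ) * w ^ (n - 1) +
        (bernoulli (N + 1) : ℂ) / ((N + 1).factorial : ℂ) * w ^ N := by
      rw [eulerMaclaurinSum, Finset.sum_range_succ, Finset.sum_range_succ',
        show ((N + 1 : ℕ) : ℤ) - 1 = (N : ℤ) by push_cast; ring, zpow_natCast]
      have : ∑ k ∈ Finset.range N, (bernoulli (k + 1) : ℂ) / ((k + 1).factorial : ℂ) *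
          w ^ (((k + 1 : ℕ) : ℤ) - 1) =
          ∑ n ∈ Finset.Icc 1 N, (bernoulli n : ℂ) / (n.factorial : ℂ) * w ^ (n - 1) := by
        rw [← Finset.Ico_add_one_right_eq_Icc, Finset.sum_Ico_eq_sum_range]
        refine Finset.sum_congr (by simp) fun k _ => ?_
        rw [show ((k + 1 : ℕ) : ℤ) - 1 = (k : ℤ) by push_cast; ring, zpow_natCast, add_comm 1 k,
          Nat.add_sub_cancel]
      rw [this]
      simp
      ring
    have hfac : eulerMaclaurinSum (N + 1) (fun k => w ^ ((k : ℤ) - 1) * Complex.exp (w * (1 : ℝ))) -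
        eulerMaclaurinSum (N + 1) (fun k => w ^ ((k : ℤ) - 1) * Complex.exp (w * (0 : ℝ))) -
        w ^ (((1 : ℕ) : ℤ) - 1) * Complex.exp (w * (0 : ℝ)) =
        (Complex.exp w - 1) * (eulerMaclaurinSum (N + 1) (fun k => w ^ ((k : ℤ) - 1)) -
          1 / (Complex.exp w - 1)) := by
      rw [mul_sub, mul_one_div_cancel hne]
      simp only [eulerMaclaurinSum, Finset.mul_sum]
      simp
      rw [← Finset.sum_sub_distrib]
      exact Finset.sum_congr rfl fun k _ => by ring
    rw [hfac, norm_mul, hS] at h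
    have h2 : ‖1 / w + ∑ n ∈ Finset.Icc 1 N, (bernoulli n : ℂ) / (n.factorial : ℂ) * w ^ (n - 1) +
        (bernoulli (N + 1) : ℂ) / ((N + 1).factorial : ℂ) * w ^ N - 1 / (Complex.exp w - 1)‖ ≤
        2 * C * Real.exp 1 * ‖w‖ ^ N := by
      have h3 := (mul_le_mul_of_nonneg_right hge (norm_nonneg _)).trans h
      rw [← mul_le_mul_iff_right₀ (show 0 < ‖w‖ / 2 by positivity)]
      refine h3.trans (le_of_eq ?_)
      ring
    have e : 1 / (Complex.exp w - 1) - 1 / w -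
        ∑ n ∈ Finset.Icc 1 N, (bernoulli n : ℂ) / (n.factorial : ℂ) * w ^ (n - 1) =
        (bernoulli (N + 1) : ℂ) / ((N + 1).factorial : ℂ) * w ^ N -
        (1 / w + ∑ n ∈ Finset.Icc 1 N, (bernoulli n : ℂ) / (n.factorial : ℂ) * w ^ (n - 1) +
        (bernoulli (N + 1) : ℂ) / ((N + 1).factorial : ℂ) * w ^ N - 1 / (Complex.exp w - 1)) := by
      ring
    rw [e]
    refine (norm_sub_le _ _).trans ?_
    rw [norm_mul, norm_pow]
    linarith
  · have h1 : HasDerivAt (fun t : ℂ => w ^ ((k : ℤ) - 1) * Complex.exp (w * t))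
        (w ^ ((k : ℤ) - 1) * (Complex.exp (w * t) * w)) (t : ℂ) := by
      refine HasDerivAt.const_mul _ (HasDerivAt.cexp ?_)
      simpa using (hasDerivAt_id (t : ℂ)).const_mul w
    refine h1.comp_ofReal.congr_deriv ?_
    rw [show ((k + 1 : ℕ) : ℤ) - 1 = ((k : ℤ) - 1) + 1 by push_cast; ring, zpow_add_one₀ hw]
    ring
  · rw [norm_mul, show ((N + 1 + 1 : ℕ) : ℤ) - 1 = ((N + 1 : ℕ) : ℤ) by push_cast; ring,
      zpow_natCast, norm_pow, Complex.norm_exp]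
    gcongr
    have h1 := Complex.re_le_norm w
    have : (w * t).re = w.re * t := by simp
    rw [this]
    nlinarith [ht.1, ht.2]

/-- The Taylor polynomial at `0` of `∫∫ (1 / (e^w - 1) - 1 / w)`. -/
noncomputable def bernoulliTaylor (N : ℕ) : Polynomial ℂ :=
  ∑ n ∈ Finset.Icc 1 N,
    Polynomial.C ((bernoulli n : ℂ) / ((n : ℂ) * ((n + 1).factorial : ℂ))) * Polynomial.X ^ (n + 1)

theorem eval_iterate_derivative_bernoulliTaylor (N k : ℕ) (w : ℂ) :
    (Polynomial.derivative^[k] (bernoulliTaylor N)).eval w = ∑ n ∈ Finset.Icc 1 N,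
      (bernoulli n : ℂ) / ((n : ℂ) * ((n + 1).factorial : ℂ)) * ((n + 1).descFactorial k : ℂ) *
        w ^ (n + 1 - k) := by
  rw [bernoulliTaylor, Polynomial.iterate_derivative_sum, Polynomial.eval_finsetSum]
  refine Finset.sum_congr rfl fun n _ => ?_
  rw [Polynomial.iterate_derivative_C_mul, Polynomial.iterate_derivative_X_pow_eq_natCast_mul]
  simp
  ring

/-- The function 1/(e^w - 1) - 1/w extends holomorphically to the disc, where primitives exist; two
primitives vanishing at 0 give φ 1 and φ 0. -/
theorem exists_regular_part : ∃ φ : ℕ → ℂ → ℂ,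
    (∀ k, ∀ w ∈ Metric.ball (0 : ℂ) 1, HasDerivAt (φ k) (φ (k + 1) w) w) ∧ φ 0 0 = 0 ∧ φ 1 0 = 0 ∧
    ∀ w ∈ Metric.ball (0 : ℂ) 1, w ≠ 0 → φ 2 w = 1 / (Complex.exp w - 1) - 1 / w := by
  have hball : Metric.ball (0 : ℂ) 1 ∈ 𝓝 (0 : ℂ) := Metric.ball_mem_nhds 0 one_pos
  set g : ℂ → ℂ := dslope Complex.exp 0 with hg
  have hg0 : g 0 = 1 := by simp [hg]
  have hgne : ∀ w, w ≠ 0 → g w = (Complex.exp w - 1) / w := by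
    intro w hw
    rw [hg, dslope_of_ne _ hw, slope_def_field]
    simp
  have hgd : DifferentiableOn ℂ g (Metric.ball 0 1) :=
    (Complex.differentiableOn_dslope hball).2 Complex.differentiable_exp.differentiableOn
  have hgz : ∀ w ∈ Metric.ball (0 : ℂ) 1, g w ≠ 0 := by
    intro w hw
    by_cases h : w = 0
    · rw [h, hg0]; exact one_ne_zero
    · rw [hgne w h]
      refine div_ne_zero (fun h0 => ?_) h
      have hw1 : ‖w‖ < 1 := by simpa using hw
      -- If e^w = 1, this bound reads |w| ≤ |w|², impossible for 0 < |w| < 1.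
      have h1 := Complex.norm_exp_sub_one_sub_id_le (x := w) hw1.le
      rw [h0, zero_sub, norm_neg] at h1
      nlinarith [norm_pos_iff.2 h]
  -- Away from 0 this is (w/(e^w - 1) - 1)/w; the divided difference at 0 supplies the holomorphic
  -- extension.
  set ψ : ℂ → ℂ := dslope (fun w => (g w)⁻¹) 0 with hψ
  have hψd : DifferentiableOn ℂ ψ (Metric.ball 0 1) :=
    (Complex.differentiableOn_dslope hball).2 (hgd.inv hgz)
  obtain ⟨f, hf0, hf⟩ := hψd.isExactOn_ball.with_val_at 0 0
  have hfd : DifferentiableOn ℂ f (Metric.ball 0 1) := fun w hw =>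
    (hf w hw).differentiableAt.differentiableWithinAt
  obtain ⟨F, hF0, hF⟩ := hfd.isExactOn_ball.with_val_at 0 0
  refine ⟨fun k => match k with
    | 0 => F
    | 1 => f
    | k + 2 => iteratedDeriv k ψ, ?_, hF0, hf0, ?_⟩
  · intro k w hw
    match k with
    | 0 => exact hF w hw
    | 1 => simpa using hf w hw
    | k + 2 =>
      have h2 : DifferentiableAt ℂ (iteratedDeriv k ψ) w := by
        rw [iteratedDeriv_eq_iterate]
        exact ((hψd.analyticOnNhd Metric.isOpen_ball).iterated_deriv k w hw).differentiableAt
      simpa [iteratedDeriv_succ] using h2.hasDerivAt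
  · intro w hw hw0
    have hne : Complex.exp w - 1 ≠ 0 := by
      intro h0
      apply hgz w hw
      rw [hgne w hw0, h0, zero_div]
    simp only [iteratedDeriv_zero, hψ]
    rw [dslope_of_ne _ hw0, slope_def_field, hg0, hgne w hw0]
    field_simp
    simp
    ring

/-- For k = 2 this is the Bernoulli expansion. The mean value inequality from 0 gains a power for k
= 1 and k = 0; Cauchy's estimate loses one per derivative for k > 2. The truncated exponent means
mere boundedness once k ≥ N + 2. -/
theorem exists_norm_sub_bernoulliTaylor_le {φ : ℕ → ℂ → ℂ}
    (hd : ∀ k, ∀ w ∈ Metric.ball (0 : ℂ) 1, HasDerivAt (φ k) (φ (k + 1) w) w)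
    (h0 : φ 0 0 = 0) (h1 : φ 1 0 = 0)
    (h2 : ∀ w ∈ Metric.ball (0 : ℂ) 1, w ≠ 0 → φ 2 w = 1 / (Complex.exp w - 1) - 1 / w)
    (N k : ℕ) : ∃ C : ℝ, 0 ≤ C ∧ ∀ w : ℂ, w ≠ 0 → ‖w‖ ≤ 1 / 4 →
      ‖φ k w - (Polynomial.derivative^[k] (bernoulliTaylor N)).eval w‖ ≤ C * ‖w‖ ^ (N + 2 - k) := by
  set e : ℕ → ℂ → ℂ := fun k w => φ k w - (Polynomial.derivative^[k] (bernoulliTaylor N)).eval w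
    with he
  have hed : ∀ k, ∀ w ∈ Metric.ball (0 : ℂ) 1, HasDerivAt (e k) (e (k + 1) w) w := by
    intro k w hw
    refine (hd k w hw).sub ?_
    rw [Function.iterate_succ_apply']
    exact Polynomial.hasDerivAt _ w
  have hmem : ∀ w : ℂ, ‖w‖ ≤ 1 / 2 → w ∈ Metric.ball (0 : ℂ) 1 := fun w hw => by
    rw [Metric.mem_ball, dist_zero_right]; linarith
  obtain ⟨C, hC0, hC⟩ := exists_norm_inv_exp_sub_one_sub_le N
  have hb2' : ∀ w : ℂ, w ≠ 0 → ‖w‖ ≤ 1 / 2 → ‖e 2 w‖ ≤ C * ‖w‖ ^ N := by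
    intro w hw hw2
    refine le_trans (le_of_eq ?_) (hC w hw hw2)
    simp only [he]
    rw [h2 w (hmem w hw2) hw, eval_iterate_derivative_bernoulliTaylor]
    congr 2
    refine Finset.sum_congr rfl fun n hn => ?_
    obtain ⟨j, rfl⟩ : ∃ j, n = j + 1 := ⟨n - 1, by have := (Finset.mem_Icc.1 hn).1; omega⟩
    rw [show j + 1 + 1 - 2 = j + 1 - 1 by omega]
    congr 1
    have h3 : (j : ℂ) + 1 ≠ 0 := Nat.cast_add_one_ne_zero j
    have h4 : (j : ℂ) + 1 + 1 ≠ 0 := by exact_mod_cast Nat.cast_add_one_ne_zero (R := ℂ) (j + 1)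
    have h5 : ((j + 1).factorial : ℂ) ≠ 0 := by exact_mod_cast (j + 1).factorial_ne_zero
    rw [Nat.factorial_succ (j + 1), Nat.succ_descFactorial_succ, Nat.succ_descFactorial_succ]
    push_cast
    simp
    field_simp
  have hb2 : ∀ w : ℂ, ‖w‖ ≤ 1 / 2 → ‖e 2 w‖ ≤ C * ‖w‖ ^ N := by
    intro w hw2
    by_cases hw : w = 0
    · subst hw
      have hc : Tendsto (fun w : ℂ => ‖e 2 w‖) (𝓝[≠] 0) (𝓝 ‖e 2 0‖) :=
        ((hed 2 0 (hmem 0 hw2)).continuousAt.norm.tendsto).mono_left nhdsWithin_le_nhds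
      have hc2 : Tendsto (fun w : ℂ => C * ‖w‖ ^ N) (𝓝[≠] 0) (𝓝 (C * ‖(0 : ℂ)‖ ^ N)) := by
        have : Continuous fun w : ℂ => C * ‖w‖ ^ N := by fun_prop
        exact (this.tendsto 0).mono_left nhdsWithin_le_nhds
      refine le_of_tendsto_of_tendsto hc hc2 ?_
      have hb : ∀ᶠ w : ℂ in 𝓝[≠] 0, w ∈ Metric.ball (0 : ℂ) (1 / 2) :=
        nhdsWithin_le_nhds (Metric.ball_mem_nhds 0 (by norm_num))
      filter_upwards [hb, self_mem_nhdsWithin] with w hw1 hw3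
      exact hb2' w hw3 (by simpa using (Metric.mem_ball.1 hw1).le)
    · exact hb2' w hw hw2
  have hstep : ∀ k j : ℕ, (∀ w : ℂ, ‖w‖ ≤ 1 / 2 → ‖e (k + 1) w‖ ≤ C * ‖w‖ ^ j) → e k 0 = 0 →
      ∀ w : ℂ, ‖w‖ ≤ 1 / 2 → ‖e k w‖ ≤ C * ‖w‖ ^ (j + 1) := by
    intro k j hk hk0 w hw
    have := (convex_closedBall (0 : ℂ) ‖w‖).norm_image_sub_le_of_norm_hasDerivWithin_le
      (f := e k) (f' := e (k + 1)) (C := C * ‖w‖ ^ j) (x := 0) (y := w)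
      (fun z hz => (hed k z (hmem z ((by simpa using hz : ‖z‖ ≤ ‖w‖).trans hw))).hasDerivWithinAt)
      (fun z hz => by
        have hz' : ‖z‖ ≤ ‖w‖ := by simpa using hz
        exact (hk z (hz'.trans hw)).trans (by gcongr)) (by simp) (by simp)
    rw [hk0, sub_zero, sub_zero] at this
    rw [pow_succ, ← mul_assoc]
    exact this
  have he1 : e 1 0 = 0 := by
    simp only [he]
    rw [h1, eval_iterate_derivative_bernoulliTaylor, Finset.sum_eq_zero, sub_zero]
    intro n hn
    have := (Finset.mem_Icc.1 hn).1
    rw [zero_pow (by omega), mul_zero]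
  have he0 : e 0 0 = 0 := by
    simp only [he]
    rw [h0, eval_iterate_derivative_bernoulliTaylor, Finset.sum_eq_zero, sub_zero]
    intro n hn
    rw [zero_pow (by omega), mul_zero]
  have hb1 := hstep 1 N hb2 he1
  have hb0 := hstep 0 (N + 1) hb1 he0
  match k with
  | 0 => exact ⟨C, hC0, fun w _ hw => hb0 w (by linarith)⟩
  | 1 => exact ⟨C, hC0, fun w _ hw => hb1 w (by linarith)⟩
  | k + 2 =>
    have hiter : ∀ j : ℕ, ∀ w ∈ Metric.ball (0 : ℂ) 1, iteratedDeriv j (e 2) w = e (j + 2) w := by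
      intro j
      induction j with
      | zero => intro w _; simp
      | succ j ih =>
        intro w hw
        rw [iteratedDeriv_succ]
        have : iteratedDeriv j (e 2) =ᶠ[𝓝 w] e (j + 2) := by
          filter_upwards [Metric.isOpen_ball.mem_nhds hw] with z hz using ih z hz
        rw [this.deriv_eq]
        exact (hed (j + 2) w hw).deriv
    have hcauchy : ∀ w : ℂ, ∀ R B : ℝ, 0 < R → ‖w‖ + R ≤ 1 / 2 → C * (‖w‖ + R) ^ N ≤ B →
        ‖e (k + 2) w‖ ≤ k.factorial * B / R ^ k := by
      intro w R B hR hw hB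
      have hsub : ∀ z ∈ Metric.closedBall w R, ‖z‖ ≤ ‖w‖ + R := by
        intro z hz
        rw [Metric.mem_closedBall, dist_eq_norm] at hz
        have := norm_add_le w (z - w)
        rw [add_sub_cancel] at this
        linarith
      rw [← hiter k w (hmem w (by linarith))]
      refine Complex.norm_iteratedDeriv_le_of_forall_mem_sphere_norm_le k hR ?_ ?_
      · refine DifferentiableOn.diffContOnCl fun z hz => ?_
        rw [closure_ball _ hR.ne'] at hz
        exact (hed 2 z (hmem z ((hsub z hz).trans hw))).differentiableAt.differentiableWithinAt
      · intro z hz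
        have h3 := hsub z (Metric.sphere_subset_closedBall hz)
        refine (hb2 z (h3.trans hw)).trans (le_trans ?_ hB)
        gcongr
    -- Cauchy's estimate on the disc of radius |w| about w keeps the power of |w|, since there the
    -- function is at most C(2|w|)^N. Beyond order N only boundedness is claimed and the fixed
    -- radius 1/4 suffices. Both discs lie in |z| ≤ 1/2 when |w| ≤ 1/4.
    rcases le_or_gt k N with hkN | hkN
    · refine ⟨k.factorial * (C * 2 ^ N), by positivity, fun w hw hw4 => ?_⟩
      have hw0 : 0 < ‖w‖ := norm_pos_iff.2 hw
      refine (hcauchy w ‖w‖ _ hw0 (by linarith) le_rfl).trans (le_of_eq ?_)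
      rw [← two_mul, mul_pow, show N + 2 - (k + 2) = N - k by omega]
      have : ‖w‖ ^ N = ‖w‖ ^ (N - k) * ‖w‖ ^ k := by rw [← pow_add]; congr 1; omega
      rw [this]
      field_simp
    · refine ⟨k.factorial * (C * 1) / (1 / 4) ^ k, by positivity, fun w hw hw4 => ?_⟩
      rw [show N + 2 - (k + 2) = 0 by omega, pow_zero, mul_one]
      refine hcauchy w (1 / 4) _ (by norm_num) (by linarith) ?_
      gcongr
      exact pow_le_one₀ (by positivity) (by linarith)

/-! ### The dilogarithm near its singularity. -/

/-- The slit disc of radius `ρ`. -/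
def slitBall (ρ : ℝ) : Set ℂ := Complex.slitPlane ∩ Metric.ball 0 ρ

theorem isOpen_slitBall (ρ : ℝ) : IsOpen (slitBall ρ) :=
  Complex.isOpen_slitPlane.inter Metric.isOpen_ball

theorem ofReal_mem_slitBall {ρ s : ℝ} (hs : 0 < s) (hsρ : s < ρ) : (s : ℂ) ∈ slitBall ρ :=
  ⟨Complex.ofReal_mem_slitPlane.2 hs, by
    rw [Metric.mem_ball, dist_zero_right, Complex.norm_real, Real.norm_of_nonneg hs.le]
    exact hsρ⟩

theorem isPreconnected_slitBall {ρ : ℝ} (hρ : 0 < ρ) : IsPreconnected (slitBall ρ) := by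
  have h1 := ofReal_mem_slitBall (ρ := ρ) (s := ρ / 2) (by linarith) (by linarith)
  have h2 : StarConvex ℝ ((ρ / 2 : ℝ) : ℂ) (slitBall ρ) :=
    (Complex.starConvex_ofReal_slitPlane (by linarith)).inter ((convex_ball 0 ρ).starConvex h1.2)
  exact (h2.isPathConnected h1).isConnected.isPreconnected

/-- Used to fix integration constants: 0 lies on the boundary of the slit disc, so they are read off
as limits along the positive axis. -/
theorem eqOn_slitBall_of_hasDerivAt_zero {ρ : ℝ} (hρ : 0 < ρ) {f : ℂ → ℂ} {c : ℂ}
    (hf : ∀ z ∈ slitBall ρ, HasDerivAt f 0 z)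
    (hlim : Tendsto (fun s : ℝ => f s) (𝓝[>] 0) (𝓝 c)) {z : ℂ} (hz : z ∈ slitBall ρ) : f z = c := by
  refine tendsto_nhds_unique (tendsto_const_nhds.congr' ?_) hlim
  have h1 : ∀ᶠ s : ℝ in 𝓝[>] 0, s < ρ := nhdsWithin_le_nhds (Iio_mem_nhds hρ)
  filter_upwards [h1, self_mem_nhdsWithin] with s hs hs0
  exact (isOpen_slitBall ρ).is_const_of_deriv_eq_zero (isPreconnected_slitBall hρ)
    (fun w hw => (hf w hw).differentiableAt.differentiableWithinAt) (fun w hw => (hf w hw).deriv)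
    hz (ofReal_mem_slitBall hs0 hs)

/-- If z + t = ū·2πin, then Im z = 2πn Re u. For n ≠ 0 this exceeds |z| in absolute value, and for n
= 0 it puts z on the slit. -/
theorem mul_mem_slitDomain {u : ℂ} (hu : 0 < u.re) (hu1 : ‖u‖ = 1) {z : ℂ}
    (hz : z ∈ slitBall u.re) : u * z ∈ slitDomain u := by
  intro n t ht he
  have hu0 : u ≠ 0 := by rintro rfl; simp at hu
  have hzn : ‖z‖ < u.re := by simpa using hz.2
  have hinv : z + t = (starRingEnd ℂ) u * (2 * Real.pi * Complex.I * n) := by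
    have h1 : u * (z + t) = 2 * Real.pi * Complex.I * n := by linear_combination he
    have h2 : (starRingEnd ℂ) u * u = 1 := by
      rw [mul_comm, Complex.mul_conj, Complex.normSq_eq_norm_sq, hu1]; simp
    rw [← h1, ← mul_assoc, h2, one_mul]
  have him : z.im = 2 * Real.pi * n * u.re := by
    have := congrArg Complex.im hinv
    simp at this
    rw [this]
    ring
  by_cases hn : n = 0
  · subst hn
    have h3 : z = ((-t : ℝ) : ℂ) := by
      simp at hinv
      push_cast
      linear_combination hinv
    have := hz.1
    rw [h3, Complex.ofReal_mem_slitPlane] at this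
    linarith
  · have h4 : (1 : ℝ) ≤ |(n : ℝ)| := by exact_mod_cast Int.one_le_abs hn
    have h5 := Complex.abs_im_le_norm z
    rw [him, abs_mul, abs_mul, abs_of_pos hu, abs_of_pos (by positivity : 0 < 2 * Real.pi)] at h5
    have h6 : u.re ≤ 2 * Real.pi * |(n : ℝ)| * u.re := by
      refine le_mul_of_one_le_left hu.le ?_
      nlinarith [Real.pi_gt_three]
    linarith

/-- The difference between `u^{k-1} Li_2^{(k)}(e^{-uz})` and the derivatives of `z log z - z`, up to
a regular function vanishing at the origin. -/
noncomputable def dilogCorrection (θ : ℝ) : ℕ → ℂ → ℂ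
  | 0, z => (Real.pi : ℂ) ^ 2 / 6 * (Complex.exp (θ * Complex.I))⁻¹ + θ * Complex.I * z
  | 1, _ => θ * Complex.I
  | _ + 2, _ => 0

theorem hasDerivAt_dilogCorrection (θ : ℝ) (k : ℕ) (z : ℂ) :
    HasDerivAt (dilogCorrection θ k) (dilogCorrection θ (k + 1) z) z := by
  match k with
  | 0 =>
    have := ((hasDerivAt_id z).const_mul (θ * Complex.I)).const_add
      ((Real.pi : ℂ) ^ 2 / 6 * (Complex.exp (θ * Complex.I))⁻¹)
    exact this.congr_deriv (by simp [dilogCorrection])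
  | 1 => exact hasDerivAt_const z _
  | k + 2 => exact hasDerivAt_const z _

/-- The source of the leading term: Li_2(1) = ζ(2), by dominated convergence in the series. -/
theorem tendsto_dilog_zero {u : ℂ} (hu : 0 < u.re) :
    Tendsto (fun s : ℝ => dilogDeriv u 0 (u * s)) (𝓝[>] 0) (𝓝 ((Real.pi : ℂ) ^ 2 / 6)) := by
  have hsum : Summable fun m : ℕ => 1 / ((m : ℝ) + 1) ^ 2 := summable_logGamma_bound 1
  have hval : ∑' m : ℕ, (1 : ℂ) / ((m : ℂ) + 1) ^ 2 = (Real.pi : ℂ) ^ 2 / 6 := by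
    have h1 := (hasSum_nat_add_iff' 1).2 hasSum_zeta_two
    have h2 := Complex.hasSum_ofReal.2 h1
    simp at h2
    simpa using h2.tsum_eq
  have h := tendsto_tsum_of_dominated_convergence (𝓕 := 𝓝[>] (0 : ℝ))
    (f := fun (s : ℝ) (m : ℕ) => Complex.exp (-((m : ℂ) + 1) * (u * s)) / ((m : ℂ) + 1) ^ 2)
    (g := fun m : ℕ => (1 : ℂ) / ((m : ℂ) + 1) ^ 2) hsum (fun m => ?_) ?_
  · rw [hval] at h
    refine h.congr' ?_
    filter_upwards [self_mem_nhdsWithin] with s hs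
    have hre : 0 < (u * s).re := by
      have h0 : (u * s).re = u.re * s := by simp
      rw [h0]; exact mul_pos hu hs
    rw [dilogDeriv, pow_zero, one_mul]
    exact_mod_cast (hasSum_polylogExp hu 2 hre).tsum_eq
  · have : Continuous fun s : ℝ => Complex.exp (-((m : ℂ) + 1) * (u * s)) / ((m : ℂ) + 1) ^ 2 := by
      fun_prop
    have h1 := (this.tendsto 0).mono_left (nhdsWithin_le_nhds (s := Set.Ioi 0))
    simpa using h1
  · filter_upwards [self_mem_nhdsWithin] with s hs m
    have hs0 : (0 : ℝ) < s := hs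
    have hn : ‖(m : ℂ) + 1‖ = (m : ℝ) + 1 := by
      rw [← Nat.cast_succ, Complex.norm_natCast]; simp
    rw [norm_div, norm_pow, hn, Complex.norm_exp]
    gcongr
    rw [Real.exp_le_one_iff]
    have h0 : (-((m : ℂ) + 1) * (u * s)).re = -(((m : ℝ) + 1) * (u.re * s)) := by
      simp
      ring
    rw [h0, neg_nonpos]
    positivity

/-- Here (1 - e^{-us})/s → u, and the principal logarithm of u is iθ. -/
theorem tendsto_dilogDeriv_one_sub_log {θ : ℝ} (hθ : |θ| < Real.pi / 2) :
    Tendsto (fun s : ℝ => dilogDeriv (Complex.exp (θ * Complex.I)) 1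
      (Complex.exp (θ * Complex.I) * s) - Complex.log s) (𝓝[>] 0) (𝓝 (θ * Complex.I)) := by
  set u := Complex.exp (θ * Complex.I) with hu
  have hre := re_exp_mul_I_pos hθ
  rw [← hu] at hre
  have hlogu : Complex.log u = θ * Complex.I := by
    have := abs_lt.1 hθ
    rw [hu, Complex.log_exp] <;> simp <;> linarith [Real.pi_pos]
  have hd : HasDerivAt (fun s : ℝ => 1 - Complex.exp (-(u * s))) u 0 := by
    have h1 : HasDerivAt (fun s : ℂ => 1 - Complex.exp (-(u * s))) u ((0 : ℝ) : ℂ) := by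
      have h2 := ((((hasDerivAt_id ((0 : ℝ) : ℂ)).const_mul u).neg).cexp).const_sub 1
      refine h2.congr_deriv ?_
      simp
    exact h1.comp_ofReal
  have h2 := (hasDerivAt_iff_tendsto_slope.1 hd).mono_left
    (nhdsWithin_mono 0 (show Set.Ioi (0 : ℝ) ⊆ {0}ᶜ from fun s hs => ne_of_gt hs))
  have h3 := h2.clog (Complex.mem_slitPlane_iff.2 (Or.inl hre))
  rw [hlogu] at h3
  refine h3.congr' ?_
  filter_upwards [self_mem_nhdsWithin] with s hs
  have hs0 : (0 : ℝ) < s := hs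
  have hsre : 0 < (u * s).re := by
    have h0 : (u * s).re = u.re * s := by simp
    rw [h0]; positivity
  have hne : 1 - Complex.exp (-(u * s)) ≠ 0 :=
    sub_ne_zero.2 (exp_neg_ne_one (slitDomain_of_re_pos hre hsre)).symm
  rw [dilogDeriv, show (2 : ℤ) - ((1 : ℕ) : ℤ) = 1 by norm_num, polylogExp_one_of_re_pos hre hsre]
  have e : slope (fun s : ℝ => 1 - Complex.exp (-(u * s))) 0 s =
      ((s⁻¹ : ℝ) : ℂ) * (1 - Complex.exp (-(u * s))) := by
    rw [slope]; simp
  rw [e, Complex.log_ofReal_mul (by positivity) hne, Real.log_inv, Complex.ofReal_neg,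
    Complex.ofReal_log hs0.le]
  ring

theorem dilogDeriv_two (u w : ℂ) (hw : Complex.exp w ≠ 1) :
    dilogDeriv u 2 w = 1 / (Complex.exp w - 1) := by
  have h := polylogExp_neg_natCast u 0
  simp only [Nat.cast_zero, neg_zero] at h
  rw [dilogDeriv, show (2 : ℤ) - ((2 : ℕ) : ℤ) = 0 by norm_num, h]
  simp only [polylogNonpos, Function.iterate_zero, id]
  have h1 : Complex.exp w - 1 ≠ 0 := sub_ne_zero.2 hw
  have h2 := Complex.exp_ne_zero w
  rw [Complex.exp_neg]
  have h3 : 1 - (Complex.exp w)⁻¹ ≠ 0 := by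
    intro h
    apply hw
    field_simp at h
    linear_combination h
  field_simp

/-- For k = 2 both sides equal u/(e^{uz} - 1). Two integrations over the slit disc, with constants
from the limits at 0+, give k = 1 and k = 0; differentiating the identity on an open set gives all
larger k. -/
theorem dilogDeriv_expansion {θ : ℝ} (hθ : |θ| < Real.pi / 2) {φ : ℕ → ℂ → ℂ}
    (hd : ∀ k, ∀ w ∈ Metric.ball (0 : ℂ) 1, HasDerivAt (φ k) (φ (k + 1) w) w)
    (h0 : φ 0 0 = 0) (h1 : φ 1 0 = 0)
    (h2 : ∀ w ∈ Metric.ball (0 : ℂ) 1, w ≠ 0 → φ 2 w = 1 / (Complex.exp w - 1) - 1 / w) (k : ℕ) :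
    ∀ z ∈ slitBall (Complex.exp (θ * Complex.I)).re,
      Complex.exp (θ * Complex.I) ^ ((k : ℤ) - 1) *
        dilogDeriv (Complex.exp (θ * Complex.I)) k (Complex.exp (θ * Complex.I) * z) =
      mulLogDeriv k z + dilogCorrection θ k z + Complex.exp (θ * Complex.I) ^ ((k : ℤ) - 1) *
        φ k (Complex.exp (θ * Complex.I) * z) := by
  set u := Complex.exp (θ * Complex.I) with hu
  have hu0 : u ≠ 0 := Complex.exp_ne_zero _
  have hu1 : ‖u‖ = 1 := Complex.norm_exp_ofReal_mul_I θ
  have hre := re_exp_mul_I_pos hθ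
  rw [← hu] at hre
  have hre1 : u.re ≤ 1 := hu1 ▸ Complex.re_le_norm u
  have hball : ∀ z ∈ slitBall u.re, u * z ∈ Metric.ball (0 : ℂ) 1 := by
    intro z hz
    have : ‖z‖ < u.re := by simpa using hz.2
    rw [Metric.mem_ball, dist_zero_right, norm_mul, hu1, one_mul]
    linarith
  have hlin : ∀ z : ℂ, HasDerivAt (fun z => u * z) u z := fun z => by
    simpa using (hasDerivAt_id z).const_mul u
  set R : ℕ → ℂ → ℂ := fun k z => u ^ ((k : ℤ) - 1) * dilogDeriv u k (u * z) -
    (mulLogDeriv k z + dilogCorrection θ k z + u ^ ((k : ℤ) - 1) * φ k (u * z)) with hR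
  have hRd : ∀ k, ∀ z ∈ slitBall u.re, HasDerivAt (R k) (R (k + 1) z) z := by
    intro k z hz
    have e1 := ((hasDerivAt_dilogDeriv hre k (mul_mem_slitDomain hre hu1 hz)).comp z
      (hlin z)).const_mul (u ^ ((k : ℤ) - 1))
    have e2 := ((hd k _ (hball z hz)).comp z (hlin z)).const_mul (u ^ ((k : ℤ) - 1))
    have e3 := e1.sub (((hasDerivAt_mulLogDeriv k hz.1).add
      (hasDerivAt_dilogCorrection θ k z)).add e2)
    refine e3.congr_deriv ?_
    simp only [hR]
    rw [show ((k + 1 : ℕ) : ℤ) - 1 = ((k : ℤ) - 1) + 1 by push_cast; ring, zpow_add_one₀ hu0]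
    ring
  have hR2 : ∀ z ∈ slitBall u.re, R 2 z = 0 := by
    intro z hz
    have hz0 : z ≠ 0 := Complex.slitPlane_ne_zero hz.1
    have hne : Complex.exp (u * z) ≠ 1 := by
      have := mem_slitDomain_iff.1 (mul_mem_slitDomain hre hu1 hz) 0 le_rfl
      simpa using this
    have hne' : Complex.exp (u * z) - 1 ≠ 0 := sub_ne_zero.2 hne
    simp only [hR]
    rw [dilogDeriv_two u _ hne, h2 _ (hball z hz) (mul_ne_zero hu0 hz0),
      show ((2 : ℕ) : ℤ) - 1 = 1 by norm_num, zpow_one]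
    simp [mulLogDeriv, dilogCorrection]
    field_simp
    ring
  have hφlim : ∀ k, φ k 0 = 0 → Tendsto (fun s : ℝ => φ k (u * s)) (𝓝[>] 0) (𝓝 0) := by
    intro k hk
    have e1 : ContinuousAt (φ k) (u * ((0 : ℝ) : ℂ)) :=
      (hd k _ (by simp)).continuousAt
    have e2 : ContinuousAt (fun s : ℝ => φ k (u * s)) 0 :=
      ContinuousAt.comp (f := fun s : ℝ => u * (s : ℂ)) e1 (by fun_prop)
    have e3 := e2.tendsto.mono_left (nhdsWithin_le_nhds (s := Set.Ioi 0))
    simpa [hk] using e3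
  have hR1 : ∀ z ∈ slitBall u.re, R 1 z = 0 := by
    intro z hz
    refine eqOn_slitBall_of_hasDerivAt_zero hre (fun w hw => ?_) ?_ hz
    · have := hRd 1 w hw
      rwa [hR2 w hw] at this
    · have e1 := ((tendsto_dilogDeriv_one_sub_log hθ).sub_const (θ * Complex.I)).sub (hφlim 1 h1)
      rw [sub_self, sub_zero] at e1
      refine e1.congr fun s => ?_
      simp [hR, mulLogDeriv, dilogCorrection]
      ring
  have hR0 : ∀ z ∈ slitBall u.re, R 0 z = 0 := by
    intro z hz
    refine eqOn_slitBall_of_hasDerivAt_zero hre (fun w hw => ?_) ?_ hz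
    · have := hRd 0 w hw
      rwa [hR1 w hw] at this
    · have e1 := ((tendsto_dilog_zero hre).sub (hφlim 0 h0)).const_mul u⁻¹
      have e2 : Tendsto (fun s : ℝ => ((s * Real.log s : ℝ) : ℂ)) (𝓝[>] 0) (𝓝 0) := by
        have e4 := Real.continuous_mul_log.tendsto 0
        rw [zero_mul] at e4
        have e3 := (Complex.continuous_ofReal.tendsto 0).comp
          (e4.mono_left (nhdsWithin_le_nhds (s := Set.Ioi 0)))
        simpa [Function.comp_def] using e3
      have e5 : Tendsto (fun s : ℝ => (s : ℂ) * (θ * Complex.I - 1) +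
          (Real.pi : ℂ) ^ 2 / 6 * u⁻¹) (𝓝[>] 0) (𝓝 ((Real.pi : ℂ) ^ 2 / 6 * u⁻¹)) := by
        have : Continuous fun s : ℝ => (s : ℂ) * (θ * Complex.I - 1) +
          (Real.pi : ℂ) ^ 2 / 6 * u⁻¹ := by fun_prop
        simpa using (this.tendsto 0).mono_left (nhdsWithin_le_nhds (s := Set.Ioi 0))
      have e6 := (e1.sub e2).sub e5
      have e7 : u⁻¹ * ((Real.pi : ℂ) ^ 2 / 6 - 0) - 0 - (Real.pi : ℂ) ^ 2 / 6 * u⁻¹ = 0 := by ring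
      rw [e7] at e6
      refine e6.congr' ?_
      filter_upwards [self_mem_nhdsWithin] with s hs
      have hs0 : (0 : ℝ) < s := hs
      simp [hR, mulLogDeriv, dilogCorrection, Complex.ofReal_log hs0.le, ← hu]
      ring
  have hall : ∀ k, ∀ z ∈ slitBall u.re, R k z = 0 := by
    intro k
    induction k with
    | zero => exact hR0
    | succ k ih =>
      intro z hz
      have e1 : R k =ᶠ[𝓝 z] fun _ => 0 := by
        filter_upwards [(isOpen_slitBall u.re).mem_nhds hz] with w hw using ih w hw
      exact (hRd k z hz).unique ((hasDerivAt_const z 0).congr_of_eventuallyEq e1)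
  intro z hz
  exact sub_eq_zero.1 (hall k z hz)

/-! ### Rescaling by β and the Bernoulli polynomials. -/

theorem log_real_mul_exp {θ : ℝ} (hθ : |θ| < Real.pi / 2) {r : ℝ} (hr : 0 < r) :
    Complex.log (r * Complex.exp (θ * Complex.I)) = Real.log r + θ * Complex.I := by
  have := abs_lt.1 hθ
  rw [Complex.log_ofReal_mul hr (Complex.exp_ne_zero _), Complex.log_exp] <;> simp <;>
    linarith [Real.pi_pos]

theorem eulerMaclaurinSum_add (m : ℕ) (f g : ℕ → ℂ) :
    eulerMaclaurinSum m (fun k => f k + g k) = eulerMaclaurinSum m f + eulerMaclaurinSum m g := by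
  simp only [eulerMaclaurinSum, mul_add, Finset.sum_add_distrib]

theorem eulerMaclaurinSum_sub (m : ℕ) (f g : ℕ → ℂ) :
    eulerMaclaurinSum m (fun k => f k - g k) = eulerMaclaurinSum m f - eulerMaclaurinSum m g := by
  simp only [eulerMaclaurinSum, mul_sub, Finset.sum_sub_distrib]

/-- The family `φ_k` consists of the successive derivatives of a second primitive of the regular
part of `1 / (e^w - 1)`. -/
structure IsRegularPart (φ : ℕ → ℂ → ℂ) : Prop where
  hasDerivAt : ∀ k, ∀ w ∈ Metric.ball (0 : ℂ) 1, HasDerivAt (φ k) (φ (k + 1) w) w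
  zero : φ 0 0 = 0
  one : φ 1 0 = 0
  two : ∀ w ∈ Metric.ball (0 : ℂ) 1, w ≠ 0 → φ 2 w = 1 / (Complex.exp w - 1) - 1 / w

/-- The difference between `β^{k-1} Li_2^{(k)}(e^{-βX})` and the derivatives of `X log X - X`. -/
noncomputable def scaledCorrection (β X : ℂ) : ℕ → ℂ
  | 0 => (Real.pi : ℂ) ^ 2 / 6 * β⁻¹ + X * Complex.log β
  | 1 => Complex.log β
  | _ + 2 => 0

theorem ofReal_mul_mem_slitBall {ρ r : ℝ} (hr : 0 < r) {X : ℂ} (hX : X ∈ Complex.slitPlane)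
    (hrX : r * ‖X‖ < ρ) : (r : ℂ) * X ∈ slitBall ρ :=
  ⟨ofReal_mul_mem_slitPlane hX hr, by
    rwa [Metric.mem_ball, dist_zero_right, norm_mul, Complex.norm_real,
      Real.norm_of_nonneg hr.le]⟩

/-- The local expansion at z = rX. The derivatives of z log z - z are homogeneous up to log r, which
joins the correction iθ to form log β. -/
theorem zpow_mul_dilogDeriv {θ : ℝ} (hθ : |θ| < Real.pi / 2) {φ : ℕ → ℂ → ℂ}
    (hφ : IsRegularPart φ) {r : ℝ} (hr : 0 < r) {X : ℂ} (hX : X ∈ Complex.slitPlane)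
    (hrX : r * ‖X‖ < (Complex.exp (θ * Complex.I)).re) (k : ℕ) :
    (r * Complex.exp (θ * Complex.I)) ^ ((k : ℤ) - 1) *
        dilogDeriv (Complex.exp (θ * Complex.I)) k (X * (r * Complex.exp (θ * Complex.I))) =
      mulLogDeriv k X + scaledCorrection (r * Complex.exp (θ * Complex.I)) X k +
        (r * Complex.exp (θ * Complex.I)) ^ ((k : ℤ) - 1) *
          φ k (X * (r * Complex.exp (θ * Complex.I))) := by
  have h := dilogDeriv_expansion hθ hφ.hasDerivAt hφ.zero hφ.one hφ.two k _
    (ofReal_mul_mem_slitBall hr hX hrX)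
  have hlogβ := log_real_mul_exp hθ hr
  set u := Complex.exp (θ * Complex.I) with hu
  have hu0 : u ≠ 0 := Complex.exp_ne_zero _
  have hr0 : (r : ℂ) ≠ 0 := by exact_mod_cast hr.ne'
  have hX0 : X ≠ 0 := Complex.slitPlane_ne_zero hX
  have hlog : Complex.log (r * X) = Real.log r + Complex.log X := Complex.log_ofReal_mul hr hX0
  rw [show u * (r * X) = X * (r * u) by ring] at h
  rw [mul_zpow, mul_assoc, h, mul_add, ← mul_assoc]
  congr 1
  match k with
  | 0 =>
    simp only [mulLogDeriv, dilogCorrection, scaledCorrection, hlog, hlogβ, ← hu]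
    norm_num
    field_simp
    ring
  | 1 =>
    simp only [mulLogDeriv, dilogCorrection, scaledCorrection, hlog, hlogβ]
    norm_num
    ring
  | k + 2 =>
    rw [mulLogDeriv, mulLogDeriv, dilogCorrection, scaledCorrection,
      show ((k + 2 : ℕ) : ℤ) - 1 = ((k + 1 : ℕ) : ℤ) by push_cast; ring, zpow_natCast, mul_pow]
    field_simp
    ring

/-- The correction lives in k = 0, 1 only, where B_0 = 1 and B_1 = -1/2 turn it into π²/(6β) + (X -
1/2) log β. -/
theorem eulerMaclaurinSum_zpow_mul_dilogDeriv {θ : ℝ} (hθ : |θ| < Real.pi / 2) {φ : ℕ → ℂ → ℂ}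
    (hφ : IsRegularPart φ) {r : ℝ} (hr : 0 < r) {X : ℂ} (hX : X ∈ Complex.slitPlane)
    (hrX : r * ‖X‖ < (Complex.exp (θ * Complex.I)).re) (m : ℕ) {β : ℂ}
    (hβ : β = r * Complex.exp (θ * Complex.I)) :
    eulerMaclaurinSum (m + 1) (fun k => β ^ ((k : ℤ) - 1) *
        dilogDeriv (Complex.exp (θ * Complex.I)) k (X * β)) =
      eulerMaclaurinSum (m + 1) (fun k => mulLogDeriv k X) + (Real.pi : ℂ) ^ 2 / 6 * β⁻¹ +
        (X - 1 / 2) * Complex.log β +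
        eulerMaclaurinSum (m + 1) (fun k => β ^ ((k : ℤ) - 1) * φ k (X * β)) := by
  subst hβ
  simp only [zpow_mul_dilogDeriv hθ hφ hr hX hrX]
  rw [eulerMaclaurinSum_add, eulerMaclaurinSum_add]
  congr 1
  rw [add_assoc]
  congr 1
  rw [eulerMaclaurinSum_add_two]
  simp [scaledCorrection]
  ring

theorem aeval_bernoulli (m : ℕ) (X : ℂ) :
    Polynomial.aeval X (Polynomial.bernoulli m) =
      ∑ k ∈ Finset.range (m + 1), (bernoulli k : ℂ) * (m.choose k : ℂ) * X ^ (m - k) := by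
  rw [Polynomial.bernoulli, map_sum]
  refine Finset.sum_congr rfl fun k _ => ?_
  rw [Polynomial.aeval_monomial]
  simp

/-- The partial sums of `∑_n B_n B_{n+1}(X) β^n / (n (n+1)!)`. -/
noncomputable def bernoulliPartialSum (N : ℕ) (β X : ℂ) : ℂ :=
  ∑ n ∈ Finset.Icc 1 N, (bernoulli n : ℂ) * Polynomial.aeval X (Polynomial.bernoulli (n + 1)) /
    ((n : ℂ) * ((n + 1).factorial : ℂ)) * β ^ n

/-- On the monomial w^{n+1} at w = Xβ, the Euler–Maclaurin sum is ∑_k binom(n+1,k) B_k X^{n+1-k} β^n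
= B_{n+1}(X) β^n. The order m must reach the degree N + 1 for every Bernoulli polynomial to be
complete. -/
theorem eulerMaclaurinSum_bernoulliTaylor {β : ℂ} (hβ : β ≠ 0) (X : ℂ) {N m : ℕ} (hm : N + 1 ≤ m) :
    eulerMaclaurinSum m (fun k => β ^ ((k : ℤ) - 1) *
      (Polynomial.derivative^[k] (bernoulliTaylor N)).eval (X * β)) =
    bernoulliPartialSum N β X := by
  simp only [eulerMaclaurinSum, eval_iterate_derivative_bernoulliTaylor, Finset.mul_sum]
  rw [Finset.sum_comm, bernoulliPartialSum]
  refine Finset.sum_congr rfl fun n hn => ?_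
  have hnN := (Finset.mem_Icc.1 hn).2
  have hsub : Finset.range (n + 1 + 1) ⊆ Finset.range (m + 1) :=
    Finset.range_subset_range.2 (by omega)
  rw [aeval_bernoulli, Finset.mul_sum, Finset.sum_div, Finset.sum_mul,
    ← Finset.sum_subset hsub]
  · refine Finset.sum_congr rfl fun k hk => ?_
    have hk' : k ≤ n + 1 := by have := Finset.mem_range.1 hk; omega
    have h1 : ((n + 1).descFactorial k : ℂ) = (k.factorial : ℂ) * ((n + 1).choose k : ℂ) := by
      exact_mod_cast Nat.descFactorial_eq_factorial_mul_choose (n + 1) k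
    have h2 : (k.factorial : ℂ) ≠ 0 := by exact_mod_cast k.factorial_ne_zero
    have h3 : β ^ ((k : ℤ) - 1) * β ^ (n + 1 - k) = β ^ n := by
      rw [← zpow_natCast, ← zpow_add₀ hβ, ← zpow_natCast]
      congr 1
      omega
    rw [h1, mul_pow, ← h3]
    field_simp
  · intro k _ hk
    have : n + 1 < k := by simpa using hk
    rw [Nat.descFactorial_of_lt this]
    simp

/-- From B_{n+1}(X+1) - B_{n+1}(X) = (n+1)X^n; this makes the recursion in X for the remainder
exact. -/
theorem bernoulliPartialSum_add_one (N : ℕ) (β X : ℂ) :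
    bernoulliPartialSum N β (X + 1) - bernoulliPartialSum N β X =
      (Polynomial.derivative^[1] (bernoulliTaylor N)).eval (X * β) := by
  rw [bernoulliPartialSum, bernoulliPartialSum, ← Finset.sum_sub_distrib,
    eval_iterate_derivative_bernoulliTaylor]
  refine Finset.sum_congr rfl fun n _ => ?_
  have h1 := congrArg (Polynomial.aeval X) (Polynomial.bernoulli_comp_one_add_X (n + 1))
  rw [Polynomial.aeval_comp] at h1
  simp at h1
  rw [add_comm X 1, h1, Nat.descFactorial_one, mul_pow, Nat.add_sub_cancel]
  push_cast
  ring

/-- The n-th term is O(|β|^n (1+|X|)^{n+1}), and |β|(1+|X|) ≤ 1 reduces every n > N to n = N + 1. -/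
theorem exists_norm_bernoulliPartialSum_sub_le (N j : ℕ) : ∃ C : ℝ, 0 ≤ C ∧ ∀ β X : ℂ,
    ‖β‖ * (1 + ‖X‖) ≤ 1 →
    ‖bernoulliPartialSum (N + j) β X - bernoulliPartialSum N β X‖ ≤
      C * (‖β‖ ^ (N + 1) * (1 + ‖X‖) ^ (N + 2)) := by
  induction j with
  | zero => exact ⟨0, le_rfl, fun β X _ => by simp⟩
  | succ j ih =>
    obtain ⟨C, hC0, hC⟩ := ih
    set n := N + j + 1 with hn
    set A : ℝ := ‖(bernoulli n : ℂ) / ((n : ℂ) * ((n + 1).factorial : ℂ))‖ *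
      ∑ k ∈ Finset.range (n + 1 + 1), ‖(bernoulli k : ℂ) * ((n + 1).choose k : ℂ)‖ with hA
    have hA0 : 0 ≤ A := mul_nonneg (norm_nonneg _) (Finset.sum_nonneg fun _ _ => norm_nonneg _)
    refine ⟨C + A, by positivity, fun β X hX => ?_⟩
    have h1 : bernoulliPartialSum (N + (j + 1)) β X = bernoulliPartialSum (N + j) β X +
        (bernoulli n : ℂ) / ((n : ℂ) * ((n + 1).factorial : ℂ)) *
          Polynomial.aeval X (Polynomial.bernoulli (n + 1)) * β ^ n := by
      rw [bernoulliPartialSum, show N + (j + 1) = N + j + 1 by ring,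
        Finset.sum_Icc_succ_top (by omega), bernoulliPartialSum]
      congr 1
      ring
    have hX1 : 1 ≤ 1 + ‖X‖ := by linarith [norm_nonneg X]
    have h2 : ‖Polynomial.aeval X (Polynomial.bernoulli (n + 1))‖ ≤
        (∑ k ∈ Finset.range (n + 1 + 1), ‖(bernoulli k : ℂ) * ((n + 1).choose k : ℂ)‖) *
          (1 + ‖X‖) ^ (n + 1) := by
      rw [aeval_bernoulli, Finset.sum_mul]
      refine norm_sum_le_of_le _ fun k _ => ?_
      rw [norm_mul, norm_pow]
      gcongr
      calc ‖X‖ ^ (n + 1 - k) ≤ (1 + ‖X‖) ^ (n + 1 - k) := by gcongr; linarith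
        _ ≤ _ := pow_le_pow_right₀ hX1 (by omega)
    have h3 : ‖β‖ ^ n * (1 + ‖X‖) ^ (n + 1) ≤ ‖β‖ ^ (N + 1) * (1 + ‖X‖) ^ (N + 2) := by
      calc ‖β‖ ^ n * (1 + ‖X‖) ^ (n + 1)
          = ‖β‖ ^ (N + 1) * (1 + ‖X‖) ^ (N + 2) * (‖β‖ * (1 + ‖X‖)) ^ j := by
            rw [hn, mul_pow]; ring
        _ ≤ ‖β‖ ^ (N + 1) * (1 + ‖X‖) ^ (N + 2) * 1 := by
            gcongr
            exact pow_le_one₀ (by positivity) hX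
        _ = _ := mul_one _
    rw [h1, add_sub_right_comm, add_mul]
    refine (norm_add_le _ _).trans (add_le_add (hC β X hX) ?_)
    rw [norm_mul, norm_mul, norm_pow]
    calc _ ≤ ‖(bernoulli n : ℂ) / ((n : ℂ) * ((n + 1).factorial : ℂ))‖ *
          ((∑ k ∈ Finset.range (n + 1 + 1), ‖(bernoulli k : ℂ) * ((n + 1).choose k : ℂ)‖) *
          (1 + ‖X‖) ^ (n + 1)) * ‖β‖ ^ n := by gcongr
      _ = A * (‖β‖ ^ n * (1 + ‖X‖) ^ (n + 1)) := by rw [hA]; ring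
      _ ≤ _ := by gcongr

/-! ### The remainder, uniformly in X. -/

/-- Near the origin the singular part of the local expansion dominates; farther out exponential
decay beats any power. The bound is uniform in the starting point z, however close to 0. -/
theorem exists_norm_dilogDeriv_ray_le {θ : ℝ} (hθ : |θ| < Real.pi / 2) {φ : ℕ → ℂ → ℂ}
    (hφ : IsRegularPart φ) (m : ℕ) : ∃ C : ℝ, 0 ≤ C ∧ ∀ z ∈ Complex.slitPlane,
      ‖z‖ ≤ (Complex.exp (θ * Complex.I)).re / 8 → ∀ s : ℝ, 0 ≤ s →
      ‖dilogDeriv (Complex.exp (θ * Complex.I)) (m + 2) (Complex.exp (θ * Complex.I) * (z + s))‖ ≤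
        C / ‖z + s‖ ^ (m + 1) := by
  have hexp := dilogDeriv_expansion hθ hφ.hasDerivAt hφ.zero hφ.one hφ.two (m + 2)
  have hre := re_exp_mul_I_pos hθ
  set u := Complex.exp (θ * Complex.I) with hu
  have hu1 : ‖u‖ = 1 := Complex.norm_exp_ofReal_mul_I θ
  have hre1 : u.re ≤ 1 := hu1 ▸ Complex.re_le_norm u
  set ρ := u.re with hρ
  have hφc : ContinuousOn (φ (m + 2)) (Metric.closedBall 0 (1 / 2)) := fun w hw =>
    (hφ.hasDerivAt (m + 2) w (Metric.closedBall_subset_ball (by norm_num) hw)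
      ).continuousAt.continuousWithinAt
  obtain ⟨B, hB⟩ := (isCompact_closedBall (0 : ℂ) (1 / 2)).exists_bound_of_continuousOn hφc
  have hB0 : 0 ≤ B := (norm_nonneg _).trans (hB 0 (by simp))
  obtain ⟨D, hD⟩ := exists_norm_dilogDeriv_le hre (m + 2)
  -- If |z| ≤ ρ/8 and |z+s| ≥ ρ/2, then s ≥ 3ρ/8, so the ray has already passed through z + 3ρ/8, a
  -- point of this disc. The disc is a compact set away from the cuts, from which decay is uniform.
  set K : Set ℂ := (fun z => u * z) '' Metric.closedBall ((3 * ρ / 8 : ℝ) : ℂ) (ρ / 8) with hK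
  have hKc : IsCompact K := (isCompact_closedBall _ _).image (by fun_prop)
  have hKs : K ⊆ slitDomain u := by
    rintro _ ⟨z, hz, rfl⟩
    rw [Metric.mem_closedBall, dist_eq_norm] at hz
    refine mul_mem_slitDomain hre hu1 ⟨Complex.mem_slitPlane_iff.2 (Or.inl ?_), ?_⟩
    · have := (abs_le.1 ((Complex.abs_re_le_norm _).trans hz)).1
      rw [Complex.sub_re, Complex.ofReal_re] at this
      linarith
    · have h1 := norm_add_le (z - ((3 * ρ / 8 : ℝ) : ℂ)) ((3 * ρ / 8 : ℝ) : ℂ)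
      rw [sub_add_cancel, Complex.norm_real, Real.norm_of_nonneg (by positivity)] at h1
      rw [Metric.mem_ball, dist_zero_right, ← hρ]
      linarith
  obtain ⟨M, hM0, hM⟩ := rayBound hre (continuousOn_dilogDeriv hre (m + 2)) hD hKc hKs
  set C1 : ℝ := m.factorial + B
  set C2 : ℝ := M * (Real.exp ρ * ((m + 1).factorial / ρ ^ (m + 1)))
  refine ⟨C1 + C2, by positivity, fun z hz hz8 s hs => ?_⟩
  have hzs := add_ofReal_mem_slitPlane hz hs
  have hpos : 0 < ‖z + s‖ := norm_pos_iff.2 (Complex.slitPlane_ne_zero hzs)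
  rcases lt_or_ge ‖z + s‖ (ρ / 2) with hlt | hge
  · have h1 := hexp (z + s) ⟨hzs, by rw [Metric.mem_ball, dist_zero_right]; linarith⟩
    have h2 : ‖dilogDeriv u (m + 2) (u * (z + s))‖ ≤ m.factorial / ‖z + s‖ ^ (m + 1) + B := by
      have h3 := congrArg norm h1
      rw [norm_mul, norm_zpow, hu1, one_zpow, one_mul] at h3
      rw [h3, dilogCorrection, add_zero]
      refine (norm_add_le _ _).trans ?_
      rw [norm_mul, norm_zpow, hu1, one_zpow, one_mul, norm_mulLogDeriv]
      gcongr
      refine hB _ ?_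
      rw [Metric.mem_closedBall, dist_zero_right, norm_mul, hu1, one_mul]
      linarith
    refine h2.trans ?_
    have h4 : ‖z + s‖ ^ (m + 1) ≤ 1 := pow_le_one₀ hpos.le (by linarith)
    rw [le_div_iff₀ (by positivity), add_mul, div_mul_cancel₀ _ (by positivity)]
    have h5 : B * ‖z + s‖ ^ (m + 1) ≤ B := mul_le_of_le_one_right hB0 h4
    have : 0 ≤ C2 := by positivity
    linarith
  · have hs2 : 3 * ρ / 8 ≤ s := by
      have h1 := norm_add_le z s
      rw [Complex.norm_real, Real.norm_of_nonneg hs] at h1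
      linarith
    set t := s - 3 * ρ / 8 with ht
    have ht0 : 0 ≤ t := by linarith
    have h1 := hM (u * (z + ((3 * ρ / 8 : ℝ) : ℂ))) ⟨_, by
      rw [Metric.mem_closedBall, dist_eq_norm, add_sub_cancel_right]; exact hz8, rfl⟩ t ht0
    have e : u * (z + ((3 * ρ / 8 : ℝ) : ℂ)) + t * u = u * (z + s) := by
      rw [ht]; push_cast; ring
    rw [e] at h1
    refine h1.trans ?_
    have h2 : ‖z + s‖ ≤ t + 1 := by
      have h1 := norm_add_le z s
      rw [Complex.norm_real, Real.norm_of_nonneg hs] at h1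
      linarith
    -- From y^{m+1}/(m+1)! ≤ e^y with y = ρ(t+1).
    have h3 : Real.exp (-(t * ρ)) * (t + 1) ^ (m + 1) ≤
        Real.exp ρ * ((m + 1).factorial / ρ ^ (m + 1)) := by
      have h4 := Real.pow_div_factorial_le_exp (ρ * (t + 1)) (by positivity) (m + 1)
      rw [mul_pow, div_le_iff₀ (by positivity)] at h4
      have h5 : Real.exp (-(t * ρ)) * Real.exp (ρ * (t + 1)) = Real.exp ρ := by
        rw [← Real.exp_add]; congr 1; ring
      rw [← mul_div_assoc, le_div_iff₀ (by positivity)]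
      calc Real.exp (-(t * ρ)) * (t + 1) ^ (m + 1) * ρ ^ (m + 1)
          = Real.exp (-(t * ρ)) * (ρ ^ (m + 1) * (t + 1) ^ (m + 1)) := by ring
        _ ≤ Real.exp (-(t * ρ)) * (Real.exp (ρ * (t + 1)) * (m + 1).factorial) := by gcongr
        _ = _ := by rw [← mul_assoc, h5]
    rw [le_div_iff₀ (by positivity)]
    calc M * Real.exp (-(t * ρ)) * ‖z + s‖ ^ (m + 1)
        ≤ M * Real.exp (-(t * ρ)) * (t + 1) ^ (m + 1) := by gcongr
      _ = M * (Real.exp (-(t * ρ)) * (t + 1) ^ (m + 1)) := by ring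
      _ ≤ C2 := mul_le_mul_of_nonneg_left h3 hM0
      _ ≤ _ := by
        have : 0 ≤ C1 := by positivity
        linarith

/-- The remainder in the expansion of `log (e^{-βX}; e^{-β})_∞` in terms of `log Γ(X)`. -/
noncomputable def qPochhammerRemainder (N : ℕ) (β X : ℂ) : ℂ :=
  logQPochhammer β (X * β) - (-(Real.pi : ℂ) ^ 2 / 6 * β⁻¹ + (1 / 2 - X) * Complex.log β -
    logGamma X + 1 / 2 * (Real.log (2 * Real.pi) : ℂ) - bernoulliPartialSum N β X)

theorem norm_ofReal_mul_exp {r : ℝ} (hr : 0 < r) (θ : ℝ) :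
    ‖(r * Complex.exp (θ * Complex.I) : ℂ)‖ = r := by
  rw [norm_mul, Complex.norm_exp_ofReal_mul_I, mul_one, Complex.norm_real,
    Real.norm_of_nonneg hr.le]

/-- The factor r^{j+2} of the remainder cancels against the scale of |rX + (n+t)r|^{-(j+2)}. What is
left is the sum in Stirling's remainder, free of β. -/
theorem exists_norm_logQPochhammer_add_le {θ : ℝ} (hθ : |θ| < Real.pi / 2) {φ : ℕ → ℂ → ℂ}
    (hφ : IsRegularPart φ) {κ : ℝ} (hκ : 0 < κ) (j : ℕ) : ∃ C : ℝ, 0 ≤ C ∧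
    ∀ (r : ℝ) (X : ℂ), 0 < r → X ∈ Complex.slitPlane → InSector κ X → 1 ≤ ‖X‖ →
      r * ‖X‖ ≤ (Complex.exp (θ * Complex.I)).re / 8 → ∀ β : ℂ,
      β = r * Complex.exp (θ * Complex.I) →
      ‖logQPochhammer β (X * β) + eulerMaclaurinSum (j + 2) (fun k => β ^ ((k : ℤ) - 1) *
        dilogDeriv (Complex.exp (θ * Complex.I)) k (X * β))‖ ≤ C / ‖X‖ ^ j := by
  obtain ⟨C, hC0, hC⟩ := exists_logQPochhammer_eulerMaclaurin (j + 2) (by omega)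
  obtain ⟨D, hD0, hD⟩ := exists_norm_dilogDeriv_ray_le hθ hφ (j + 1)
  have hre := re_exp_mul_I_pos hθ
  set u := Complex.exp (θ * Complex.I) with hu
  have hu1 : ‖u‖ = 1 := Complex.norm_exp_ofReal_mul_I θ
  refine ⟨C * (D / κ ^ (j + 2) * ∑' n : ℕ, 1 / ((n : ℝ) + 1) ^ 2), ?_, ?_⟩
  · have : 0 ≤ ∑' n : ℕ, 1 / ((n : ℝ) + 1) ^ 2 := tsum_nonneg fun n => by positivity
    positivity
  intro r X hr hX hsec hX1 hrX β hβ
  have hβn : ‖β‖ = r := by rw [hβ]; exact norm_ofReal_mul_exp hr θ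
  have hsum : Summable fun n : ℕ => 1 / ((n : ℝ) + 1) ^ 2 := summable_logGamma_bound 1
  have hmem : u * (r * X) ∈ slitDomain u :=
    mul_mem_slitDomain hre hu1 (ofReal_mul_mem_slitBall hr hX (by linarith))
  have h := hC β (X * β)
    (fun n => D / κ ^ (j + 2) / ‖X‖ ^ j * (1 / ((n : ℝ) + 1) ^ 2)) ?_ ?_ ?_ (hsum.mul_left _)
  · rw [tsum_mul_left] at h
    rw [hβ] at h ⊢
    simp only [dilogDeriv_real_mul hr] at h
    exact h.trans (le_of_eq (by ring))
  · rw [hβ, Complex.re_ofReal_mul]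
    positivity
  · rw [hβ, slitDomain_real_mul hr]
    rwa [show X * (r * u) = u * (r * X) by ring]
  · intro n t ht
    have ht0 : 0 ≤ (n : ℝ) + t := add_nonneg (Nat.cast_nonneg n) ht.1
    have hrz : ‖(r : ℂ) * X‖ = r * ‖X‖ := by
      rw [norm_mul, Complex.norm_real, Real.norm_of_nonneg hr.le]
    have h0 := hD (r * X) (ofReal_mul_mem_slitPlane hX hr) (by rwa [hrz]) ((n + t) * r)
      (by positivity)
    have e1 : X * β + (n + t) * β = u * (r * X + (((n + t) * r : ℝ) : ℂ)) := by
      rw [hβ]; push_cast; ring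
    have e2 : (r : ℂ) * X + (((n + t) * r : ℝ) : ℂ) = r * (X + ((n + t : ℝ) : ℂ)) := by
      push_cast; ring
    have e3 : dilogDeriv β (j + 2 + 1) = dilogDeriv u (j + 1 + 2) := by
      rw [hβ, dilogDeriv_real_mul hr]
    rw [hβn, e1, e3]
    have h1 := hsec (n + t) ht0
    have h2 : κ * (‖X‖ + n) ≤ ‖X + ((n + t : ℝ) : ℂ)‖ := by
      refine le_trans (mul_le_mul_of_nonneg_left ?_ hκ.le) h1
      linarith [ht.1]
    have h3 : κ ^ (j + 2) * (‖X‖ ^ j * ((n : ℝ) + 1) ^ 2) ≤ ‖X + ((n + t : ℝ) : ℂ)‖ ^ (j + 2) := by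
      have hn := Nat.cast_nonneg (α := ℝ) n
      calc κ ^ (j + 2) * (‖X‖ ^ j * ((n : ℝ) + 1) ^ 2)
          ≤ κ ^ (j + 2) * ((‖X‖ + n) ^ j * (‖X‖ + n) ^ 2) := by
            have h4 : ‖X‖ ≤ ‖X‖ + n := by linarith
            have h5 : (n : ℝ) + 1 ≤ ‖X‖ + n := by linarith
            gcongr
        _ = (κ * (‖X‖ + n)) ^ (j + 2) := by rw [mul_pow, ← pow_add]
        _ ≤ _ := by gcongr
    have hXn : 0 < ‖X + ((n + t : ℝ) : ℂ)‖ :=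
      norm_pos_iff.2 (Complex.slitPlane_ne_zero (add_ofReal_mem_slitPlane hX ht0))
    calc r ^ (j + 2) * ‖dilogDeriv u (j + 1 + 2) (u * (r * X + (((n + t) * r : ℝ) : ℂ)))‖
        ≤ r ^ (j + 2) * (D / ‖(r : ℂ) * X + (((n + t) * r : ℝ) : ℂ)‖ ^ (j + 1 + 1)) := by gcongr
      _ = D / ‖X + ((n + t : ℝ) : ℂ)‖ ^ (j + 2) := by
          rw [e2, norm_mul, Complex.norm_real, Real.norm_of_nonneg hr.le, mul_pow]
          field_simp
      _ ≤ D / (κ ^ (j + 2) * (‖X‖ ^ j * ((n : ℝ) + 1) ^ 2)) := by gcongr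
      _ = _ := by field_simp

/-- The Taylor error in the k-th term is |β|^{k-1} |Xβ|^{N+2-k} = |β|^{N+1} |X|^{N+2-k} for k ≤ N +
2; for larger k the factor |β|^{k-1} is enough alone. -/
theorem exists_norm_eulerMaclaurinSum_regular_le {φ : ℕ → ℂ → ℂ} (hφ : IsRegularPart φ)
    {N m : ℕ} (hm : N + 1 ≤ m) : ∃ C : ℝ, 0 ≤ C ∧ ∀ β X : ℂ, β ≠ 0 → X ≠ 0 → ‖β‖ ≤ 1 →
      ‖β‖ * ‖X‖ ≤ 1 / 4 →
      ‖eulerMaclaurinSum m (fun k => β ^ ((k : ℤ) - 1) * φ k (X * β)) -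
        bernoulliPartialSum N β X‖ ≤ C * (‖β‖ ^ (N + 1) * (1 + ‖X‖) ^ (N + 2)) := by
  choose C hC0 hC using
    exists_norm_sub_bernoulliTaylor_le hφ.hasDerivAt hφ.zero hφ.one hφ.two N
  refine ⟨∑ k ∈ Finset.range (m + 1), ‖(bernoulli k : ℂ) / (k.factorial : ℂ)‖ * C k,
    Finset.sum_nonneg fun k _ => mul_nonneg (norm_nonneg _) (hC0 k), fun β X hβ hX hβ1 hβX => ?_⟩
  rw [← eulerMaclaurinSum_bernoulliTaylor hβ X hm, ← eulerMaclaurinSum_sub, eulerMaclaurinSum,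
    Finset.sum_mul]
  refine norm_sum_le_of_le _ fun k _ => ?_
  rw [← mul_sub, norm_mul, norm_mul, norm_zpow, mul_assoc]
  have hβ0 : 0 < ‖β‖ := norm_pos_iff.2 hβ
  have hX1 : 1 ≤ 1 + ‖X‖ := by linarith [norm_nonneg X]
  have h1 := hC k (X * β) (mul_ne_zero hX hβ) (by rwa [norm_mul, mul_comm])
  have h2 : ‖β‖ ^ ((k : ℤ) - 1) * ‖X * β‖ ^ (N + 2 - k) ≤
      ‖β‖ ^ (N + 1) * (1 + ‖X‖) ^ (N + 2) := by
    rcases le_or_gt k (N + 2) with hk | hk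
    · have h3 : ‖β‖ ^ ((k : ℤ) - 1) * ‖β‖ ^ (N + 2 - k) = ‖β‖ ^ (N + 1) := by
        rw [← zpow_natCast, ← zpow_add₀ hβ0.ne', ← zpow_natCast]
        congr 1
        omega
      rw [norm_mul, mul_pow, mul_comm (‖X‖ ^ _), ← mul_assoc, h3]
      gcongr
      calc ‖X‖ ^ (N + 2 - k) ≤ (1 + ‖X‖) ^ (N + 2 - k) := by gcongr; linarith
        _ ≤ _ := pow_le_pow_right₀ hX1 (by omega)
    · rw [show N + 2 - k = 0 by omega, pow_zero, mul_one,
        show (k : ℤ) - 1 = ((k - 1 : ℕ) : ℤ) by omega, zpow_natCast]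
      calc ‖β‖ ^ (k - 1) ≤ ‖β‖ ^ (N + 1) := pow_le_pow_of_le_one hβ0.le hβ1 (by omega)
        _ ≤ _ := le_mul_of_one_le_right (by positivity) (one_le_pow₀ hX1)
  refine mul_le_mul_of_nonneg_left ?_ (norm_nonneg _)
  calc _ ≤ ‖β‖ ^ ((k : ℤ) - 1) * (C k * ‖X * β‖ ^ (N + 2 - k)) := by gcongr
    _ = C k * (‖β‖ ^ ((k : ℤ) - 1) * ‖X * β‖ ^ (N + 2 - k)) := by ring
    _ ≤ _ := mul_le_mul_of_nonneg_left h2 (hC0 k)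

/-- With j = 2(N+1), both Euler–Maclaurin errors are O(|X|^{-2(N+1)}), at most a constant times
r^{N+1} because r|X|² ≥ 1. -/
theorem exists_norm_qPochhammerRemainder_le_of_large {θ : ℝ} (hθ : |θ| < Real.pi / 2)
    {κ : ℝ} (hκ : 0 < κ) (N : ℕ) : ∃ C : ℝ, 0 ≤ C ∧
    ∀ (r : ℝ) (X : ℂ), 0 < r → r ≤ 1 → X ∈ Complex.slitPlane → InSector κ X → 1 ≤ r * ‖X‖ ^ 2 →
      r * ‖X‖ ≤ (Complex.exp (θ * Complex.I)).re / 8 →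
      ‖qPochhammerRemainder N (r * Complex.exp (θ * Complex.I)) X‖ ≤
        C * (r ^ (N + 1) * (1 + ‖X‖) ^ (N + 2)) := by
  obtain ⟨φ, h1, h2, h3, h4⟩ := exists_regular_part
  have hφ : IsRegularPart φ := ⟨h1, h2, h3, h4⟩
  obtain ⟨A, hA0, hA⟩ := exists_norm_logQPochhammer_add_le hθ hφ hκ (2 * (N + 1))
  obtain ⟨B, hB0, hB⟩ := logGamma_stirling hκ (2 * (N + 1))
  obtain ⟨C, hC0, hC⟩ := exists_norm_eulerMaclaurinSum_regular_le hφ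
    (show N + 1 ≤ 2 * (N + 1) + 2 by omega)
  refine ⟨A + B + C, by positivity, fun r X hr hr1 hX hsec hrX2 hrX => ?_⟩
  have hre := re_exp_mul_I_pos hθ
  have hre1 : (Complex.exp (θ * Complex.I)).re ≤ 1 :=
    Complex.norm_exp_ofReal_mul_I θ ▸ Complex.re_le_norm _
  have hEM := eulerMaclaurinSum_zpow_mul_dilogDeriv hθ hφ hr hX (by linarith)
    (2 * (N + 1) + 1) rfl
  have hβn := norm_ofReal_mul_exp hr θ
  set β : ℂ := r * Complex.exp (θ * Complex.I) with hβ
  have hβ0 : β ≠ 0 := by rw [← norm_pos_iff, hβn]; exact hr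
  have hX0 : 0 < ‖X‖ := norm_pos_iff.2 (Complex.slitPlane_ne_zero hX)
  have hX1 : 1 ≤ ‖X‖ := by
    by_contra hlt
    rw [not_le] at hlt
    nlinarith
  have e1 := hA r X hr hX hsec hX1 hrX β hβ
  have e2 := hB X hX hsec hX1
  have e3 := hC β X hβ0 (norm_pos_iff.1 hX0) (by rw [hβn]; exact hr1) (by rw [hβn]; linarith)
  rw [hβn] at e3
  have e4 : 1 / ‖X‖ ^ (2 * (N + 1)) ≤ r ^ (N + 1) * (1 + ‖X‖) ^ (N + 2) := by
    have h5 : 1 / ‖X‖ ^ (2 * (N + 1)) ≤ r ^ (N + 1) := by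
      rw [div_le_iff₀ (by positivity), pow_mul, ← mul_pow]
      exact one_le_pow₀ hrX2
    exact h5.trans (le_mul_of_one_le_right (by positivity) (one_le_pow₀ (by linarith)))
  -- The two Euler–Maclaurin sums share the singular part X log X - X, which cancels; the regular
  -- part is compared with the Bernoulli sum.
  have hdecomp : qPochhammerRemainder N β X =
      (logQPochhammer β (X * β) + eulerMaclaurinSum (2 * (N + 1) + 2) (fun k => β ^ ((k : ℤ) - 1) *
        dilogDeriv (Complex.exp (θ * Complex.I)) k (X * β))) +
      (logGamma X - 1 / 2 * Real.log (2 * Real.pi) -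
        eulerMaclaurinSum (2 * (N + 1) + 2) (fun k => mulLogDeriv k X)) -
      (eulerMaclaurinSum (2 * (N + 1) + 2) (fun k => β ^ ((k : ℤ) - 1) * φ k (X * β)) -
        bernoulliPartialSum N β X) := by
    rw [hEM, qPochhammerRemainder]
    ring
  rw [hdecomp]
  refine (norm_sub_le _ _).trans ?_
  rw [add_mul, add_mul]
  refine add_le_add ((norm_add_le _ _).trans (add_le_add ?_ ?_)) e3
  · refine e1.trans ?_
    rw [div_eq_mul_one_div]
    gcongr
  · refine e2.trans ?_
    rw [div_eq_mul_one_div]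
    gcongr

/-- The elementary terms satisfy the functional equation exactly, so only the Taylor error of φ 1
survives. -/
theorem qPochhammerRemainder_sub {θ : ℝ} (hθ : |θ| < Real.pi / 2) {φ : ℕ → ℂ → ℂ}
    (hφ : IsRegularPart φ) (N : ℕ) {r : ℝ} (hr : 0 < r) {X : ℂ} (hX : X ∈ Complex.slitPlane)
    (hrX : r * ‖X‖ < (Complex.exp (θ * Complex.I)).re) {β : ℂ}
    (hβ : β = r * Complex.exp (θ * Complex.I)) :
    qPochhammerRemainder N β X - qPochhammerRemainder N β (X + 1) =
      φ 1 (X * β) - (Polynomial.derivative^[1] (bernoulliTaylor N)).eval (X * β) := by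
  have hre := re_exp_mul_I_pos hθ
  have hu1 : ‖Complex.exp (θ * Complex.I)‖ = 1 := Complex.norm_exp_ofReal_mul_I θ
  have h1 := zpow_mul_dilogDeriv hθ hφ hr hX hrX 1
  rw [← hβ] at h1
  have hmem := mul_mem_slitDomain hre hu1 (ofReal_mul_mem_slitBall hr hX hrX)
  have h2 : logQPochhammer β (X * β) - logQPochhammer β (X * β + β) =
      dilogDeriv (Complex.exp (θ * Complex.I)) 1 (X * β) := by
    rw [hβ, ← dilogDeriv_real_mul hr]
    refine logQPochhammer_sub ?_ ?_
    · rw [Complex.re_ofReal_mul]; positivity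
    · rw [slitDomain_real_mul hr]
      rwa [show X * (r * Complex.exp (θ * Complex.I)) =
        Complex.exp (θ * Complex.I) * (r * X) by ring]
  have h3 := logGamma_add_one hX
  have h4 := bernoulliPartialSum_add_one N β X
  simp [mulLogDeriv, scaledCorrection] at h1
  rw [qPochhammerRemainder, qPochhammerRemainder, h3, add_mul, one_mul, ← h4]
  linear_combination h2 + h1

theorem qPochhammerRemainder_sub_natCast {θ : ℝ} (hθ : |θ| < Real.pi / 2) {φ : ℕ → ℂ → ℂ}
    (hφ : IsRegularPart φ) (N : ℕ) {r : ℝ} (hr : 0 < r) {X : ℂ} (hX : X ∈ Complex.slitPlane)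
    {β : ℂ} (hβ : β = r * Complex.exp (θ * Complex.I)) (n : ℕ)
    (hrX : r * (‖X‖ + n) < (Complex.exp (θ * Complex.I)).re) :
    qPochhammerRemainder N β X - qPochhammerRemainder N β (X + n) =
      ∑ k ∈ Finset.range n, (φ 1 ((X + k) * β) -
        (Polynomial.derivative^[1] (bernoulliTaylor N)).eval ((X + k) * β)) := by
  induction n with
  | zero => simp
  | succ n ih =>
    push_cast at hrX
    have h1 : r * (‖X‖ + n) < (Complex.exp (θ * Complex.I)).re := by nlinarith
    have h2 : X + n ∈ Complex.slitPlane := by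
      exact_mod_cast add_ofReal_mem_slitPlane hX (Nat.cast_nonneg n)
    have h3 : ‖X + n‖ ≤ ‖X‖ + n := by
      refine (norm_add_le _ _).trans ?_
      rw [Complex.norm_natCast]
    have h4 := qPochhammerRemainder_sub hθ hφ N hr h2
      (lt_of_le_of_lt (mul_le_mul_of_nonneg_left h3 hr.le) h1) hβ
    rw [Finset.sum_range_succ, ← ih h1, ← h4]
    push_cast
    rw [add_assoc]
    ring

/-- Moving X by n ≈ r^{-1/2} unit steps reaches the regime r|X|² ≥ 1. Each step costs
O(r^{1/2})^{2(N+1)+1}, in all O(r^{N+1}), and the bound at the end point is also O(r^{N+1}).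
Truncation at 2(N+1) compensates for arguments as large as r^{-1/2}. -/
theorem exists_norm_qPochhammerRemainder_le_of_small {θ : ℝ} (hθ : |θ| < Real.pi / 2)
    {κ : ℝ} (hκ : 0 < κ) (N : ℕ) : ∃ C ε : ℝ, 0 ≤ C ∧ 0 < ε ∧
    ∀ (r : ℝ) (X : ℂ), 0 < r → r < ε → X ∈ Complex.slitPlane → InSector κ X → r * ‖X‖ ^ 2 < 1 →
      ‖qPochhammerRemainder (2 * (N + 1)) (r * Complex.exp (θ * Complex.I)) X‖ ≤ C * r ^ (N + 1) := by
  obtain ⟨φ, h1, h2, h3, h4⟩ := exists_regular_part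
  have hφ : IsRegularPart φ := ⟨h1, h2, h3, h4⟩
  obtain ⟨B, hB0, hB⟩ := exists_norm_qPochhammerRemainder_le_of_large hθ hκ (2 * (N + 1))
  obtain ⟨D, hD0, hD⟩ := exists_norm_sub_bernoulliTaylor_le h1 h2 h3 h4 (2 * (N + 1)) 1
  have hre := re_exp_mul_I_pos hθ
  have hre1 : (Complex.exp (θ * Complex.I)).re ≤ 1 :=
    Complex.norm_exp_ofReal_mul_I θ ▸ Complex.re_le_norm _
  set δ := (Complex.exp (θ * Complex.I)).re with hδ
  -- Chosen so that |X| + n ≤ A/√r, from |X| ≤ 1/√r and n ≤ (1/κ + 1)/√r. The bound on r then keeps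
  -- r(|X|+n) ≤ A√r within δ/8.
  set A : ℝ := 1 + (1 / κ + 1) with hA
  have hA1 : 1 ≤ A := by rw [hA]; have : 0 < 1 / κ := by positivity
                         linarith
  refine ⟨B * (2 * A) ^ (2 * (N + 1) + 2) + A * (D * A ^ (2 * (N + 1) + 1)), (δ / (8 * A)) ^ 2,
    by positivity, by positivity, fun r X hr hrε hX hsec hrX => ?_⟩
  set ρ := Real.sqrt r with hρ
  have hρ0 : 0 < ρ := Real.sqrt_pos.2 hr
  have hρr : ρ ^ 2 = r := Real.sq_sqrt hr.le
  have hρε : ρ < δ / (8 * A) := by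
    rw [← hρr] at hrε
    exact lt_of_pow_lt_pow_left₀ 2 (by positivity) hrε
  have hAρ : A * ρ ≤ δ / 8 := by
    rw [lt_div_iff₀ (by positivity)] at hρε
    linarith
  have hρ1 : ρ ≤ 1 := by nlinarith
  have hr1 : r ≤ 1 := by rw [← hρr]; exact pow_le_one₀ hρ0.le hρ1
  have hXρ : ‖X‖ ≤ 1 / ρ := by
    rw [le_div_iff₀ hρ0]
    have h5 : (‖X‖ * ρ) ^ 2 < 1 ^ 2 := by rw [mul_pow, hρr, one_pow]; linarith
    exact (lt_of_pow_lt_pow_left₀ 2 zero_le_one h5).le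
  -- The lower bound forces |X+n| ≥ κn ≥ 1/ρ by the sector condition; the upper bound keeps the
  -- whole path near the origin after scaling.
  obtain ⟨n, hn1, hn2⟩ : ∃ n : ℕ, 1 / (κ * ρ) ≤ n ∧ (n : ℝ) ≤ (1 / κ + 1) / ρ := by
    refine ⟨⌈1 / (κ * ρ)⌉₊, Nat.le_ceil _, ?_⟩
    refine (Nat.ceil_lt_add_one (by positivity)).le.trans ?_
    have h5 : 1 ≤ 1 / ρ := by rw [le_div_iff₀ hρ0]; linarith
    have h6 : (1 / κ + 1) / ρ = 1 / (κ * ρ) + 1 / ρ := by field_simp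
    linarith
  have hXn : ‖X‖ + n ≤ A / ρ := by
    have : A / ρ = 1 / ρ + (1 / κ + 1) / ρ := by rw [hA]; ring
    linarith
  have hrXn : r * (‖X‖ + n) ≤ A * ρ := by
    calc r * (‖X‖ + n) ≤ r * (A / ρ) := by gcongr
      _ = A * ρ := by rw [← hρr]; field_simp
  have hk : ∀ k : ℕ, ‖X + k‖ ≤ ‖X‖ + k := fun k => by
    refine (norm_add_le _ _).trans ?_
    rw [Complex.norm_natCast]
  have hX' : X + n ∈ Complex.slitPlane := by
    exact_mod_cast add_ofReal_mem_slitPlane hX (Nat.cast_nonneg n)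
  have hsec' : InSector κ (X + n) := by exact_mod_cast hsec.add hκ.le (Nat.cast_nonneg n)
  have hβn := norm_ofReal_mul_exp hr θ
  have hsub := qPochhammerRemainder_sub_natCast hθ hφ (2 * (N + 1)) hr hX rfl n (by linarith)
  have hrρ : r ^ (N + 1) = ρ ^ (2 * (N + 1)) := by rw [← hρr, ← pow_mul]
  have hfar : ‖qPochhammerRemainder (2 * (N + 1)) (r * Complex.exp (θ * Complex.I)) (X + n)‖ ≤
      B * (2 * A) ^ (2 * (N + 1) + 2) * r ^ (N + 1) := by
    have h5 : 1 ≤ r * ‖X + n‖ ^ 2 := by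
      have h6 := hsec n (Nat.cast_nonneg n)
      rw [Complex.ofReal_natCast] at h6
      have h7 : 1 / ρ ≤ ‖X + n‖ := by
        refine le_trans ?_ h6
        calc 1 / ρ = κ * (1 / (κ * ρ)) := by field_simp
          _ ≤ κ * (‖X‖ + n) := by
            refine mul_le_mul_of_nonneg_left ?_ hκ.le
            linarith [norm_nonneg X]
      calc (1 : ℝ) = r * (1 / ρ) ^ 2 := by rw [← hρr]; field_simp
        _ ≤ _ := by gcongr
    refine (hB r (X + n) hr hr1 hX' hsec' h5 ?_).trans ?_
    · exact (mul_le_mul_of_nonneg_left (hk n) hr.le).trans (hrXn.trans hAρ)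
    · have h6 : 1 + ‖X + n‖ ≤ 2 * A / ρ := by
        have h7 : 1 ≤ A / ρ := by rw [le_div_iff₀ hρ0]; linarith
        have := hk n
        have h8 : 2 * A / ρ = A / ρ + A / ρ := by ring
        linarith
      calc B * (r ^ (2 * (N + 1) + 1) * (1 + ‖X + n‖) ^ (2 * (N + 1) + 2))
          ≤ B * (r ^ (2 * (N + 1) + 1) * (2 * A / ρ) ^ (2 * (N + 1) + 2)) := by gcongr
        _ = _ := by
          have h7 : r ^ (2 * (N + 1) + 1) = ρ ^ (2 * (N + 1) + 2) * r ^ (N + 1) := by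
            rw [hrρ, ← hρr, ← pow_mul, ← pow_add]; congr 1; ring
          rw [h7, div_pow]
          field_simp
  have hsum : ‖∑ k ∈ Finset.range n, (φ 1 ((X + k) * (r * Complex.exp (θ * Complex.I))) -
      (Polynomial.derivative^[1] (bernoulliTaylor (2 * (N + 1)))).eval
        ((X + k) * (r * Complex.exp (θ * Complex.I))))‖ ≤
      A * (D * A ^ (2 * (N + 1) + 1)) * r ^ (N + 1) := by
    have h5 : ∀ k ∈ Finset.range n, ‖φ 1 ((X + k) * (r * Complex.exp (θ * Complex.I))) -
      (Polynomial.derivative^[1] (bernoulliTaylor (2 * (N + 1)))).eval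
        ((X + k) * (r * Complex.exp (θ * Complex.I)))‖ ≤ D * (A * ρ) ^ (2 * (N + 1) + 1) := by
      intro k hkn
      have hkn' : (k : ℝ) ≤ n := by exact_mod_cast (Finset.mem_range.1 hkn).le
      have hX'' : X + k ∈ Complex.slitPlane := by
        exact_mod_cast add_ofReal_mem_slitPlane hX (Nat.cast_nonneg k)
      have h6 : ‖(X + k) * (r * Complex.exp (θ * Complex.I))‖ ≤ A * ρ := by
        rw [norm_mul, hβn, mul_comm]
        refine le_trans (mul_le_mul_of_nonneg_left ?_ hr.le) hrXn
        exact (hk k).trans (by linarith)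
      refine (hD _ ?_ (by linarith)).trans ?_
      · refine mul_ne_zero (Complex.slitPlane_ne_zero hX'') ?_
        rw [← norm_pos_iff, hβn]
        exact hr
      · rw [show 2 * (N + 1) + 2 - 1 = 2 * (N + 1) + 1 by omega]
        gcongr
    refine (norm_sum_le_of_le _ h5).trans ?_
    rw [Finset.sum_const, Finset.card_range, nsmul_eq_mul]
    have h6 : (n : ℝ) ≤ A / ρ := by linarith [norm_nonneg X]
    calc (n : ℝ) * (D * (A * ρ) ^ (2 * (N + 1) + 1))
        ≤ A / ρ * (D * (A * ρ) ^ (2 * (N + 1) + 1)) := by gcongr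
      _ = _ := by
        rw [hrρ, mul_pow, pow_succ ρ]
        field_simp
  rw [eq_add_of_sub_eq hsub, add_mul]
  refine (norm_add_le _ _).trans ?_
  linarith

/-- The two regimes cover all X. For small X the Bernoulli terms from N + 1 to 2(N+1) are discarded,
each within the claimed error. -/
theorem exists_norm_qPochhammerRemainder_le {θ : ℝ} (hθ : |θ| < Real.pi / 2)
    {κ : ℝ} (hκ : 0 < κ) (N : ℕ) : ∃ C ε : ℝ, 0 ≤ C ∧ 0 < ε ∧
    ∀ (r : ℝ) (X : ℂ), 0 < r → r < ε → X ∈ Complex.slitPlane → InSector κ X → r * ‖X‖ < ε →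
      ‖qPochhammerRemainder N (r * Complex.exp (θ * Complex.I)) X‖ ≤
        C * (r ^ (N + 1) * (1 + ‖X‖) ^ (N + 2)) := by
  obtain ⟨A, hA0, hA⟩ := exists_norm_qPochhammerRemainder_le_of_large hθ hκ N
  obtain ⟨B, ε, hB0, hε, hB⟩ := exists_norm_qPochhammerRemainder_le_of_small hθ hκ N
  obtain ⟨D, hD0, hD⟩ := exists_norm_bernoulliPartialSum_sub_le N (N + 2)
  have hre := re_exp_mul_I_pos hθ
  have hre1 : (Complex.exp (θ * Complex.I)).re ≤ 1 :=
    Complex.norm_exp_ofReal_mul_I θ ▸ Complex.re_le_norm _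
  refine ⟨A + (B + D), min ε ((Complex.exp (θ * Complex.I)).re / 8), by positivity,
    lt_min hε (by positivity), fun r X hr hrε hX hsec hrX => ?_⟩
  have h1 := hrε.trans_le (min_le_left _ _)
  have h2 := hrε.trans_le (min_le_right _ _)
  have h3 := hrX.trans_le (min_le_right _ _)
  set E : ℝ := r ^ (N + 1) * (1 + ‖X‖) ^ (N + 2) with hE
  have hE0 : 0 ≤ E := by positivity
  rcases le_or_gt 1 (r * ‖X‖ ^ 2) with hge | hlt
  · refine (hA r X hr (by linarith) hX hsec hge h3.le).trans ?_
    have : 0 ≤ (B + D) * E := by positivity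
    rw [add_mul]
    linarith
  · have h4 := hB r X hr h1 hX hsec hlt
    have hβn := norm_ofReal_mul_exp hr θ
    have h5 := hD (r * Complex.exp (θ * Complex.I)) X (by rw [hβn]; linarith)
    rw [hβn, ← hE, show N + (N + 2) = 2 * (N + 1) by ring] at h5
    have h6 : qPochhammerRemainder N (r * Complex.exp (θ * Complex.I)) X =
        qPochhammerRemainder (2 * (N + 1)) (r * Complex.exp (θ * Complex.I)) X -
        (bernoulliPartialSum (2 * (N + 1)) (r * Complex.exp (θ * Complex.I)) X -
          bernoulliPartialSum N (r * Complex.exp (θ * Complex.I)) X) := by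
      rw [qPochhammerRemainder, qPochhammerRemainder]
      ring
    have h7 : r ^ (N + 1) ≤ E :=
      le_mul_of_one_le_right (by positivity) (one_le_pow₀ (by linarith [norm_nonneg X]))
    rw [h6]
    refine (norm_sub_le _ _).trans ?_
    have h8 : B * r ^ (N + 1) ≤ B * E := by gcongr
    have h9 : 0 ≤ A * E := by positivity
    rw [add_mul, add_mul]
    linarith

/-! ### Expansions of log Γ, and the substitution X = xβ^{c-1}. -/

theorem isBigO_argRay_of_eventually {θ : ℝ} {f : ℂ → ℂ} {g : ℂ → ℝ} {C : ℝ}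
    (h : ∀ᶠ r : ℝ in 𝓝[>] 0,
      ‖f (r * Complex.exp (θ * Complex.I))‖ ≤ C * |g (r * Complex.exp (θ * Complex.I))|) :
    f =O[argRay θ] g := by
  obtain ⟨ε, hε, h⟩ := mem_nhdsGT_iff_exists_Ioo_subset.1 h
  exact isBigO_argRay ⟨C, ε, hε, fun r hr hrε => h ⟨hr, hrε⟩⟩

theorem sum_range_two_mul_of_odd_eq_zero {a : ℕ → ℂ} (ha : ∀ i, a (2 * i + 1) = 0) (m : ℕ) :
    ∑ k ∈ Finset.range (2 * m), a k = ∑ i ∈ Finset.range m, a (2 * i) := by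
  induction m with
  | zero => simp
  | succ m ih =>
    rw [mul_add, mul_one, Finset.sum_range_succ, Finset.sum_range_succ, ih, ha, add_zero,
      Finset.sum_range_succ]

theorem logGamma_stirling_even {κ : ℝ} (hκ : 0 < κ) (M : ℕ) : ∃ C : ℝ, 0 ≤ C ∧
    ∀ x ∈ Complex.slitPlane, InSector κ x → 1 ≤ ‖x‖ →
      ‖logGamma x - (1 / 2 * (Real.log (2 * Real.pi) : ℂ) + (x - 1 / 2) * Complex.log x - x +
        ∑ k ∈ Finset.Icc 1 M, (bernoulli (2 * k) : ℂ) /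
          (2 * (k : ℂ) * (2 * (k : ℂ) - 1) * x ^ (2 * k - 1)))‖ ≤ C / ‖x‖ ^ (2 * M + 1) := by
  -- This order matches the claimed error. It includes one term beyond k = M, namely `a M` /
  -- x^{2M+1}, of the same size as the error; the odd Bernoulli numbers vanish.
  obtain ⟨C, hC0, hC⟩ := logGamma_stirling hκ (2 * M + 1)
  set a : ℕ → ℂ := fun i => (bernoulli (2 * (i + 1)) : ℂ) /
    (2 * ((i + 1 : ℕ) : ℂ) * (2 * ((i + 1 : ℕ) : ℂ) - 1)) with ha
  refine ⟨C + ‖a M‖, by positivity, fun x hx hsec hx1 => ?_⟩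
  have hsum : eulerMaclaurinSum (2 * M + 1 + 2) (fun k => mulLogDeriv k x) =
      x * Complex.log x - x - 1 / 2 * Complex.log x +
        (∑ k ∈ Finset.Icc 1 M, (bernoulli (2 * k) : ℂ) /
          (2 * (k : ℂ) * (2 * (k : ℂ) - 1) * x ^ (2 * k - 1)) + a M / x ^ (2 * M + 1)) := by
    rw [eulerMaclaurinSum_add_two, show 2 * M + 1 + 1 = 2 * (M + 1) by ring,
      sum_range_two_mul_of_odd_eq_zero]
    · have hterm : ∀ i : ℕ, (bernoulli (2 * i + 2) : ℂ) / ((2 * i + 2).factorial : ℂ) *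
          mulLogDeriv (2 * i + 2) x = a i / x ^ (2 * i + 1) := by
        intro i
        have h1 : ((2 * i).factorial : ℂ) ≠ 0 := by exact_mod_cast (2 * i).factorial_ne_zero
        have h2 : (2 * (i : ℂ) + 1) ≠ 0 := by exact_mod_cast Nat.cast_add_one_ne_zero (R := ℂ) (2 * i)
        have h3 : ((i : ℂ) + 1) ≠ 0 := Nat.cast_add_one_ne_zero i
        rw [mulLogDeriv, pow_mul, neg_one_sq, one_pow, one_mul, Nat.factorial_succ,
          Nat.factorial_succ]
        simp only [ha]
        rw [show 2 * (i + 1) = 2 * i + 2 by ring]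
        push_cast
        rw [show (2 : ℂ) * (i + 1) - 1 = 2 * i + 1 by ring,
          show (2 * (i : ℂ) + 1 + 1) = 2 * (i + 1) by ring]
        have hx0 := Complex.slitPlane_ne_zero hx
        field_simp
      simp only [hterm]
      rw [Finset.sum_range_succ]
      congr 2
      rw [← Finset.Ico_add_one_right_eq_Icc, Finset.sum_Ico_eq_sum_range]
      refine Finset.sum_congr (by simp) fun k _ => ?_
      rw [add_comm 1 k, show 2 * (k + 1) - 1 = 2 * k + 1 by omega]
      simp only [ha]
      rw [div_div]
    · intro i
      rw [bernoulli_eq_zero_of_odd ⟨i + 1, by ring⟩ (by omega)]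
      simp
  have h := hC x hx hsec hx1
  rw [hsum] at h
  have hx0 : 0 < ‖x‖ := by linarith
  have e : logGamma x - (1 / 2 * (Real.log (2 * Real.pi) : ℂ) + (x - 1 / 2) * Complex.log x - x +
        ∑ k ∈ Finset.Icc 1 M, (bernoulli (2 * k) : ℂ) /
          (2 * (k : ℂ) * (2 * (k : ℂ) - 1) * x ^ (2 * k - 1))) =
      (logGamma x - 1 / 2 * Real.log (2 * Real.pi) -
        (x * Complex.log x - x - 1 / 2 * Complex.log x +
        (∑ k ∈ Finset.Icc 1 M, (bernoulli (2 * k) : ℂ) /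
          (2 * (k : ℂ) * (2 * (k : ℂ) - 1) * x ^ (2 * k - 1)) + a M / x ^ (2 * M + 1)))) +
      a M / x ^ (2 * M + 1) := by ring
  rw [e, add_div]
  refine (norm_add_le _ _).trans (add_le_add h ?_)
  rw [norm_div, norm_pow]

/-- Each term x/m - log(1 + x/m) of the Weierstrass series is expanded in powers of x/m; summing
over m produces ζ(k). As K ≥ 1, the remainders (|x|/m)^{K+1} are summable. The term log x cancels,
so no slit is needed. -/
theorem logGamma_expansion_zero (K : ℕ) (hK : 1 ≤ K) : ∃ C : ℝ, 0 ≤ C ∧ ∀ x : ℂ, ‖x‖ ≤ 1 / 2 →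
    ‖logGamma x - (-Complex.log x - Real.eulerMascheroniConstant * x +
      ∑ k ∈ Finset.Icc 2 K, riemannZeta k * (-x) ^ k / (k : ℂ))‖ ≤ C * ‖x‖ ^ (K + 1) := by
  have hsum2 : Summable fun n : ℕ => 1 / ((n : ℝ) + 1) ^ 2 := summable_logGamma_bound 1
  refine ⟨2 * ∑' n : ℕ, 1 / ((n : ℝ) + 1) ^ 2, by positivity, fun x hx => ?_⟩
  have hzeta : ∀ k ∈ Finset.Icc 2 K, HasSum (fun n : ℕ => (-(x / ((n : ℂ) + 1))) ^ k / (k : ℂ))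
      (riemannZeta k * (-x) ^ k / (k : ℂ)) := by
    intro k hk
    have hk2 := (Finset.mem_Icc.1 hk).1
    have hs : Summable fun n : ℕ => 1 / (n : ℂ) ^ k := by
      have h1 := Real.summable_one_div_nat_pow.2 (show 1 < k by omega)
      have h2 := Complex.hasSum_ofReal.2 h1.hasSum
      exact h2.summable.congr fun n => by push_cast; rfl
    have h3 := hs.hasSum
    rw [← zeta_nat_eq_tsum_of_gt_one (by omega)] at h3
    have h4 := (hasSum_nat_add_iff' 1).2 h3
    simp only [Finset.range_one, Finset.sum_singleton, Nat.cast_zero,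
      zero_pow (show k ≠ 0 by omega), div_zero, sub_zero] at h4
    refine ((h4.mul_right ((-x) ^ k)).div_const (k : ℂ)).congr_fun fun n => ?_
    rw [← neg_div, div_pow]
    push_cast
    ring
  have hall := ((summable_logGamma x).hasSum.sub (hasSum_sum hzeta))
  have e : logGamma x - (-Complex.log x - Real.eulerMascheroniConstant * x +
      ∑ k ∈ Finset.Icc 2 K, riemannZeta k * (-x) ^ k / (k : ℂ)) =
      ∑' n : ℕ, (x / ((n : ℂ) + 1) - Complex.log (1 + x / ((n : ℂ) + 1))) -
        ∑ k ∈ Finset.Icc 2 K, riemannZeta k * (-x) ^ k / (k : ℂ) := by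
    rw [logGamma]; ring
  rw [e, ← hall.tsum_eq, mul_assoc, mul_comm _ (‖x‖ ^ (K + 1)), ← mul_assoc, ← tsum_mul_left]
  refine tsum_of_norm_bounded (hsum2.mul_left _).hasSum fun n => ?_
  set z := x / ((n : ℂ) + 1) with hz
  have hn : ‖(n : ℂ) + 1‖ = (n : ℝ) + 1 := by
    rw [← Nat.cast_succ, Complex.norm_natCast]; simp
  have hn1 : (1 : ℝ) ≤ (n : ℝ) + 1 := by linarith [Nat.cast_nonneg (α := ℝ) n]
  have hzn : ‖z‖ = ‖x‖ / ((n : ℝ) + 1) := by rw [hz, norm_div, hn]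
  have hz2 : ‖z‖ ≤ 1 / 2 := by
    rw [hzn]
    exact (div_le_self (norm_nonneg _) hn1).trans hx
  have htaylor : z - Complex.logTaylor (K + 1) z = ∑ k ∈ Finset.Icc 2 K, (-z) ^ k / (k : ℂ) := by
    rw [Complex.logTaylor]
    obtain ⟨j, rfl⟩ : ∃ j, K = j + 1 := ⟨K - 1, by omega⟩
    rw [Finset.sum_range_succ', Finset.sum_range_succ', ← Finset.Ico_add_one_right_eq_Icc,
      Finset.sum_Ico_eq_sum_range, show j + 1 + 1 - 2 = j by omega]
    have : ∑ k ∈ Finset.range j, (-z) ^ (2 + k) / ((2 + k : ℕ) : ℂ) =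
        -∑ k ∈ Finset.range j, (-1) ^ (k + 1 + 1 + 1) * z ^ (k + 1 + 1) / ((k + 1 + 1 : ℕ) : ℂ) := by
      rw [← Finset.sum_neg_distrib]
      refine Finset.sum_congr rfl fun k _ => ?_
      rw [neg_pow z, show 2 + k = k + 1 + 1 by ring]
      ring
    rw [this]
    norm_num
  rw [← htaylor, show z - Complex.log (1 + z) - (z - Complex.logTaylor (K + 1) z) =
    -(Complex.log (1 + z) - Complex.logTaylor (K + 1) z) by ring, norm_neg]
  refine (Complex.norm_log_sub_logTaylor_le K (by linarith)).trans ?_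
  have h1 : (1 - ‖z‖)⁻¹ ≤ 2 := by
    rw [inv_le_comm₀ (by linarith) (by norm_num)]; linarith
  have h2 : 0 ≤ (1 - ‖z‖)⁻¹ := inv_nonneg.2 (by linarith)
  have h3 : ‖z‖ ^ (K + 1) ≤ ‖x‖ ^ (K + 1) * (1 / ((n : ℝ) + 1) ^ 2) := by
    rw [hzn, div_pow, div_eq_mul_one_div]
    gcongr
    omega
  calc ‖z‖ ^ (K + 1) * (1 - ‖z‖)⁻¹ / (K + 1) ≤ ‖z‖ ^ (K + 1) * (1 - ‖z‖)⁻¹ :=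
        div_le_self (by positivity) (by linarith [Nat.cast_nonneg (α := ℝ) K])
    _ ≤ (‖x‖ ^ (K + 1) * (1 / ((n : ℝ) + 1) ^ 2)) * 2 := by gcongr
    _ = _ := by ring

/-- Expanding B_{n+1}(xβ^{c-1})β^n by powers of x gives the exponent (c-1)(n+1-k) + n = k - 1 +
c(n+1-k). -/
theorem bernoulliPartialSum_cpow {β : ℂ} (hβ : β ≠ 0) (c : ℝ) (x : ℂ) (P : ℕ) :
    bernoulliPartialSum P β (x * β ^ ((c - 1 : ℝ) : ℂ)) =
      ∑ n ∈ Finset.Icc 1 P, ∑ k ∈ Finset.range (n + 2),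
        (bernoulli k : ℂ) * (bernoulli n : ℂ) * x ^ (n + 1 - k) /
          ((k.factorial : ℂ) * (n : ℂ) * ((n + 1 - k).factorial : ℂ)) *
            β ^ (((k : ℝ) - 1 + c * ((n : ℝ) + 1 - (k : ℝ)) : ℝ) : ℂ) := by
  rw [bernoulliPartialSum]
  refine Finset.sum_congr rfl fun n _ => ?_
  rw [aeval_bernoulli, Finset.mul_sum, Finset.sum_div, Finset.sum_mul]
  refine Finset.sum_congr rfl fun k hk => ?_
  have hk' : k ≤ n + 1 := by have := Finset.mem_range.1 hk; omega
  have h1 : (((n + 1).factorial : ℕ) : ℂ) =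
      ((n + 1).choose k : ℂ) * (k.factorial : ℂ) * ((n + 1 - k).factorial : ℂ) := by
    exact_mod_cast (Nat.choose_mul_factorial_mul_factorial hk').symm
  have h2 : ((n + 1).choose k : ℂ) ≠ 0 := by
    exact_mod_cast (Nat.choose_pos hk').ne'
  have h3 : β ^ (((k : ℝ) - 1 + c * ((n : ℝ) + 1 - (k : ℝ)) : ℝ) : ℂ) =
      (β ^ ((c - 1 : ℝ) : ℂ)) ^ (n + 1 - k) * β ^ n := by
    rw [← Complex.cpow_nat_mul, ← Complex.cpow_natCast, ← Complex.cpow_add _ _ hβ]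
    congr 1
    rw [Nat.cast_sub hk']
    push_cast
    ring
  rw [h1, h3, mul_pow]
  field_simp

/-- Polar form, arranged so that for a = c - 1 the rotation is the one in `logCut` with φ = (1-c)θ.
-/
theorem mul_cpow_eq {θ : ℝ} (hθ : |θ| < Real.pi / 2) {r : ℝ} (hr : 0 < r) (a : ℝ) (x : ℂ) :
    x * (r * Complex.exp (θ * Complex.I)) ^ (a : ℂ) =
      ((r ^ a : ℝ) : ℂ) * (x * Complex.exp (-(((-a * θ : ℝ) : ℂ) * Complex.I))) := by
  have hne : (r * Complex.exp (θ * Complex.I) : ℂ) ≠ 0 := by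
    rw [← norm_pos_iff, norm_ofReal_mul_exp hr]; exact hr
  rw [Complex.cpow_def_of_ne_zero hne, log_real_mul_exp hθ hr, Real.rpow_def_of_pos hr, add_mul,
    Complex.exp_add, Complex.ofReal_exp]
  push_cast
  rw [show -(-(a : ℂ) * θ * Complex.I) = θ * Complex.I * a by ring]
  ring

theorem tendsto_rpow_nhdsGT_zero {a : ℝ} (ha : 0 < a) :
    Tendsto (fun r : ℝ => r ^ a) (𝓝[>] 0) (𝓝 0) := by
  have h := (Real.continuousAt_rpow_const 0 a (Or.inr ha.le)).tendsto
  rw [Real.zero_rpow ha.ne'] at h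
  exact h.mono_left nhdsWithin_le_nhds

/-- No multiple of 2πi appears, even for |(1-c)θ| ≥ π: the normalization of `logCut` makes the
principal logarithm of X split exactly. -/
theorem log_mul_cpow {θ : ℝ} (hθ : |θ| < Real.pi / 2) {c : ℝ} {x : ℂ} (hx : x ≠ 0) {r : ℝ}
    (hr : 0 < r) :
    Complex.log (x * (r * Complex.exp (θ * Complex.I)) ^ ((c - 1 : ℝ) : ℂ)) =
      logCut ((1 - c) * θ) x + (c - 1) * Complex.log (r * Complex.exp (θ * Complex.I)) := by
  rw [mul_cpow_eq hθ hr, Complex.log_ofReal_mul (Real.rpow_pos_of_pos hr _)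
    (mul_ne_zero hx (Complex.exp_ne_zero _)), log_real_mul_exp hθ hr, Real.log_rpow hr, logCut,
    neg_sub]
  push_cast
  ring

theorem norm_mul_cpow {θ : ℝ} {r : ℝ} (hr : 0 < r) (a : ℝ) (x : ℂ) :
    ‖x * (r * Complex.exp (θ * Complex.I)) ^ (a : ℂ)‖ = r ^ a * ‖x‖ := by
  rw [norm_mul, Complex.norm_cpow_real, norm_ofReal_mul_exp hr, mul_comm]

/-- As β → 0 with fixed argument, X moves along a single ray, which avoids the negative axis exactly
when x avoids its rotated cut. -/
theorem mul_cpow_mem_sector {θ : ℝ} (hθ : |θ| < Real.pi / 2) {c : ℝ} {x : ℂ}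
    (hx : ∀ t : ℝ, 0 ≤ t → x ≠ -(t * Complex.exp (((1 - c) * θ : ℝ) * Complex.I))) :
    ∃ κ : ℝ, 0 < κ ∧ ∀ r : ℝ, 0 < r →
      x * (r * Complex.exp (θ * Complex.I)) ^ ((c - 1 : ℝ) : ℂ) ∈ Complex.slitPlane ∧
      InSector κ (x * (r * Complex.exp (θ * Complex.I)) ^ ((c - 1 : ℝ) : ℂ)) := by
  have h1 := mem_slitPlane_of_avoid hx
  obtain ⟨κ, hκ, -, h2⟩ := exists_inSector h1
  refine ⟨κ, hκ, fun r hr => ?_⟩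
  rw [mul_cpow_eq hθ hr, neg_sub]
  exact ⟨ofReal_mul_mem_slitPlane h1 (Real.rpow_pos_of_pos hr _),
    h2 _ (Real.rpow_pos_of_pos hr _)⟩

theorem eventually_norm_qPochhammerRemainder_le {θ : ℝ} (hθ : |θ| < Real.pi / 2) {c : ℝ}
    (hc : 0 < c) {x : ℂ}
    (hx : ∀ t : ℝ, 0 ≤ t → x ≠ -(t * Complex.exp (((1 - c) * θ : ℝ) * Complex.I))) (N : ℕ) :
    ∃ C : ℝ, 0 ≤ C ∧ ∀ᶠ r : ℝ in 𝓝[>] 0,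
      ‖qPochhammerRemainder N (r * Complex.exp (θ * Complex.I))
        (x * (r * Complex.exp (θ * Complex.I)) ^ ((c - 1 : ℝ) : ℂ))‖ ≤
        C * (r ^ (N + 1) * (1 + r ^ (c - 1) * ‖x‖) ^ (N + 2)) := by
  obtain ⟨κ, hκ, hsec⟩ := mul_cpow_mem_sector hθ hx
  obtain ⟨C, ε, hC0, hε, hC⟩ := exists_norm_qPochhammerRemainder_le hθ hκ N
  refine ⟨C, hC0, ?_⟩
  have h1 : ∀ᶠ r : ℝ in 𝓝[>] 0, r < ε := nhdsWithin_le_nhds (Iio_mem_nhds hε)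
  -- This is r|X| = r^c|x|, small because c > 0.
  have h2 : ∀ᶠ r : ℝ in 𝓝[>] 0, r ^ c * ‖x‖ < ε := by
    have h3 := (tendsto_rpow_nhdsGT_zero hc).mul_const ‖x‖
    rw [zero_mul] at h3
    exact h3.eventually_lt_const hε
  filter_upwards [h1, h2, self_mem_nhdsWithin] with r hrε hrc hr
  have hr0 : (0 : ℝ) < r := hr
  have h4 := hC r _ hr0 hrε (hsec r hr0).1 (hsec r hr0).2
  rw [norm_mul_cpow hr0] at h4
  refine h4 ?_
  rw [← mul_assoc, Real.rpow_sub_one hr0.ne', mul_div_cancel₀ _ hr0.ne']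
  exact hrc

/-! ### The cases c = 1, 0 < c < 1 and c > 1. -/

theorem logQPochhammer_isBigO_of_eq_one {θ : ℝ} (hθ : |θ| < Real.pi / 2) {x : ℂ}
    (hx : ∀ t : ℝ, 0 ≤ t → x ≠ -(t : ℂ)) (N : ℕ) :
    (fun β : ℂ => logQPochhammer β (x * β) -
          (-(Real.pi : ℂ) ^ 2 / 6 * β⁻¹ + (1 / 2 - x) * Complex.log β - logGamma x
            + 1 / 2 * (Real.log (2 * Real.pi) : ℂ)
            - ∑ n ∈ Finset.Icc 1 N,
                (bernoulli n : ℂ) * Polynomial.aeval x (Polynomial.bernoulli (n + 1)) /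
                  ((n : ℂ) * ((n + 1).factorial : ℂ)) * β ^ n))
        =O[argRay θ] fun β : ℂ => ‖β‖ ^ ((N : ℝ) + 1) := by
  obtain ⟨C, hC0, hC⟩ := eventually_norm_qPochhammerRemainder_le hθ one_pos (x := x)
    (fun t ht => by simpa using hx t ht) N
  refine isBigO_argRay_of_eventually (C := C * (1 + ‖x‖) ^ (N + 2)) ?_
  filter_upwards [hC, self_mem_nhdsWithin] with r h hr
  have hr0 : (0 : ℝ) < r := hr
  rw [norm_ofReal_mul_exp hr0, abs_of_nonneg (by positivity), ← Nat.cast_succ, Real.rpow_natCast]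
  simp only [sub_self, Real.rpow_zero, Complex.ofReal_zero, Complex.cpow_zero, mul_one,
    one_mul] at h
  refine h.trans (le_of_eq ?_)
  rw [Nat.succ_eq_add_one]
  ring

/-- Here |X| = r^{c-1}|x| → ∞. The Bernoulli error r^{P+1}|X|^{P+2} has exponent c(P+2) - 1 in r,
and the Stirling error |X|^{-(2M+1)} has exponent (1-c)(2M+1). -/
theorem logQPochhammer_isBigO_of_lt_one {θ : ℝ} (hθ : |θ| < Real.pi / 2) {c : ℝ} (hc : 0 < c)
    (hc1 : c < 1) {x : ℂ}
    (hx : ∀ t : ℝ, 0 ≤ t → x ≠ -(t * Complex.exp (((1 - c) * θ : ℝ) * Complex.I))) (M P : ℕ) :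
    (fun β : ℂ => logQPochhammer β (x * β ^ (c : ℂ)) -
          (-(Real.pi : ℂ) ^ 2 / 6 * β⁻¹
            + x * (1 - logCut ((1 - c) * θ) x - c * Complex.log β) * β ^ ((c - 1 : ℝ) : ℂ)
            + c / 2 * Complex.log β + 1 / 2 * logCut ((1 - c) * θ) x
            - ∑ k ∈ Finset.Icc 1 M,
                (bernoulli (2 * k) : ℂ) / (2 * (k : ℂ) * (2 * (k : ℂ) - 1) * x ^ (2 * k - 1)) *
                  β ^ (((1 - c) * (2 * (k : ℝ) - 1) : ℝ) : ℂ)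
            - ∑ n ∈ Finset.Icc 1 P, ∑ k ∈ Finset.range (n + 2),
                (bernoulli k : ℂ) * (bernoulli n : ℂ) * x ^ (n + 1 - k) /
                  ((k.factorial : ℂ) * (n : ℂ) * ((n + 1 - k).factorial : ℂ)) *
                  β ^ (((1 - c) * ((k : ℝ) - 1) + c * (n : ℝ) : ℝ) : ℂ)))
        =O[argRay θ] fun β : ℂ =>
          ‖β‖ ^ (min ((1 - c) * (2 * (M : ℝ) + 1)) (c * ((P : ℝ) + 2) - 1)) := by
  have hx0 : x ≠ 0 := by simpa using hx 0 le_rfl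
  have hxn : 0 < ‖x‖ := norm_pos_iff.2 hx0
  obtain ⟨κ, hκ, hsec⟩ := mul_cpow_mem_sector hθ hx
  obtain ⟨A, hA0, hA⟩ := eventually_norm_qPochhammerRemainder_le hθ hc hx P
  obtain ⟨B, hB0, hB⟩ := logGamma_stirling_even hκ M
  refine isBigO_argRay_of_eventually (C := A * (2 * ‖x‖) ^ (P + 2) + B / ‖x‖ ^ (2 * M + 1)) ?_
  have h1 : ∀ᶠ r : ℝ in 𝓝[>] 0, r < 1 := nhdsWithin_le_nhds (Iio_mem_nhds one_pos)
  have h2 : ∀ᶠ r : ℝ in 𝓝[>] 0, r ^ (1 - c) < ‖x‖ :=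
    (tendsto_rpow_nhdsGT_zero (by linarith)).eventually_lt_const hxn
  filter_upwards [hA, h1, h2, self_mem_nhdsWithin] with r hAr hr1 hrc hr
  have hr0 : (0 : ℝ) < r := hr
  have hlog := log_mul_cpow hθ hx0 hr0 (c := c)
  have hXn := norm_mul_cpow (θ := θ) hr0 (c - 1) x
  have hβn := norm_ofReal_mul_exp hr0 θ
  obtain ⟨hX, hXsec⟩ := hsec r hr0
  set β : ℂ := r * Complex.exp (θ * Complex.I) with hβ
  have hβ0 : β ≠ 0 := by rw [← norm_pos_iff, hβn]; exact hr0
  set Y : ℂ := β ^ ((c - 1 : ℝ) : ℂ) with hY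
  have hrr : r ^ (c - 1) * r ^ (1 - c) = 1 := by
    rw [← Real.rpow_add hr0]; simp
  have hX1 : 1 ≤ r ^ (c - 1) * ‖x‖ :=
    hrr.ge.trans (mul_le_mul_of_nonneg_left hrc.le (Real.rpow_nonneg hr0.le _))
  have hcpow : β ^ (c : ℂ) = Y * β := by
    rw [hY]
    nth_rewrite 3 [← Complex.cpow_one β]
    rw [← Complex.cpow_add _ _ hβ0]
    congr 1
    push_cast
    ring
  have hsum1 : ∑ k ∈ Finset.Icc 1 M,
      (bernoulli (2 * k) : ℂ) / (2 * (k : ℂ) * (2 * (k : ℂ) - 1) * x ^ (2 * k - 1)) *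
        β ^ (((1 - c) * (2 * (k : ℝ) - 1) : ℝ) : ℂ) =
      ∑ k ∈ Finset.Icc 1 M, (bernoulli (2 * k) : ℂ) /
          (2 * (k : ℂ) * (2 * (k : ℂ) - 1) * (x * Y) ^ (2 * k - 1)) := by
    refine Finset.sum_congr rfl fun k hk => ?_
    have hk1 := (Finset.mem_Icc.1 hk).1
    have e : β ^ (((1 - c) * (2 * (k : ℝ) - 1) : ℝ) : ℂ) = (Y ^ (2 * k - 1))⁻¹ := by
      rw [hY, ← Complex.cpow_nat_mul, ← Complex.cpow_neg]
      congr 1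
      rw [Nat.cast_sub (by omega)]
      push_cast
      ring
    rw [e, mul_pow, ← mul_assoc, div_mul_eq_div_div _ _ (Y ^ (2 * k - 1)), ← div_eq_mul_inv]
  have hsum2 : ∑ n ∈ Finset.Icc 1 P, ∑ k ∈ Finset.range (n + 2),
      (bernoulli k : ℂ) * (bernoulli n : ℂ) * x ^ (n + 1 - k) /
        ((k.factorial : ℂ) * (n : ℂ) * ((n + 1 - k).factorial : ℂ)) *
        β ^ (((1 - c) * ((k : ℝ) - 1) + c * (n : ℝ) : ℝ) : ℂ) =
      bernoulliPartialSum P β (x * Y) := by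
    rw [hY, bernoulliPartialSum_cpow hβ0]
    refine Finset.sum_congr rfl fun n _ => Finset.sum_congr rfl fun k _ => ?_
    congr 3
    ring
  rw [hsum1, hsum2, hcpow, ← mul_assoc]
  have hBX := hB _ hX hXsec (by rw [hXn]; exact hX1)
  -- By log X = log x + (c-1) log β, the logarithms combine to (1/2 - X)(log x + c log β), and the
  -- two constants ½ log 2π cancel.
  have hid : logQPochhammer β (x * Y * β) - (-(Real.pi : ℂ) ^ 2 / 6 * β⁻¹
            + x * (1 - logCut ((1 - c) * θ) x - c * Complex.log β) * Y
            + c / 2 * Complex.log β + 1 / 2 * logCut ((1 - c) * θ) x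
            - ∑ k ∈ Finset.Icc 1 M, (bernoulli (2 * k) : ℂ) /
                (2 * (k : ℂ) * (2 * (k : ℂ) - 1) * (x * Y) ^ (2 * k - 1))
            - bernoulliPartialSum P β (x * Y)) =
      qPochhammerRemainder P β (x * Y) -
        (logGamma (x * Y) - (1 / 2 * (Real.log (2 * Real.pi) : ℂ) +
          (x * Y - 1 / 2) * Complex.log (x * Y) - x * Y +
          ∑ k ∈ Finset.Icc 1 M, (bernoulli (2 * k) : ℂ) /
            (2 * (k : ℂ) * (2 * (k : ℂ) - 1) * (x * Y) ^ (2 * k - 1)))) := by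
    rw [hlog, qPochhammerRemainder]
    ring
  rw [hid, hβn, abs_of_nonneg (by positivity), add_mul]
  refine (norm_sub_le _ _).trans (add_le_add ?_ ?_)
  · refine hAr.trans ?_
    calc A * (r ^ (P + 1) * (1 + r ^ (c - 1) * ‖x‖) ^ (P + 2))
        ≤ A * (r ^ (P + 1) * (r ^ (c - 1) * ‖x‖ + r ^ (c - 1) * ‖x‖) ^ (P + 2)) := by gcongr
      _ = A * (2 * ‖x‖) ^ (P + 2) * (r ^ (P + 1) * (r ^ (c - 1)) ^ (P + 2)) := by
          rw [← two_mul, show 2 * (r ^ (c - 1) * ‖x‖) = (2 * ‖x‖) * r ^ (c - 1) by ring, mul_pow]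
          ring
      _ = A * (2 * ‖x‖) ^ (P + 2) * r ^ (c * ((P : ℝ) + 2) - 1) := by
          congr 1
          rw [← Real.rpow_natCast, ← Real.rpow_natCast, ← Real.rpow_mul hr0.le,
            ← Real.rpow_add hr0]
          congr 1
          push_cast
          ring
      _ ≤ _ := by
          refine mul_le_mul_of_nonneg_left ?_ (by positivity)
          exact Real.rpow_le_rpow_of_exponent_ge hr0 hr1.le (min_le_right _ _)
  · refine hBX.trans ?_
    rw [hXn]
    calc B / (r ^ (c - 1) * ‖x‖) ^ (2 * M + 1)
        = B / ‖x‖ ^ (2 * M + 1) * (r ^ (1 - c)) ^ (2 * M + 1) := by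
          have : r ^ (1 - c) = (r ^ (c - 1))⁻¹ := eq_inv_of_mul_eq_one_right hrr
          rw [this, mul_pow, inv_pow]
          field_simp
      _ = B / ‖x‖ ^ (2 * M + 1) * r ^ ((1 - c) * (2 * (M : ℝ) + 1)) := by
          congr 1
          rw [← Real.rpow_natCast, ← Real.rpow_mul hr0.le]
          push_cast
          rfl
      _ ≤ _ := by
          refine mul_le_mul_of_nonneg_left ?_ (by positivity)
          exact Real.rpow_le_rpow_of_exponent_ge hr0 hr1.le (min_le_left _ _)

/-- Here X → 0, so 1 + |X| ≤ 2 and the Bernoulli error is O(r^{P+1}); the expansion of log Γ at 0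
contributes O(|X|^{K+1}). -/
theorem logQPochhammer_isBigO_of_one_lt {θ : ℝ} (hθ : |θ| < Real.pi / 2) {c : ℝ} (hc : 1 < c)
    {x : ℂ}
    (hx : ∀ t : ℝ, 0 ≤ t → x ≠ -(t * Complex.exp (((1 - c) * θ : ℝ) * Complex.I))) {K : ℕ}
    (hK : 1 ≤ K) (P : ℕ) :
    (fun β : ℂ => logQPochhammer β (x * β ^ (c : ℂ)) -
          (-(Real.pi : ℂ) ^ 2 / 6 * β⁻¹ + (c - 1 / 2) * Complex.log β
            + logCut ((1 - c) * θ) x + 1 / 2 * (Real.log (2 * Real.pi) : ℂ)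
            + x * ((Real.eulerMascheroniConstant : ℂ) - Complex.log β) * β ^ ((c - 1 : ℝ) : ℂ)
            - ∑ k ∈ Finset.Icc 2 K,
                riemannZeta k * (-x) ^ k / (k : ℂ) * β ^ (((c - 1) * (k : ℝ) : ℝ) : ℂ)
            - ∑ n ∈ Finset.Icc 1 P, ∑ k ∈ Finset.range (n + 2),
                (bernoulli k : ℂ) * (bernoulli n : ℂ) * x ^ (n + 1 - k) /
                  ((k.factorial : ℂ) * (n : ℂ) * ((n + 1 - k).factorial : ℂ)) *
                  β ^ (((k : ℝ) - 1 + c * ((n : ℝ) + 1 - (k : ℝ)) : ℝ) : ℂ)))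
        =O[argRay θ] fun β : ℂ =>
          ‖β‖ ^ (min ((c - 1) * ((K : ℝ) + 1)) ((P : ℝ) + 1)) := by
  have hx0 : x ≠ 0 := by simpa using hx 0 le_rfl
  obtain ⟨A, hA0, hA⟩ := eventually_norm_qPochhammerRemainder_le hθ (by linarith) hx P
  obtain ⟨B, hB0, hB⟩ := logGamma_expansion_zero K hK
  refine isBigO_argRay_of_eventually (C := A * 2 ^ (P + 2) + B * ‖x‖ ^ (K + 1)) ?_
  have h1 : ∀ᶠ r : ℝ in 𝓝[>] 0, r < 1 := nhdsWithin_le_nhds (Iio_mem_nhds one_pos)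
  have h2 : ∀ᶠ r : ℝ in 𝓝[>] 0, r ^ (c - 1) * ‖x‖ < 1 / 2 := by
    have h3 := (tendsto_rpow_nhdsGT_zero (show 0 < c - 1 by linarith)).mul_const ‖x‖
    rw [zero_mul] at h3
    exact h3.eventually_lt_const (by norm_num)
  filter_upwards [hA, h1, h2, self_mem_nhdsWithin] with r hAr hr1 hrc hr
  have hr0 : (0 : ℝ) < r := hr
  have hlog := log_mul_cpow hθ hx0 hr0 (c := c)
  have hXn := norm_mul_cpow (θ := θ) hr0 (c - 1) x
  have hβn := norm_ofReal_mul_exp hr0 θ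
  set β : ℂ := r * Complex.exp (θ * Complex.I) with hβ
  have hβ0 : β ≠ 0 := by rw [← norm_pos_iff, hβn]; exact hr0
  rw [← bernoulliPartialSum_cpow hβ0]
  set Y : ℂ := β ^ ((c - 1 : ℝ) : ℂ) with hY
  have hcpow : β ^ (c : ℂ) = Y * β := by
    rw [hY]
    nth_rewrite 3 [← Complex.cpow_one β]
    rw [← Complex.cpow_add _ _ hβ0]
    congr 1
    push_cast
    ring
  have hsum1 : ∑ k ∈ Finset.Icc 2 K,
      riemannZeta k * (-x) ^ k / (k : ℂ) * β ^ (((c - 1) * (k : ℝ) : ℝ) : ℂ) =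
      ∑ k ∈ Finset.Icc 2 K, riemannZeta k * (-(x * Y)) ^ k / (k : ℂ) := by
    refine Finset.sum_congr rfl fun k _ => ?_
    have e : β ^ (((c - 1) * (k : ℝ) : ℝ) : ℂ) = Y ^ k := by
      rw [hY, ← Complex.cpow_mul_nat]
      push_cast
      rfl
    rw [e, ← neg_mul, mul_pow]
    ring
  rw [hsum1, hcpow, ← mul_assoc]
  have hBX := hB (x * Y) (by rw [hXn]; exact hrc.le)
  -- From -log Γ(X) comes log X = log x + (c-1) log β, which with ½ log β gives the coefficient c -
  -- 1/2.
  have hid : logQPochhammer β (x * Y * β) - (-(Real.pi : ℂ) ^ 2 / 6 * β⁻¹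
            + (c - 1 / 2) * Complex.log β
            + logCut ((1 - c) * θ) x + 1 / 2 * (Real.log (2 * Real.pi) : ℂ)
            + x * ((Real.eulerMascheroniConstant : ℂ) - Complex.log β) * Y
            - ∑ k ∈ Finset.Icc 2 K, riemannZeta k * (-(x * Y)) ^ k / (k : ℂ)
            - bernoulliPartialSum P β (x * Y)) =
      qPochhammerRemainder P β (x * Y) -
        (logGamma (x * Y) - (-Complex.log (x * Y) - Real.eulerMascheroniConstant * (x * Y) +
          ∑ k ∈ Finset.Icc 2 K, riemannZeta k * (-(x * Y)) ^ k / (k : ℂ))) := by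
    rw [hlog, qPochhammerRemainder]
    ring
  rw [hid, hβn, abs_of_nonneg (by positivity), add_mul]
  refine (norm_sub_le _ _).trans (add_le_add ?_ ?_)
  · refine hAr.trans ?_
    calc A * (r ^ (P + 1) * (1 + r ^ (c - 1) * ‖x‖) ^ (P + 2))
        ≤ A * (r ^ (P + 1) * 2 ^ (P + 2)) := by
          gcongr
          linarith
      _ = A * 2 ^ (P + 2) * r ^ ((P : ℝ) + 1) := by
          rw [← Nat.cast_succ, Real.rpow_natCast, Nat.succ_eq_add_one]
          ring
      _ ≤ _ := by
          refine mul_le_mul_of_nonneg_left ?_ (by positivity)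
          exact Real.rpow_le_rpow_of_exponent_ge hr0 hr1.le (min_le_right _ _)
  · refine hBX.trans ?_
    rw [hXn]
    calc B * (r ^ (c - 1) * ‖x‖) ^ (K + 1)
        = B * ‖x‖ ^ (K + 1) * r ^ ((c - 1) * ((K : ℝ) + 1)) := by
          rw [Real.rpow_mul hr0.le, ← Nat.cast_succ, Real.rpow_natCast, Nat.succ_eq_add_one]
          ring
      _ ≤ _ := by
          refine mul_le_mul_of_nonneg_left ?_ (by positivity)
          exact Real.rpow_le_rpow_of_exponent_ge hr0 hr1.le (min_le_left _ _)

theorem mainTheorem4 (θ : ℝ) (hθ : |θ| < Real.pi / 2) (c : ℝ) (x : ℂ)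
    (F : ℂ → ℂ) (hF : ∀ β : ℂ, F β = logQPochhammer β (x * β ^ (c : ℂ))) :
    -- the case `c = 0`
    (c = 0 → x ∈ slitDomain (Complex.exp (θ * Complex.I)) →
      ∀ N : ℕ,
        (fun β : ℂ => F β -
          ∑ k ∈ Finset.range (N + 1),
            (-1 : ℂ) ^ ((k : ℤ) - 1) * (bernoulli k : ℂ) *
              polylogExp (Complex.exp (θ * Complex.I)) (2 - (k : ℤ)) x / (k.factorial : ℂ) *
              β ^ ((k : ℤ) - 1))
        =O[argRay θ] fun β : ℂ => ‖β‖ ^ (N : ℝ)) ∧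
    -- the case `0 < c < 1`
    (0 < c → c < 1 →
      (∀ t : ℝ, 0 ≤ t → x ≠ -(t * Complex.exp (((1 - c) * θ : ℝ) * Complex.I))) →
      ∀ M P : ℕ,
        (fun β : ℂ => F β -
          (-(Real.pi : ℂ) ^ 2 / 6 * β⁻¹
            + x * (1 - logCut ((1 - c) * θ) x - c * Complex.log β) * β ^ ((c - 1 : ℝ) : ℂ)
            + c / 2 * Complex.log β + 1 / 2 * logCut ((1 - c) * θ) x
            - ∑ k ∈ Finset.Icc 1 M,
                (bernoulli (2 * k) : ℂ) / (2 * (k : ℂ) * (2 * (k : ℂ) - 1) * x ^ (2 * k - 1)) *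
                  β ^ (((1 - c) * (2 * (k : ℝ) - 1) : ℝ) : ℂ)
            - ∑ n ∈ Finset.Icc 1 P, ∑ k ∈ Finset.range (n + 2),
                (bernoulli k : ℂ) * (bernoulli n : ℂ) * x ^ (n + 1 - k) /
                  ((k.factorial : ℂ) * (n : ℂ) * ((n + 1 - k).factorial : ℂ)) *
                  β ^ (((1 - c) * ((k : ℝ) - 1) + c * (n : ℝ) : ℝ) : ℂ)))
        =O[argRay θ] fun β : ℂ =>
          ‖β‖ ^ (min ((1 - c) * (2 * (M : ℝ) + 1)) (c * ((P : ℝ) + 2) - 1))) ∧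
    -- the case `c = 1`
    (c = 1 → (∀ t : ℝ, 0 ≤ t → x ≠ -(t : ℂ)) →
      ∀ N : ℕ,
        (fun β : ℂ => F β -
          (-(Real.pi : ℂ) ^ 2 / 6 * β⁻¹ + (1 / 2 - x) * Complex.log β - logGamma x
            + 1 / 2 * (Real.log (2 * Real.pi) : ℂ)
            - ∑ n ∈ Finset.Icc 1 N,
                (bernoulli n : ℂ) * Polynomial.aeval x (Polynomial.bernoulli (n + 1)) /
                  ((n : ℂ) * ((n + 1).factorial : ℂ)) * β ^ n))
        =O[argRay θ] fun β : ℂ => ‖β‖ ^ ((N : ℝ) + 1)) ∧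
    -- the case `c > 1`
    (1 < c →
      (∀ t : ℝ, 0 ≤ t → x ≠ -(t * Complex.exp (((1 - c) * θ : ℝ) * Complex.I))) →
      ∀ K P : ℕ, 1 ≤ K →
        (fun β : ℂ => F β -
          (-(Real.pi : ℂ) ^ 2 / 6 * β⁻¹ + (c - 1 / 2) * Complex.log β
            + logCut ((1 - c) * θ) x + 1 / 2 * (Real.log (2 * Real.pi) : ℂ)
            + x * ((Real.eulerMascheroniConstant : ℂ) - Complex.log β) * β ^ ((c - 1 : ℝ) : ℂ)
            - ∑ k ∈ Finset.Icc 2 K,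
                riemannZeta k * (-x) ^ k / (k : ℂ) * β ^ (((c - 1) * (k : ℝ) : ℝ) : ℂ)
            - ∑ n ∈ Finset.Icc 1 P, ∑ k ∈ Finset.range (n + 2),
                (bernoulli k : ℂ) * (bernoulli n : ℂ) * x ^ (n + 1 - k) /
                  ((k.factorial : ℂ) * (n : ℂ) * ((n + 1 - k).factorial : ℂ)) *
                  β ^ (((k : ℝ) - 1 + c * ((n : ℝ) + 1 - (k : ℝ)) : ℝ) : ℂ)))
        =O[argRay θ] fun β : ℂ =>
          ‖β‖ ^ (min ((c - 1) * ((K : ℝ) + 1)) ((P : ℝ) + 1))) := by 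
  obtain rfl : F = fun β => logQPochhammer β (x * β ^ (c : ℂ)) := funext hF
  refine ⟨?_, ?_, ?_, ?_⟩
  · rintro rfl hx N
    simpa only [Complex.ofReal_zero, Complex.cpow_zero, mul_one] using
      logQPochhammer_isBigO_of_fixed hθ hx N
  · intro hc hc1 hx M P
    exact logQPochhammer_isBigO_of_lt_one hθ hc hc1 hx M P
  · rintro rfl hx N
    simpa only [Complex.ofReal_one, Complex.cpow_one] using
      logQPochhammer_isBigO_of_eq_one hθ hx N
  · intro hc hx K P hK
    exact logQPochhammer_isBigO_of_one_lt hθ hc hx hK P
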